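/- Let $G=(V,E)$ be a finite simple graph with $n=|V|$ and $m=|E|$. For $v\in V$ let $N_G[v]$ be the set consisting of $v$ and its neighbours, and for an edge $e=xy$ let $N_G[e]=N_G[x]\cup N_G[y]$. A set $L\subseteq V$ is a liar's vertex-edge dominating set of $G$ if $|N_G[e]\cap L|\ge 2$ for every $e\in E$ and $|(N_G[e]\cup N_G[f])\cap L|\ge 3$ for every pair of distinct edges $e,f\in E$. A cut vertex of a graph is a vertex whose removal increases the number of connected components; a block of $G$ is a maximal connected subgraph that has no cut vertex of its own; $G$ is a block graph if each of its blocks is a complete graph. Theorem. There is a linear-time algorithm that computes a minimum liar's vertex-edge dominating set of a block graph: there are a single word-RAM program and a constant $c$ such that, for every finite block graph $G$ (connected or not) with vertex set $\{0,\dots,n-1\}$, given by adjacency lists in any order, the program halts after at most $c\,(n+m+1)$ steps, uses only numbers smaller than $(n+m+2)^c$ (that is, words of $O(\log (n+m+2))$ bits), and returns a liar's vertex-edge dominating set of $G$ of minimum cardinality. -/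

import Mathlib

/-! ### Liar's vertex-edge domination -/

namespace LiarVE

variable {V : Type*}

/-- The closed neighbourhood `N_G[v]` of a vertex. -/
def closedNbhd (G : SimpleGraph V) (v : V) : Set V :=
  insert v (G.neighborSet v)

/-- The closed neighbourhood `N_G[e] = N_G[x] ∪ N_G[y]` of an edge `e = xy`. -/
def edgeClosedNbhd (G : SimpleGraph V) (e : Sym2 V) : Set V :=
  {u | ∃ x ∈ e, u ∈ closedNbhd G x}

/-- `L` is a liar's vertex-edge dominating set of `G`. -/
def IsLiarVEDominating (G : SimpleGraph V) (L : Finset V) : Prop :=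
  (∀ e ∈ G.edgeSet, 2 ≤ (edgeClosedNbhd G e ∩ (L : Set V)).ncard) ∧
  (∀ e ∈ G.edgeSet, ∀ f ∈ G.edgeSet, e ≠ f →
    3 ≤ ((edgeClosedNbhd G e ∪ edgeClosedNbhd G f) ∩ (L : Set V)).ncard)

/-- `L` is a liar's vertex-edge dominating set of `G` of minimum cardinality. -/
def IsMinimumLiarVEDominating (G : SimpleGraph V) (L : Finset V) : Prop :=
  IsLiarVEDominating G L ∧ ∀ L' : Finset V, IsLiarVEDominating G L' → L.card ≤ L'.card

/-! ### Block graphs (finite graphs) -/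

/-- Removing `v` from `G` increases the number of connected components. -/
def IsCutVertex (G : SimpleGraph V) (v : V) : Prop :=
  Nat.card G.ConnectedComponent < Nat.card (G.induce {v}ᶜ).ConnectedComponent

/-- A block of `G` is a maximal connected subgraph that has no cut vertex (of its own). -/
def IsBlock (G : SimpleGraph V) (B : G.Subgraph) : Prop :=
  Maximal (fun H : G.Subgraph => H.Connected ∧ ∀ v : H.verts, ¬ IsCutVertex H.coe v) B

/-- Every block of `G` is a complete subgraph. The graph need not be connected. -/
def IsBlockGraph (G : SimpleGraph V) : Prop :=
  ∀ B : G.Subgraph, IsBlock G B → ∀ u ∈ B.verts, ∀ v ∈ B.verts, u ≠ v → B.Adj u v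

end LiarVE

/-! ### A word RAM with a step count

Programs are while-programs over natural-number variables and arrays; a program mentions
finitely many of them. Every primitive operation (reading a constant, a variable or an array cell,
addition, truncated subtraction, a comparison, a logical connective, an assignment, a branching)
takes one step. All numbers that occur have to be smaller than a bound `W`, that is, they have to
fit into a word of `log₂ W` bits; a computation that exceeds the bound has no run. -/

namespace WordRAM

/-- The contents of the variables and of the arrays. -/
structure Store where
  var : ℕ → ℕ
  arr : ℕ → ℕ → ℕ

/-- `σ` with variable `x` set to `k`. -/
def Store.setVar (σ : Store) (x k : ℕ) : Store :=
  { σ with var := Function.update σ.var x k }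

/-- `σ` with cell `i` of array `a` set to `k`. -/
def Store.setArr (σ : Store) (a i k : ℕ) : Store :=
  { σ with arr := Function.update σ.arr a (Function.update (σ.arr a) i k) }

inductive Expr where
  | const (k : ℕ)
  | var (x : ℕ)
  | read (a : ℕ) (i : Expr)
  | add (e f : Expr)
  | sub (e f : Expr)

namespace Expr

def eval (σ : Store) : Expr → ℕ
  | const k => k
  | var x => σ.var x
  | read a i => σ.arr a (i.eval σ)
  | add e f => e.eval σ + f.eval σ
  | sub e f => e.eval σ - f.eval σ

/-- The number of steps that the evaluation takes. -/
def cost : Expr → ℕ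
  | const _ => 1
  | var _ => 1
  | read _ i => i.cost + 1
  | add e f => e.cost + f.cost + 1
  | sub e f => e.cost + f.cost + 1

/-- All values that occur in the evaluation are smaller than `W`. -/
def Fits (W : ℕ) (σ : Store) : Expr → Prop
  | const k => k < W
  | var x => σ.var x < W
  | read a i => i.Fits W σ ∧ σ.arr a (i.eval σ) < W
  | add e f => e.Fits W σ ∧ f.Fits W σ ∧ e.eval σ + f.eval σ < W
  | sub e f => e.Fits W σ ∧ f.Fits W σ

end Expr

inductive Cond where
  | eq (e f : Expr)
  | lt (e f : Expr)
  | not (b : Cond)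
  | and (b d : Cond)

namespace Cond

def Holds (σ : Store) : Cond → Prop
  | eq e f => e.eval σ = f.eval σ
  | lt e f => e.eval σ < f.eval σ
  | not b => ¬ b.Holds σ
  | and b d => b.Holds σ ∧ d.Holds σ

def cost : Cond → ℕ
  | eq e f => e.cost + f.cost + 1
  | lt e f => e.cost + f.cost + 1
  | not b => b.cost + 1
  | and b d => b.cost + d.cost + 1

def Fits (W : ℕ) (σ : Store) : Cond → Prop
  | eq e f => e.Fits W σ ∧ f.Fits W σ
  | lt e f => e.Fits W σ ∧ f.Fits W σ
  | not b => b.Fits W σ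
  | and b d => b.Fits W σ ∧ d.Fits W σ

end Cond

inductive Prog where
  | skip
  | assign (x : ℕ) (e : Expr)
  | write (a : ℕ) (i e : Expr)
  | seq (P Q : Prog)
  | ite (b : Cond) (P Q : Prog)
  | loop (b : Cond) (P : Prog)

/-- `Run W P σ t τ`: started in the store `σ`, the program `P` halts after exactly `t` steps in the
store `τ`, and all numbers that occur on the way are smaller than `W`. `loop b P` repeats `P` while
`b` holds. -/
inductive Run (W : ℕ) : Prog → Store → ℕ → Store → Prop where
  | skip (σ : Store) : Run W Prog.skip σ 1 σ
  | assign (σ : Store) (x : ℕ) (e : Expr) (he : e.Fits W σ) :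
      Run W (Prog.assign x e) σ (e.cost + 1) (σ.setVar x (e.eval σ))
  | write (σ : Store) (a : ℕ) (i e : Expr) (hi : i.Fits W σ) (he : e.Fits W σ) :
      Run W (Prog.write a i e) σ (i.cost + e.cost + 1) (σ.setArr a (i.eval σ) (e.eval σ))
  | seq {P Q : Prog} {σ σ₁ σ₂ : Store} {t₁ t₂ : ℕ} (hP : Run W P σ t₁ σ₁)
      (hQ : Run W Q σ₁ t₂ σ₂) : Run W (Prog.seq P Q) σ (t₁ + t₂) σ₂
  | iteTrue {b : Cond} {P Q : Prog} {σ τ : Store} {t : ℕ} (hf : b.Fits W σ) (hb : b.Holds σ)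
      (hP : Run W P σ t τ) : Run W (Prog.ite b P Q) σ (b.cost + 1 + t) τ
  | iteFalse {b : Cond} {P Q : Prog} {σ τ : Store} {t : ℕ} (hf : b.Fits W σ) (hb : ¬ b.Holds σ)
      (hQ : Run W Q σ t τ) : Run W (Prog.ite b P Q) σ (b.cost + 1 + t) τ
  | loopTrue {b : Cond} {P : Prog} {σ σ₁ σ₂ : Store} {t₁ t₂ : ℕ} (hf : b.Fits W σ)
      (hb : b.Holds σ) (hP : Run W P σ t₁ σ₁) (hL : Run W (Prog.loop b P) σ₁ t₂ σ₂) :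
      Run W (Prog.loop b P) σ (b.cost + 1 + t₁ + t₂) σ₂
  | loopFalse {b : Cond} {P : Prog} {σ : Store} (hf : b.Fits W σ) (hb : ¬ b.Holds σ) :
      Run W (Prog.loop b P) σ (b.cost + 1) σ

/-- The machine is deterministic: a program has at most one run from a given store. -/
theorem Run.deterministic {W : ℕ} {P : Prog} {σ τ τ' : Store} {t t' : ℕ}
    (h : Run W P σ t τ) (h' : Run W P σ t' τ') : t = t' ∧ τ = τ' := by
  induction h generalizing t' τ' with
  | skip => cases h'; exact ⟨rfl, rfl⟩
  | assign => cases h'; exact ⟨rfl, rfl⟩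
  | write => cases h'; exact ⟨rfl, rfl⟩
  | seq _ _ ih₁ ih₂ =>
    cases h' with
    | seq hP hQ =>
      obtain ⟨rfl, rfl⟩ := ih₁ hP
      obtain ⟨rfl, rfl⟩ := ih₂ hQ
      exact ⟨rfl, rfl⟩
  | iteTrue _ hb _ ih =>
    cases h' with
    | iteTrue _ _ hP => obtain ⟨rfl, rfl⟩ := ih hP; exact ⟨rfl, rfl⟩
    | iteFalse _ hb' _ => exact absurd hb hb'
  | iteFalse _ hb _ ih =>
    cases h' with
    | iteTrue _ hb' _ => exact absurd hb' hb
    | iteFalse _ _ hQ => obtain ⟨rfl, rfl⟩ := ih hQ; exact ⟨rfl, rfl⟩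
  | loopTrue _ hb _ _ ih₁ ih₂ =>
    cases h' with
    | loopTrue _ _ hP hL =>
      obtain ⟨rfl, rfl⟩ := ih₁ hP
      obtain ⟨rfl, rfl⟩ := ih₂ hL
      exact ⟨rfl, rfl⟩
    | loopFalse _ hb' => exact absurd hb hb'
  | loopFalse _ hb =>
    cases h' with
    | loopTrue _ hb' _ _ => exact absurd hb' hb
    | loopFalse => exact ⟨rfl, rfl⟩

/-! ### Graphs as input, vertex sets as output -/

/-- `nbrs v` lists the neighbours of `v`, each once, in any order. -/
def IsAdjacencyLists {n : ℕ} (G : SimpleGraph (Fin n)) (nbrs : Fin n → List (Fin n)) : Prop :=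
  ∀ v, (nbrs v).Nodup ∧ ∀ u, u ∈ nbrs v ↔ G.Adj v u

/-- The initial store for a graph given by adjacency lists. Variable `0` holds the number `n` of
vertices, array `1` the concatenation of the lists of the vertices `0, …, n - 1`, and the list of
vertex `v` occupies the cells `i` of array `1` with `(array 0)[v] ≤ i < (array 0)[v + 1]`.
Everything else is `0`. -/
def inputStore {n : ℕ} (nbrs : Fin n → List (Fin n)) : Store where
  var := fun x => if x = 0 then n else 0
  arr := fun a i =>
    if a = 0 then
      if i ≤ n then (((List.finRange n).take i).flatMap nbrs).length else 0
    else if a = 1 then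
      (((List.finRange n).flatMap nbrs).map Fin.val).getD i 0
    else 0

/-- The set of vertices that a store returns: array `2` holds its indicator function. -/
def outputSet (n : ℕ) (σ : Store) : Finset (Fin n) :=
  Finset.univ.filter fun v => σ.arr 2 v.val = 1

end WordRAM

/-! A graph search that enters a new component only when no edge leaves the vertices found so far
numbers the vertices of a block graph so that the earlier neighbours of every vertex `v` form a
clique. Two of them are joined by a walk through vertices numbered before `v`. Hence they lie on a
cycle with `v`, cycles lie in blocks, and blocks are complete (`IsSearchOrder.adj_of_earlier`). For
the same reason, if `v` has at least two earlier neighbours and `p` is the last of them, the others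
are exactly the earlier neighbours of `p` (`IsSearchOrder.isElimination`). The graph is therefore
encoded by a tree of parents with one bit per node; `0` is a virtual root for the vertices without
earlier neighbours.

Merging the nodes `n, …, 1` into their parents rebuilds the graph from single vertices, and at each
time three labels determine the edges between the trees to be merged (`Elim.invariant`,
`treeGraph_isMerge`). First-order types of bounded rank are finite in number and compose under such
unions, by an Ehrenfeucht–Fraïssé argument (`IsMerge.type_eq`). Rank seven suffices here, for the
four ends of two edges and three dominating vertices (`good_of_type_eq`). So a finite tree automaton
that does not depend on the graph recognizes the liar's vertex-edge dominating sets
(`exists_automaton`).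

Minimizing the cardinality over the runs of this automaton is dynamic programming with a constant
number of states (`IsTable.step`, `IsTable.optimal`). The automaton is hard-wired into the program,
so its mere existence is enough. Every loop of the program has a loop-free body and a measure that
is linear in `n + m` (`exists_run_loop`), and all numbers are linear in `n + m` as well. -/

/-! ### Weakest preconditions for loop-free programs, and a rule for loops -/

namespace WordRAM

/-- An upper bound for the number of steps of a loop-free program. -/
def Prog.cost : Prog → ℕ
  | .skip => 1
  | .assign _ e => e.cost + 1
  | .write _ i e => i.cost + e.cost + 1
  | .seq P Q => P.cost + Q.cost
  | .ite b P Q => b.cost + 1 + (P.cost + Q.cost)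
  | .loop _ _ => 0

/-- The weakest precondition of a loop-free program; `False` for loops. -/
def wp (W : ℕ) : Prog → (Store → Prop) → Store → Prop
  | .skip, Q, σ => Q σ
  | .assign x e, Q, σ => e.Fits W σ ∧ Q (σ.setVar x (e.eval σ))
  | .write a i e, Q, σ => i.Fits W σ ∧ e.Fits W σ ∧ Q (σ.setArr a (i.eval σ) (e.eval σ))
  | .seq P R, Q, σ => wp W P (wp W R Q) σ
  | .ite b P R, Q, σ => b.Fits W σ ∧ (b.Holds σ → wp W P Q σ) ∧ (¬ b.Holds σ → wp W R Q σ)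
  | .loop _ _, _, _ => False

theorem wp_mono {W : ℕ} {P : Prog} {Q R : Store → Prop} {σ : Store} (h : wp W P Q σ)
    (hQR : ∀ τ, Q τ → R τ) : wp W P R σ := by
  induction P generalizing Q R σ with
  | skip => exact hQR _ h
  | assign => exact ⟨h.1, hQR _ h.2⟩
  | write => exact ⟨h.1, h.2.1, hQR _ h.2.2⟩
  | seq P P' ih ih' => exact ih h fun τ hτ => ih' hτ hQR
  | ite b P P' ih ih' => exact ⟨h.1, fun hb => ih (h.2.1 hb) hQR, fun hb => ih' (h.2.2 hb) hQR⟩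
  | loop => exact h

theorem wp.run {W : ℕ} {P : Prog} {Q : Store → Prop} {σ : Store} (h : wp W P Q σ) :
    ∃ t τ, Run W P σ t τ ∧ t ≤ P.cost ∧ Q τ := by
  induction P generalizing Q σ with
  | skip => exact ⟨1, σ, .skip σ, le_rfl, h⟩
  | assign x e => exact ⟨_, _, .assign σ x e h.1, le_rfl, h.2⟩
  | write a i e => exact ⟨_, _, .write σ a i e h.1 h.2.1, le_rfl, h.2.2⟩
  | seq P P' ih ih' =>
    obtain ⟨t, τ, hr, ht, hq⟩ := ih h
    obtain ⟨t', τ', hr', ht', hq'⟩ := ih' hq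
    exact ⟨_, _, .seq hr hr', Nat.add_le_add ht ht', hq'⟩
  | ite b P P' ih ih' =>
    by_cases hb : b.Holds σ
    · obtain ⟨t, τ, hr, ht, hq⟩ := ih (h.2.1 hb)
      exact ⟨_, _, .iteTrue h.1 hb hr, by simp only [Prog.cost]; omega, hq⟩
    · obtain ⟨t, τ, hr, ht, hq⟩ := ih' (h.2.2 hb)
      exact ⟨_, _, .iteFalse h.1 hb hr, by simp only [Prog.cost]; omega, hq⟩
  | loop => exact h.elim

/-- A loop with a loop-free body, an invariant and a decreasing measure. -/
theorem exists_run_loop {W : ℕ} {b : Cond} {P : Prog} (I : Store → Prop) (μ : Store → ℕ)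
    (hf : ∀ σ, I σ → b.Fits W σ)
    (hP : ∀ σ, I σ → b.Holds σ → wp W P (fun τ => I τ ∧ μ τ < μ σ) σ) {σ : Store} (hσ : I σ) :
    ∃ t τ, Run W (.loop b P) σ t τ ∧ t ≤ (b.cost + 1 + P.cost) * (μ σ + 1) ∧ I τ ∧ ¬ b.Holds τ := by
  induction hk : μ σ using Nat.strong_induction_on generalizing σ with
  | _ k ih =>
    subst hk
    by_cases hb : b.Holds σ
    · obtain ⟨t, τ, hr, ht, hI, hlt⟩ := (hP σ hσ hb).run
      obtain ⟨t', τ', hr', ht', hI', hb'⟩ := ih _ hlt hI rfl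
      refine ⟨_, τ', .loopTrue (hf σ hσ) hb hr hr', ?_, hI', hb'⟩
      have := Nat.mul_le_mul_left (b.cost + 1 + P.cost) (show μ τ + 1 ≤ μ σ from hlt)
      calc b.cost + 1 + t + t' ≤ (b.cost + 1 + P.cost) + (b.cost + 1 + P.cost) * (μ τ + 1) := by
            omega
        _ ≤ (b.cost + 1 + P.cost) * (μ σ + 1) := by rw [mul_add_one _ (μ σ)]; omega
    · refine ⟨_, σ, .loopFalse (hf σ hσ) hb, ?_, hσ, hb⟩
      calc b.cost + 1 ≤ (b.cost + 1 + P.cost) * 1 := by omega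
        _ ≤ _ := Nat.mul_le_mul_left _ (by omega)

/-- Sequential composition of a list of programs. -/
def seqs : List Prog → Prog
  | [] => .skip
  | P :: l => .seq P (seqs l)

/-- Iterations over the states of the automaton, whose number is a constant, are unrolled into
straight-line code, so that the bodies of loops stay loop-free. The invariant is indexed by the list
of the items treated so far. -/
theorem wp_seqs {W : ℕ} {α : Type*} (I : List α → Store → Prop) (f : α → Prog) (l done : List α)
    (h : ∀ pre, ∀ x ∈ l, ∀ σ, I pre σ → wp W (f x) (I (pre ++ [x])) σ) {σ : Store}
    (hσ : I done σ) : wp W (seqs (l.map f)) (I (done ++ l)) σ := by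
  induction l generalizing done σ with
  | nil => simpa [seqs, wp] using hσ
  | cons x l ih =>
    rw [List.map_cons, seqs, wp]
    refine wp_mono (h done x List.mem_cons_self σ hσ) fun τ hτ => ?_
    have := ih _ (fun pre y hy => h pre y (List.mem_cons_of_mem _ hy)) hτ
    rwa [List.append_assoc] at this

/-- The product of an expression with a constant, by repeated addition. -/
def Expr.mulConst : ℕ → Expr → Expr
  | 0, _ => .const 0
  | k + 1, e => .add (mulConst k e) e

@[simp] theorem Expr.eval_mulConst (k : ℕ) (e : Expr) (σ : Store) :
    (e.mulConst k).eval σ = k * e.eval σ := by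
  induction k with
  | zero => simp [mulConst, eval]
  | succ k ih => simp [mulConst, eval, ih, add_mul]

theorem Expr.fits_mulConst {k : ℕ} {e : Expr} {σ : Store} {W : ℕ} (he : e.Fits W σ)
    (h : k * e.eval σ < W) : (e.mulConst k).Fits W σ := by
  induction k with
  | zero => simpa [mulConst, Fits] using h
  | succ k ih =>
    rw [add_one_mul] at h
    refine ⟨ih (by omega), he, ?_⟩
    simpa using h

@[simp] theorem Store.setVar_var (σ : Store) (x k y : ℕ) :
    (σ.setVar x k).var y = if y = x then k else σ.var y := by
  simp [Store.setVar, Function.update_apply]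

@[simp] theorem Store.setVar_arr (σ : Store) (x k : ℕ) : (σ.setVar x k).arr = σ.arr := rfl

@[simp] theorem Store.setArr_var (σ : Store) (a i k : ℕ) : (σ.setArr a i k).var = σ.var := rfl

@[simp] theorem Store.setArr_arr (σ : Store) (a i k b : ℕ) :
    (σ.setArr a i k).arr b = if b = a then Function.update (σ.arr a) i k else σ.arr b := by
  simp [Store.setArr, Function.update_apply]

end WordRAM

/-! ### Cycles in block graphs -/

namespace LiarVE

variable {V : Type*}

open SimpleGraph

/-- Transfers a walk of `G` to the graph whose components `IsCutVertex` counts, the subgraph `H`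
with `u` deleted. -/
theorem reachable_induce_coe_of_walk {G : SimpleGraph V} (H : G.Subgraph) (u : H.verts) {a b : V}
    (p : G.Walk a b) (hp : p.toSubgraph ≤ H) (hu : u.1 ∉ p.support) (ha : a ∈ H.verts)
    (hb : b ∈ H.verts) (hau : (⟨a, ha⟩ : H.verts) ∈ ({u}ᶜ : Set H.verts))
    (hbu : (⟨b, hb⟩ : H.verts) ∈ ({u}ᶜ : Set H.verts)) :
    (H.coe.induce {u}ᶜ).Reachable ⟨⟨a, ha⟩, hau⟩ ⟨⟨b, hb⟩, hbu⟩ := by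
  induction p with
  | nil => exact Reachable.refl _
  | @cons x y z h p ih =>
    rw [Walk.support_cons, List.mem_cons, not_or] at hu
    have hp' : p.toSubgraph ≤ H := le_trans le_sup_right hp
    have hy : y ∈ H.verts := hp'.1 p.start_mem_verts_toSubgraph
    have hyu : (⟨y, hy⟩ : H.verts) ∈ ({u}ᶜ : Set H.verts) := by
      rintro rfl
      exact hu.2 p.start_mem_support
    refine Reachable.trans (Adj.reachable ?_) (ih hp' hu.2 hy hb hyu hbu)
    have : H.Adj x y := (le_trans le_sup_left hp : G.subgraphOfAdj h ≤ H).2 (by simp)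
    exact this

/-- A cycle minus a vertex is connected: rotated to start at `u`, the cycle is an edge `u w`
followed by a path `q` back to `u`, and initial segments of `q` connect `w` with all other vertices.
-/
theorem not_isCutVertex_toSubgraph_of_isCycle [Finite V] {G : SimpleGraph V} {v : V} {c : G.Walk v v}
    (hc : c.IsCycle) (u : c.toSubgraph.verts) : ¬ IsCutVertex c.toSubgraph.coe u := by
  classical
  have hu : u.1 ∈ c.support := by simpa using u.2
  have hrot : (c.rotate u.1 hu).toSubgraph = c.toSubgraph := c.toSubgraph_rotate hu
  have hcyc := hc.rotate hu
  have hne : ∃ w, ∃ h : G.Adj u.1 w, ∃ q : G.Walk w u.1, c.rotate u.1 hu = .cons h q := by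
    cases hh : c.rotate u.1 hu with
    | nil => rw [hh] at hcyc; exact absurd rfl hcyc.ne_nil
    | cons h q => exact ⟨_, h, q, rfl⟩
  obtain ⟨w, h, q, hq⟩ := hne
  rw [hq] at hrot hcyc
  have hpath := ((Walk.cons_isCycle_iff q h).1 hcyc).1
  have hqH : q.toSubgraph ≤ c.toSubgraph := 
    le_trans (le_sup_right : _ ≤ (Walk.cons h q).toSubgraph) hrot.le
  have hw : w ∈ c.toSubgraph.verts := hqH.1 q.start_mem_verts_toSubgraph
  have hwu : (⟨w, hw⟩ : c.toSubgraph.verts) ∈ ({u}ᶜ : Set c.toSubgraph.verts) := by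
    intro hh
    have : w = u.1 := congrArg Subtype.val hh
    exact h.ne this.symm
  have hreach : ∀ z, (c.toSubgraph.coe.induce {u}ᶜ).Reachable ⟨⟨w, hw⟩, hwu⟩ z := by
    rintro ⟨⟨z, hz⟩, hzu⟩
    have hzne : z ≠ u.1 := fun hh => hzu (Subtype.ext hh)
    have hzq : z ∈ q.support := by
      rw [← hrot] at hz
      rcases (by simpa [hzne] using hz : z = w ∨ z ∈ q.support) with rfl | hz'
      · exact q.start_mem_support
      · exact hz'
    refine reachable_induce_coe_of_walk _ u (q.takeUntil z hzq) ?_ ?_ hw hz hwu hzu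
    · exact le_trans (by
        conv_rhs => rw [← q.take_spec hzq]
        rw [Walk.toSubgraph_append]; exact le_sup_left) hqH
    -- The path `q` ends in `u`, so an initial segment that stops at another vertex misses `u`.
    · intro hmem
      exact Walk.endpoint_notMem_support_takeUntil hpath hzq hzne.symm hmem
  have hsub : Subsingleton (c.toSubgraph.coe.induce {u}ᶜ).ConnectedComponent := by
    refine ⟨fun a b => ?_⟩
    induction a using ConnectedComponent.ind with | _ a
    induction b using ConnectedComponent.ind with | _ b
    exact ConnectedComponent.sound ((hreach a).symm.trans (hreach b))
  unfold IsCutVertex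
  have h1 : Nat.card (c.toSubgraph.coe.induce {u}ᶜ).ConnectedComponent ≤ 1 :=
    Finite.card_le_one_iff_subsingleton.2 hsub
  have h2 : 0 < Nat.card c.toSubgraph.coe.ConnectedComponent :=
    Nat.card_pos_iff.2 ⟨⟨c.toSubgraph.coe.connectedComponentMk u⟩, inferInstance⟩
  omega

/-- By finiteness the cycle extends to a maximal connected subgraph without cut vertices, that is,
to a block. -/
theorem IsBlockGraph.adj_of_isCycle [Finite V] {G : SimpleGraph V} (hG : IsBlockGraph G) {v x y : V}
    {c : G.Walk v v} (hc : c.IsCycle) (hx : x ∈ c.support) (hy : y ∈ c.support) (hxy : x ≠ y) :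
    G.Adj x y := by
  obtain ⟨B, hB, hmax⟩ := (Set.toFinite {H : G.Subgraph | H.Connected ∧
    ∀ v : H.verts, ¬ IsCutVertex H.coe v}).exists_le_maximal (a := c.toSubgraph)
    ⟨c.toSubgraph_connected, not_isCutVertex_toSubgraph_of_isCycle hc⟩
  exact (hG B hmax x (hB.1 (by simpa using hx)) y (hB.1 (by simpa using hy)) hxy).adj_sub

/-- In a block graph two neighbours of `v` that are connected by a walk avoiding `v` are adjacent. -/
theorem IsBlockGraph.adj_of_walk [Finite V] {G : SimpleGraph V} (hG : IsBlockGraph G) {v x y : V}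
    (p : G.Walk x y) (hv : v ∉ p.support) (hx : G.Adj v x) (hy : G.Adj v y) (hxy : x ≠ y) :
    G.Adj x y := by
  classical
  have hv' : v ∉ (p.toPath : G.Walk x y).support := fun h => hv (p.support_toPath_subset_support h)
  have hpath : ((p.toPath : G.Walk x y).concat hy.symm).IsPath :=
    p.toPath.2.concat hv' hy.symm
  -- A path from `x` to `y` that avoids `v` is closed up through `v`; `x ≠ y` keeps the two edges at
  -- `v` apart.
  have hc : (Walk.cons hx ((p.toPath : G.Walk x y).concat hy.symm)).IsCycle := by
    refine (Walk.cons_isCycle_iff _ _).2 ⟨hpath, ?_⟩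
    rw [Walk.edges_concat, List.concat_eq_append, List.mem_append, not_or]
    refine ⟨fun h => hv' (Walk.fst_mem_support_of_mem_edges _ h), ?_⟩
    simp only [List.mem_singleton, Sym2.eq_iff, not_or]
    exact ⟨fun h => hy.ne h.1, fun h => hxy h.2⟩
  exact hG.adj_of_isCycle hc (by simp) (by simp [Walk.support_concat]) hxy

end LiarVE

/-! ### Labelled graphs and their Ehrenfeucht–Fraïssé types

The property of being a liar's vertex-edge dominating set is first-order, of quantifier rank seven.
Types of rank seven of labelled graphs are finite in number, and they are compositional with respect
to disjoint unions with additional edges that depend on the labels only. -/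

namespace LiarVE

/-- A graph on the set `dom` with a distinguished vertex set `sel` and three vertex labels. -/
structure LabelledGraph where
  adj : ℕ → ℕ → Prop
  sel : ℕ → Prop
  dom : ℕ → Prop
  lab : ℕ → Fin 3

namespace LabelledGraph

/-- The types of rank `q` of seven-tuples, some of whose entries may be undefined. -/
def RankType : ℕ → Type
  | 0 => (Fin 7 → Fin 7 → Prop) × (Fin 7 → Fin 7 → Prop) × (Fin 7 → Prop) × (Fin 7 → Fin 3 → Prop)
  | q + 1 => Set (RankType q)

instance finite_rankType (q : ℕ) : Finite (RankType q) := by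
  induction q with
  | zero => unfold RankType; infer_instance
  | succ q ih => unfold RankType; infer_instance

/-- The type of rank `q` of a tuple. A move from rank `q + 1` to rank `q` sets the entry `q`. -/
def rankType (S : LabelledGraph) : (q : ℕ) → (ℕ → Option ℕ) → RankType q
  | 0, a => (fun i j => ∃ u ∈ a i, ∃ w ∈ a j, S.adj u w, fun i j => ∃ u ∈ a i, u ∈ a j,
      fun i => ∃ u ∈ a i, S.sel u, fun i l => ∃ u ∈ a i, S.lab u = l)
  | q + 1, a => {t | ∃ x : Option ℕ, (∀ u ∈ x, S.dom u) ∧ t = rankType S q (Function.update a q x)}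

/-- A type of rank `q + 1` as a set of types of rank `q`. -/
def extensions (S : LabelledGraph) (q : ℕ) (a : ℕ → Option ℕ) : Set (RankType q) :=
  S.rankType (q + 1) a

variable {S S₁ S₂ S' S₁' S₂' : LabelledGraph}

theorem exists_move {q : ℕ} {a a' : ℕ → Option ℕ} (h : S.rankType (q + 1) a = S'.rankType (q + 1) a')
    {x : Option ℕ} (hx : ∀ u ∈ x, S.dom u) : ∃ x' : Option ℕ, (∀ u ∈ x', S'.dom u) ∧
      S.rankType q (Function.update a q x) = S'.rankType q (Function.update a' q x') := by
  have : S.rankType q (Function.update a q x) ∈ S'.extensions q a' := by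
    rw [extensions, ← h]
    exact ⟨x, hx, rfl⟩
  exact this

/-- The remaining moves set only entries below `q`, so entry `i` survives to the atomic type, where
the equality relation of `i` with itself records whether the entry is defined. -/
theorem eq_none_iff {q : ℕ} {a a' : ℕ → Option ℕ} (h : S.rankType q a = S'.rankType q a') {i : ℕ}
    (hi : i < 7) (hq : q ≤ i) : a i = none ↔ a' i = none := by
  induction q generalizing a a' with
  | zero =>
    have := congrFun (congrFun (congrArg (fun t : RankType 0 => t.2.1) h) ⟨i, hi⟩) ⟨i, hi⟩
    simp only [rankType, and_self, eq_iff_iff] at this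
    cases h1 : a i <;> cases h2 : a' i <;> simp_all
  | succ q ih =>
    obtain ⟨x', -, hx'⟩ := exists_move h (x := none) (by simp)
    have := ih hx' (by omega)
    rwa [Function.update_of_ne (by omega), Function.update_of_ne (by omega)] at this

theorem exists_move_some {q : ℕ} (hq : q < 7) {a a' : ℕ → Option ℕ}
    (h : S.rankType (q + 1) a = S'.rankType (q + 1) a') {x : ℕ} (hx : S.dom x) : ∃ x', S'.dom x' ∧
      S.rankType q (Function.update a q (some x)) =
        S'.rankType q (Function.update a' q (some x')) := by
  obtain ⟨x', h1, h2⟩ := exists_move h (x := some x) (by simpa using hx)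
  cases x' with
  | none => have := eq_none_iff h2 hq le_rfl; simp at this
  | some x' => exact ⟨x', h1 _ rfl, h2⟩

theorem move_none {q : ℕ} (hq : q < 7) {a a' : ℕ → Option ℕ}
    (h : S.rankType (q + 1) a = S'.rankType (q + 1) a') :
      S.rankType q (Function.update a q none) = S'.rankType q (Function.update a' q none) := by
  obtain ⟨x', -, h2⟩ := exists_move h (x := none) (by simp)
  cases x' with
  | none => exact h2
  | some x' => have := eq_none_iff h2 hq le_rfl; simp at this

/-- `S` is the disjoint union of `S₁` and `S₂`, with additional edges between vertices with labels
in relation `κ`, and relabelled by `ρ₁` and `ρ₂`. -/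
structure IsMerge (κ : Fin 3 → Fin 3 → Prop) (ρ₁ ρ₂ : Fin 3 → Fin 3) (S₁ S₂ S : LabelledGraph) :
    Prop where
  dom : ∀ x, S.dom x ↔ S₁.dom x ∨ S₂.dom x
  disjoint : ∀ x, S₁.dom x → S₂.dom x → False
  adj_left : ∀ x y, S₁.dom x → S₁.dom y → (S.adj x y ↔ S₁.adj x y)
  adj_right : ∀ x y, S₂.dom x → S₂.dom y → (S.adj x y ↔ S₂.adj x y)
  adj_cross : ∀ x y, S₁.dom x → S₂.dom y → (S.adj x y ↔ κ (S₁.lab x) (S₂.lab y))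
  adj_cross' : ∀ x y, S₁.dom x → S₂.dom y → (S.adj y x ↔ κ (S₁.lab x) (S₂.lab y))
  sel_left : ∀ x, S₁.dom x → (S.sel x ↔ S₁.sel x)
  sel_right : ∀ x, S₂.dom x → (S.sel x ↔ S₂.sel x)
  lab_left : ∀ x, S₁.dom x → S.lab x = ρ₁ (S₁.lab x)
  lab_right : ∀ x, S₂.dom x → S.lab x = ρ₂ (S₂.lab x)

/-- The tuple `a` in a disjoint union consists of `a₁` in the first and `a₂` in the second part. -/
def Splits (S₁ S₂ : LabelledGraph) (a a₁ a₂ : ℕ → Option ℕ) : Prop :=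
  ∀ i, (a i = none ∧ a₁ i = none ∧ a₂ i = none) ∨
    (∃ u, S₁.dom u ∧ a i = some u ∧ a₁ i = some u ∧ a₂ i = none) ∨
    (∃ u, S₂.dom u ∧ a i = some u ∧ a₁ i = none ∧ a₂ i = some u)

theorem Splits.update {a a₁ a₂ : ℕ → Option ℕ} (h : Splits S₁ S₂ a a₁ a₂) (q : ℕ)
    {x x₁ x₂ : Option ℕ} (hx : (x = none ∧ x₁ = none ∧ x₂ = none) ∨
      (∃ u, S₁.dom u ∧ x = some u ∧ x₁ = some u ∧ x₂ = none) ∨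
      (∃ u, S₂.dom u ∧ x = some u ∧ x₁ = none ∧ x₂ = some u)) :
    Splits S₁ S₂ (Function.update a q x) (Function.update a₁ q x₁) (Function.update a₂ q x₂) := by
  intro i
  by_cases hi : i = q
  · subst hi
    simpa using hx
  · simpa [Function.update_of_ne hi] using h i

variable {κ : Fin 3 → Fin 3 → Prop} {ρ₁ ρ₂ : Fin 3 → Fin 3}

/-- The types of the parts show which entries are undefined and in which part the others lie, so
corresponding entries lie in corresponding parts. Atoms inside a part are then known; across the
parts equality fails and adjacency depends on the labels, which the types record. -/
theorem IsMerge.rankType_zero_eq (hS : IsMerge κ ρ₁ ρ₂ S₁ S₂ S) (hS' : IsMerge κ ρ₁ ρ₂ S₁' S₂' S')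
    {a a₁ a₂ a' a₁' a₂' : ℕ → Option ℕ} (ha : Splits S₁ S₂ a a₁ a₂) (ha' : Splits S₁' S₂' a' a₁' a₂')
    (h₁ : S₁.rankType 0 a₁ = S₁'.rankType 0 a₁') (h₂ : S₂.rankType 0 a₂ = S₂'.rankType 0 a₂') :
    S.rankType 0 a = S'.rankType 0 a' := by
  have key : ∀ i : Fin 7, (a i = none ∧ a₁ i = none ∧ a₂ i = none ∧ a' i = none ∧ a₁' i = none ∧
        a₂' i = none) ∨
      (∃ u u', S₁.dom u ∧ S₁'.dom u' ∧ a i = some u ∧ a₁ i = some u ∧ a₂ i = none ∧ a' i = some u' ∧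
        a₁' i = some u' ∧ a₂' i = none) ∨
      (∃ u u', S₂.dom u ∧ S₂'.dom u' ∧ a i = some u ∧ a₁ i = none ∧ a₂ i = some u ∧ a' i = some u' ∧
        a₁' i = none ∧ a₂' i = some u') := by
    intro i
    have e1 := eq_none_iff h₁ i.2 (Nat.zero_le _)
    have e2 := eq_none_iff h₂ i.2 (Nat.zero_le _)
    rcases ha i with h | ⟨u, h⟩ | ⟨u, h⟩ <;> rcases ha' i with h' | ⟨u', h'⟩ | ⟨u', h'⟩ <;> simp_all
  have hl : ∀ (i : Fin 7) l, (∃ u ∈ a₁ i, S₁.lab u = l) ↔ ∃ u ∈ a₁' i, S₁'.lab u = l := fun i l =>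
    (congrFun (congrFun (congrArg (fun t : RankType 0 => t.2.2.2) h₁) i) l).to_iff
  have hl2 : ∀ (i : Fin 7) l, (∃ u ∈ a₂ i, S₂.lab u = l) ↔ ∃ u ∈ a₂' i, S₂'.lab u = l := fun i l =>
    (congrFun (congrFun (congrArg (fun t : RankType 0 => t.2.2.2) h₂) i) l).to_iff
  have hs : ∀ (i : Fin 7), (∃ u ∈ a₁ i, S₁.sel u) ↔ ∃ u ∈ a₁' i, S₁'.sel u := fun i =>
    (congrFun (congrArg (fun t : RankType 0 => t.2.2.1) h₁) i).to_iff
  have hs2 : ∀ (i : Fin 7), (∃ u ∈ a₂ i, S₂.sel u) ↔ ∃ u ∈ a₂' i, S₂'.sel u := fun i =>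
    (congrFun (congrArg (fun t : RankType 0 => t.2.2.1) h₂) i).to_iff
  have he : ∀ (i j : Fin 7), (∃ u ∈ a₁ i, u ∈ a₁ j) ↔ ∃ u ∈ a₁' i, u ∈ a₁' j := fun i j =>
    (congrFun (congrFun (congrArg (fun t : RankType 0 => t.2.1) h₁) i) j).to_iff
  have he2 : ∀ (i j : Fin 7), (∃ u ∈ a₂ i, u ∈ a₂ j) ↔ ∃ u ∈ a₂' i, u ∈ a₂' j := fun i j =>
    (congrFun (congrFun (congrArg (fun t : RankType 0 => t.2.1) h₂) i) j).to_iff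
  have hA : ∀ (i j : Fin 7), (∃ u ∈ a₁ i, ∃ w ∈ a₁ j, S₁.adj u w) ↔
      ∃ u ∈ a₁' i, ∃ w ∈ a₁' j, S₁'.adj u w := fun i j =>
    (congrFun (congrFun (congrArg (fun t : RankType 0 => t.1) h₁) i) j).to_iff
  have hA2 : ∀ (i j : Fin 7), (∃ u ∈ a₂ i, ∃ w ∈ a₂ j, S₂.adj u w) ↔
      ∃ u ∈ a₂' i, ∃ w ∈ a₂' j, S₂'.adj u w := fun i j =>
    (congrFun (congrFun (congrArg (fun t : RankType 0 => t.1) h₂) i) j).to_iff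
  refine Prod.ext (funext₂ fun i j => propext ?_) (Prod.ext (funext₂ fun i j => propext ?_)
    (Prod.ext (funext fun i => propext ?_) (funext₂ fun i l => propext ?_)))
  · rcases key i with hi | ⟨u, u', hi⟩ | ⟨u, u', hi⟩
    · simp [rankType, hi]
    · rcases key j with hj | ⟨w, w', hj⟩ | ⟨w, w', hj⟩
      · simp [rankType, hj]
      · simpa [rankType, hi, hj, hS.adj_left u w hi.1 hj.1, hS'.adj_left u' w' hi.2.1 hj.2.1]
          using hA i j
      · have e1 : S₁'.lab u' = S₁.lab u := by simpa [hi] using hl i (S₁.lab u)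
        have e2 : S₂'.lab w' = S₂.lab w := by simpa [hj] using hl2 j (S₂.lab w)
        simp [rankType, hi, hj, hS.adj_cross u w hi.1 hj.1, hS'.adj_cross u' w' hi.2.1 hj.2.1, e1, e2]
    · rcases key j with hj | ⟨w, w', hj⟩ | ⟨w, w', hj⟩
      · simp [rankType, hj]
      · have e1 : S₁'.lab w' = S₁.lab w := by simpa [hj] using hl j (S₁.lab w)
        have e2 : S₂'.lab u' = S₂.lab u := by simpa [hi] using hl2 i (S₂.lab u)
        simp [rankType, hi, hj, hS.adj_cross' w u hj.1 hi.1, hS'.adj_cross' w' u' hj.2.1 hi.2.1, e1, e2]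
      · simpa [rankType, hi, hj, hS.adj_right u w hi.1 hj.1, hS'.adj_right u' w' hi.2.1 hj.2.1]
          using hA2 i j
  · rcases key i with hi | ⟨u, u', hi⟩ | ⟨u, u', hi⟩
    · simp [rankType, hi]
    · rcases key j with hj | ⟨w, w', hj⟩ | ⟨w, w', hj⟩
      · simp [rankType, hj]
      · simpa [rankType, hi, hj] using he i j
      · have e1 : u ≠ w := fun h => hS.disjoint u hi.1 (h ▸ hj.1)
        have e2 : u' ≠ w' := fun h => hS'.disjoint u' hi.2.1 (h ▸ hj.2.1)
        simp [rankType, hi, hj, e1.symm, e2.symm]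
    · rcases key j with hj | ⟨w, w', hj⟩ | ⟨w, w', hj⟩
      · simp [rankType, hj]
      · have e1 : w ≠ u := fun h => hS.disjoint w hj.1 (h ▸ hi.1)
        have e2 : w' ≠ u' := fun h => hS'.disjoint w' hj.2.1 (h ▸ hi.2.1)
        simp [rankType, hi, hj, e1, e2]
      · simpa [rankType, hi, hj] using he2 i j
  · rcases key i with hi | ⟨u, u', hi⟩ | ⟨u, u', hi⟩
    · simp [rankType, hi]
    · simpa [rankType, hi, hS.sel_left u hi.1, hS'.sel_left u' hi.2.1] using hs i
    · simpa [rankType, hi, hS.sel_right u hi.1, hS'.sel_right u' hi.2.1] using hs2 i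
  · rcases key i with hi | ⟨u, u', hi⟩ | ⟨u, u', hi⟩
    · simp [rankType, hi]
    · have e1 : S₁'.lab u' = S₁.lab u := by simpa [hi] using hl i (S₁.lab u)
      simp [rankType, hi, hS.lab_left u hi.1, hS'.lab_left u' hi.2.1, e1]
    · have e2 : S₂'.lab u' = S₂.lab u := by simpa [hi] using hl2 i (S₂.lab u)
      simp [rankType, hi, hS.lab_right u hi.1, hS'.lab_right u' hi.2.1, e2]

/-- A vertex chosen in the union lies in one part and is answered there, while the undefined move is
played in the other part. This is why tuples may have undefined entries. -/
theorem IsMerge.rankType_eq (hS : IsMerge κ ρ₁ ρ₂ S₁ S₂ S) (hS' : IsMerge κ ρ₁ ρ₂ S₁' S₂' S')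
    {q : ℕ} (hq : q ≤ 7) {a a₁ a₂ a' a₁' a₂' : ℕ → Option ℕ} (ha : Splits S₁ S₂ a a₁ a₂)
    (ha' : Splits S₁' S₂' a' a₁' a₂') (h₁ : S₁.rankType q a₁ = S₁'.rankType q a₁')
    (h₂ : S₂.rankType q a₂ = S₂'.rankType q a₂') : S.rankType q a = S'.rankType q a' := by
  induction q generalizing S S₁ S₂ S' S₁' S₂' a a₁ a₂ a' a₁' a₂' with
  | zero => exact hS.rankType_zero_eq hS' ha ha' h₁ h₂
  | succ q ih =>
    -- The two unions play symmetric roles, so one inclusion is proved for all of them.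
    have main : ∀ {S S₁ S₂ S' S₁' S₂' : LabelledGraph} (_ : IsMerge κ ρ₁ ρ₂ S₁ S₂ S)
        (_ : IsMerge κ ρ₁ ρ₂ S₁' S₂' S') {a a₁ a₂ a' a₁' a₂' : ℕ → Option ℕ}
        (_ : Splits S₁ S₂ a a₁ a₂) (_ : Splits S₁' S₂' a' a₁' a₂')
        (_ : S₁.rankType (q + 1) a₁ = S₁'.rankType (q + 1) a₁')
        (_ : S₂.rankType (q + 1) a₂ = S₂'.rankType (q + 1) a₂'),
        S.extensions q a ⊆ S'.extensions q a' := by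
      rintro S S₁ S₂ S' S₁' S₂' hS hS' a a₁ a₂ a' a₁' a₂' ha ha' h₁ h₂ t ⟨x, hx, rfl⟩
      have n₁ := move_none (by omega) h₁
      have n₂ := move_none (by omega) h₂
      cases x with
      | none =>
        exact ⟨none, by simp, ih hS hS' (by omega) (ha.update q (.inl ⟨rfl, rfl, rfl⟩))
          (ha'.update q (.inl ⟨rfl, rfl, rfl⟩)) n₁ n₂⟩
      | some x =>
        rcases (hS.dom x).1 (hx x rfl) with hd | hd
        · obtain ⟨x', hd', hx'⟩ := exists_move_some (by omega) h₁ hd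
          exact ⟨some x', by simpa using (hS'.dom x').2 (.inl hd'), ih hS hS' (by omega)
            (ha.update q (.inr (.inl ⟨x, hd, rfl, rfl, rfl⟩)))
            (ha'.update q (.inr (.inl ⟨x', hd', rfl, rfl, rfl⟩))) hx' n₂⟩
        · obtain ⟨x', hd', hx'⟩ := exists_move_some (by omega) h₂ hd
          exact ⟨some x', by simpa using (hS'.dom x').2 (.inr hd'), ih hS hS' (by omega)
            (ha.update q (.inr (.inr ⟨x, hd, rfl, rfl, rfl⟩)))
            (ha'.update q (.inr (.inr ⟨x', hd', rfl, rfl, rfl⟩))) n₁ hx'⟩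
    exact Set.Subset.antisymm (main hS hS' ha ha' h₁ h₂) (main hS' hS ha' ha h₁.symm h₂.symm)

/-- The type of rank seven of a labelled graph. -/
def type (S : LabelledGraph) : RankType 7 := S.rankType 7 fun _ => none

theorem IsMerge.type_eq (hS : IsMerge κ ρ₁ ρ₂ S₁ S₂ S) (hS' : IsMerge κ ρ₁ ρ₂ S₁' S₂' S')
    (h₁ : S₁.type = S₁'.type) (h₂ : S₂.type = S₂'.type) : S.type = S'.type :=
  hS.rankType_eq hS' le_rfl (fun _ => .inl ⟨rfl, rfl, rfl⟩) (fun _ => .inl ⟨rfl, rfl, rfl⟩) h₁ h₂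

end LabelledGraph

/-- `u` is in the closed neighbourhood of the edge `xy`. -/
def NearEdge (adj : ℕ → ℕ → Prop) (x y u : ℕ) : Prop := u = x ∨ u = y ∨ adj x u ∨ adj y u

/-- The elements of `sel` form a liar's vertex-edge dominating set. -/
def Good (adj : ℕ → ℕ → Prop) (sel : ℕ → Prop) : Prop :=
  (∀ x y, adj x y → ∃ u₁ u₂, u₁ ≠ u₂ ∧ sel u₁ ∧ sel u₂ ∧ NearEdge adj x y u₁ ∧ NearEdge adj x y u₂) ∧
  (∀ x y z w, adj x y → adj z w → ¬ (x = z ∧ y = w) → ¬ (x = w ∧ y = z) →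
    ∃ u₁ u₂ u₃, u₁ ≠ u₂ ∧ u₁ ≠ u₃ ∧ u₂ ≠ u₃ ∧ sel u₁ ∧ sel u₂ ∧ sel u₃ ∧
      (NearEdge adj x y u₁ ∨ NearEdge adj z w u₁) ∧ (NearEdge adj x y u₂ ∨ NearEdge adj z w u₂) ∧
      (NearEdge adj x y u₃ ∨ NearEdge adj z w u₃))

/-! ### Domination is determined by the type of rank seven -/

namespace LabelledGraph

/-- All edges and all selected vertices are in the domain. -/
def IsProper (S : LabelledGraph) : Prop :=
  (∀ x y, S.adj x y → S.dom x ∧ S.dom y) ∧ ∀ x, S.sel x → S.dom x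

theorem adj_iff {S S' : LabelledGraph} {a a' : ℕ → Option ℕ}
    (h : S.rankType 0 a = S'.rankType 0 a') {i j x y x' y' : ℕ} (hi : i < 7) (hj : j < 7)
    (h1 : a i = some x) (h2 : a j = some y) (h1' : a' i = some x') (h2' : a' j = some y') :
    (S.adj x y ↔ S'.adj x' y') ∧ (x = y ↔ x' = y') := by
  have hA := (congrFun (congrFun (congrArg (fun t : RankType 0 => t.1) h) ⟨i, hi⟩) ⟨j, hj⟩).to_iff
  have he := (congrFun (congrFun (congrArg (fun t : RankType 0 => t.2.1) h) ⟨i, hi⟩) ⟨j, hj⟩).to_iff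
  simp only [rankType, h1, h2, h1', h2', Option.mem_some_iff, exists_eq_left'] at hA he
  exact ⟨hA, by rw [eq_comm, he, eq_comm]⟩

theorem sel_iff {S S' : LabelledGraph} {a a' : ℕ → Option ℕ}
    (h : S.rankType 0 a = S'.rankType 0 a') {i x x' : ℕ} (hi : i < 7)
    (h1 : a i = some x) (h1' : a' i = some x') : S.sel x ↔ S'.sel x' := by
  have hA := (congrFun (congrArg (fun t : RankType 0 => t.2.2.1) h) ⟨i, hi⟩).to_iff
  simpa [rankType, h1, h1'] using hA

/-- The ends of two edges of `S'` are matched in `S` by four moves, and the dominating vertices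
found in `S` are matched back in `S'` by the three remaining moves. All conditions on these seven
vertices are atomic. -/
theorem good_of_type_eq {S S' : LabelledGraph} (hS : S.IsProper) (hS' : S'.IsProper)
    (h : S.type = S'.type) (hg : Good S.adj S.sel) : Good S'.adj S'.sel := by
  have main : ∀ x' y' z' w', S'.dom x' → S'.dom y' → S'.dom z' → S'.dom w' →
      ∃ x y z w, (S.adj x y ↔ S'.adj x' y') ∧ (S.adj z w ↔ S'.adj z' w') ∧ (x = z ↔ x' = z') ∧
        (y = w ↔ y' = w') ∧ (x = w ↔ x' = w') ∧ (y = z ↔ y' = z') ∧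
        ∀ u₁ u₂ u₃, S.sel u₁ → S.sel u₂ → S.sel u₃ → ∃ u₁' u₂' u₃',
          S'.sel u₁' ∧ S'.sel u₂' ∧ S'.sel u₃' ∧ (u₁ = u₂ ↔ u₁' = u₂') ∧ (u₁ = u₃ ↔ u₁' = u₃') ∧
          (u₂ = u₃ ↔ u₂' = u₃') ∧
          (NearEdge S.adj x y u₁ ↔ NearEdge S'.adj x' y' u₁') ∧
          (NearEdge S.adj x y u₂ ↔ NearEdge S'.adj x' y' u₂') ∧
          (NearEdge S.adj x y u₃ ↔ NearEdge S'.adj x' y' u₃') ∧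
          (NearEdge S.adj z w u₁ ↔ NearEdge S'.adj z' w' u₁') ∧
          (NearEdge S.adj z w u₂ ↔ NearEdge S'.adj z' w' u₂') ∧
          (NearEdge S.adj z w u₃ ↔ NearEdge S'.adj z' w' u₃') := by
    intro x' y' z' w' hx' hy' hz' hw'
    -- The ends of the edges take the entries 6 to 3, the dominating vertices the entries 2 to 0.
    obtain ⟨x, hx, h6⟩ := exists_move_some (by omega) h.symm hx'
    obtain ⟨y, hy, h5⟩ := exists_move_some (by omega) h6 hy'
    obtain ⟨z, hz, h4⟩ := exists_move_some (by omega) h5 hz'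
    obtain ⟨w, hw, h3⟩ := exists_move_some (by omega) h4 hw'
    have key : ∀ u₁ u₂ u₃, S.dom u₁ → S.dom u₂ → S.dom u₃ → ∃ u₁' u₂' u₃', ∃ a a' : ℕ → Option ℕ,
        S.rankType 0 a = S'.rankType 0 a' ∧ (a 6 = some x ∧ a' 6 = some x') ∧
        (a 5 = some y ∧ a' 5 = some y') ∧ (a 4 = some z ∧ a' 4 = some z') ∧
        (a 3 = some w ∧ a' 3 = some w') ∧ (a 2 = some u₁ ∧ a' 2 = some u₁') ∧
        (a 1 = some u₂ ∧ a' 1 = some u₂') ∧ (a 0 = some u₃ ∧ a' 0 = some u₃') := by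
      intro u₁ u₂ u₃ k1 k2 k3
      obtain ⟨u₁', -, h2⟩ := exists_move_some (by omega) h3.symm k1
      obtain ⟨u₂', -, h1⟩ := exists_move_some (by omega) h2 k2
      obtain ⟨u₃', -, h0⟩ := exists_move_some (by omega) h1 k3
      exact ⟨u₁', u₂', u₃', _, _, h0, by simp⟩
    refine ⟨x, y, z, w, ?_⟩
    have near : ∀ {a a' : ℕ → Option ℕ} (_ : S.rankType 0 a = S'.rankType 0 a') {i j k : ℕ}
        (_ : i < 7) (_ : j < 7) (_ : k < 7) {x y u x' y' u' : ℕ} (_ : a i = some x ∧ a' i = some x')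
        (_ : a j = some y ∧ a' j = some y') (_ : a k = some u ∧ a' k = some u'),
        NearEdge S.adj x y u ↔ NearEdge S'.adj x' y' u' := by
      intro a a' h i j k hi hj hk x y u x' y' u' h1 h2 h3
      unfold NearEdge
      rw [(adj_iff h hk hi h3.1 h1.1 h3.2 h1.2).2, (adj_iff h hk hj h3.1 h2.1 h3.2 h2.2).2,
        (adj_iff h hi hk h1.1 h3.1 h1.2 h3.2).1, (adj_iff h hj hk h2.1 h3.1 h2.2 h3.2).1]
    obtain ⟨_, _, _, a, a', h0, e6, e5, e4, e3, -⟩ := key x y z hx hy hz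
    refine ⟨(adj_iff h0 (by omega) (by omega) e6.1 e5.1 e6.2 e5.2).1,
      (adj_iff h0 (by omega) (by omega) e4.1 e3.1 e4.2 e3.2).1,
      (adj_iff h0 (by omega) (by omega) e6.1 e4.1 e6.2 e4.2).2,
      (adj_iff h0 (by omega) (by omega) e5.1 e3.1 e5.2 e3.2).2,
      (adj_iff h0 (by omega) (by omega) e6.1 e3.1 e6.2 e3.2).2,
      (adj_iff h0 (by omega) (by omega) e5.1 e4.1 e5.2 e4.2).2, ?_⟩
    intro u₁ u₂ u₃ s1 s2 s3
    obtain ⟨u₁', u₂', u₃', a, a', h0, e6, e5, e4, e3, e2, e1, e0⟩ :=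
      key u₁ u₂ u₃ (hS.2 _ s1) (hS.2 _ s2) (hS.2 _ s3)
    refine ⟨u₁', u₂', u₃', (sel_iff h0 (by omega) e2.1 e2.2).1 s1,
      (sel_iff h0 (by omega) e1.1 e1.2).1 s2, (sel_iff h0 (by omega) e0.1 e0.2).1 s3,
      (adj_iff h0 (by omega) (by omega) e2.1 e1.1 e2.2 e1.2).2,
      (adj_iff h0 (by omega) (by omega) e2.1 e0.1 e2.2 e0.2).2,
      (adj_iff h0 (by omega) (by omega) e1.1 e0.1 e1.2 e0.2).2,
      near h0 (by omega) (by omega) (by omega) e6 e5 e2,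
      near h0 (by omega) (by omega) (by omega) e6 e5 e1,
      near h0 (by omega) (by omega) (by omega) e6 e5 e0,
      near h0 (by omega) (by omega) (by omega) e4 e3 e2,
      near h0 (by omega) (by omega) (by omega) e4 e3 e1,
      near h0 (by omega) (by omega) (by omega) e4 e3 e0⟩
  constructor
  · intro x' y' hxy'
    obtain ⟨hx', hy'⟩ := hS'.1 _ _ hxy'
    -- A single edge is treated as a pair of equal edges, with the second dominating vertex
    -- repeated.
    obtain ⟨x, y, z, w, hA, -, -, -, -, -, hu⟩ := main x' y' x' y' hx' hy' hx' hy'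
    obtain ⟨u₁, u₂, hne, s1, s2, n1, n2⟩ := hg.1 x y (hA.2 hxy')
    obtain ⟨u₁', u₂', -, t1, t2, -, d, -, -, m1, m2, -⟩ := hu u₁ u₂ u₂ s1 s2 s2
    exact ⟨u₁', u₂', fun h => hne (d.2 h), t1, t2, m1.1 n1, m2.1 n2⟩
  · intro x' y' z' w' hxy' hzw' hn1 hn2
    obtain ⟨hx', hy'⟩ := hS'.1 _ _ hxy'
    obtain ⟨hz', hw'⟩ := hS'.1 _ _ hzw'
    obtain ⟨x, y, z, w, hA, hB, e1, e2, e3, e4, hu⟩ := main x' y' z' w' hx' hy' hz' hw'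
    obtain ⟨u₁, u₂, u₃, d1, d2, d3, s1, s2, s3, n1, n2, n3⟩ := hg.2 x y z w (hA.2 hxy') (hB.2 hzw')
      (by rwa [e1, e2]) (by rwa [e3, e4])
    obtain ⟨u₁', u₂', u₃', t1, t2, t3, c1, c2, c3, m1, m2, m3, m4, m5, m6⟩ := hu u₁ u₂ u₃ s1 s2 s3
    exact ⟨u₁', u₂', u₃', fun h => d1 (c1.2 h), fun h => d2 (c2.2 h), fun h => d3 (c3.2 h), t1, t2,
      t3, by rwa [← m1, ← m4], by rwa [← m2, ← m5], by rwa [← m3, ← m6]⟩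

end LabelledGraph

end LiarVE

/-! ### Elimination structures and the tree automaton -/

namespace LiarVE

/-- `R` is a graph on `1, …, n`, and `par i` is the last neighbour of `i` before `i`, or `0` if there
is none. If `full i` then the other neighbours of `i` before `i` are the neighbours of `par i` before
`par i`, and otherwise there are none. -/
structure IsElimination (n : ℕ) (R : ℕ → ℕ → Prop) (par : ℕ → ℕ) (full : ℕ → Bool) : Prop where
  symm : ∀ a b, R a b → R b a
  irrefl : ∀ a, ¬ R a a
  pos : ∀ a b, R a b → 1 ≤ a
  le : ∀ a b, R a b → a ≤ n
  par_lt : ∀ i, 1 ≤ i → i ≤ n → par i < i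
  adj_of_full : ∀ i, 1 ≤ i → i ≤ n → full i = true → ∀ a, a < i →
    (R a i ↔ a = par i ∨ a < par i ∧ R a (par i))
  adj_of_not_full : ∀ i, 1 ≤ i → i ≤ n → full i = false → ∀ a, a < i → (R a i ↔ a = par i ∧ 0 < a)

/-- A bottom-up tree automaton with two kinds of tree edges and initial states that depend on a
bit, and an additional initial state for the root. -/
structure Automaton (N : ℕ) where
  init : Bool → Fin N
  empty : Fin N
  comb : Bool → Fin N → Fin N → Fin N
  acc : Fin N → Prop

/-! ### Merging trees, and the labels of their vertices -/

namespace Elim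

variable (n : ℕ) (par : ℕ → ℕ) (full : ℕ → Bool)

/-- The tree that contains `x` after the trees with the roots `n, …, n - k + 1` have been merged,
in this order, into the trees of their parents. -/
def owner : ℕ → ℕ → ℕ
  | 0, x => x
  | k + 1, x => if owner k x = n - k then par (n - k) else owner k x

/-- The new label of a vertex with label `l` of a tree that is merged into another one. -/
def relabel (b : Bool) (l : Fin 3) : Fin 3 := if b = true ∧ l ≠ 0 then 1 else 0

/-- The label of `x` after `k` mergers: `2` for the root of its tree, `1` for the other vertices with
the same earlier neighbours outside the tree as the root, and `0` for the rest. -/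
def label : ℕ → ℕ → Fin 3
  | 0, _ => 2
  | k + 1, x => if owner n par k x = n - k then relabel (full (n - k)) (label k x) else label k x

theorem relabel_ne_two (b : Bool) (l : Fin 3) : relabel b l ≠ 2 := by
  unfold relabel; split <;> decide

theorem relabel_ne_zero (b : Bool) (l : Fin 3) : relabel b l ≠ 0 ↔ b = true ∧ l ≠ 0 := by
  unfold relabel; split <;> simp_all

variable {n par full} {R : ℕ → ℕ → Prop}

/-- When `i = n - k` is merged, the vertices of its tree with nonzero label have the earlier
neighbours of `i` outside the tree: `par i` and, if `full i`, the earlier neighbours of `par i`.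
Outside the enlarged tree there remain the earlier neighbours of the new root, which gives label 1,
or none, which gives label 0. Only roots have neighbours in later trees. -/
theorem invariant (h : IsElimination n R par full) (k : ℕ) (hk : k ≤ n) :
    (∀ x, x ≤ n → owner n par k x ≤ n - k) ∧
    (∀ x, label n par full k x = 2 → owner n par k x = x) ∧
    ∀ x y, x ≤ n → y ≤ n → owner n par k x < owner n par k y →
      (R x y ↔ label n par full k x = 2 ∧ label n par full k y ≠ 0 ∧
        R (owner n par k x) (owner n par k y)) := by
  induction k with
  | zero => exact ⟨fun x hx => by simpa [owner] using hx, fun x _ => rfl, by simp [owner, label]⟩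
  | succ k ih =>
    obtain ⟨h1, h2, h3⟩ := ih (by omega)
    have hp := h.par_lt (n - k) (by omega) (by omega)
    refine ⟨fun x hx => ?_, fun x hx => ?_, fun x y hx hy hxy => ?_⟩
    · have := h1 x hx
      simp only [owner]
      split <;> omega
    · simp only [owner, label] at hx ⊢
      split
      · rename_i hh
        rw [if_pos hh] at hx
        exact absurd hx (relabel_ne_two _ _)
      · rename_i hh
        rw [if_neg hh] at hx
        exact h2 x hx
    · have b1 := h1 x hx
      have b2 := h1 y hy
      simp only [owner, label] at hxy ⊢
      by_cases hxi : owner n par k x = n - k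
      · rw [if_pos hxi] at hxy
        by_cases hyi : owner n par k y = n - k
        · rw [if_pos hyi] at hxy; omega
        rw [if_neg hyi] at hxy
        simp only [hxi, if_true, relabel_ne_two, false_and, iff_false]
        -- Such an edge would make the root of the tree of `y` a neighbour of `n - k` strictly
        -- between `par (n - k)` and `n - k`.
        intro hR
        have hR' := (h3 y x hy hx (by omega)).1 (h.symm _ _ hR)
        rw [hxi] at hR'
        cases hf : full (n - k) with
        | true =>
          have := (h.adj_of_full (n - k) (by omega) (by omega) hf _ (by omega)).1 hR'.2.2
          omega
        | false =>
          have := (h.adj_of_not_full (n - k) (by omega) (by omega) hf _ (by omega)).1 hR'.2.2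
          omega
      · rw [if_neg hxi] at hxy ⊢
        by_cases hyi : owner n par k y = n - k
        · rw [if_pos hyi] at hxy
          simp only [hyi, if_true, if_neg hxi, relabel_ne_zero]
          rw [h3 x y hx hy (by omega), hyi]
          cases hf : full (n - k) with
          | true =>
            rw [h.adj_of_full (n - k) (by omega) (by omega) hf _ (by omega)]
            have : owner n par k x ≠ par (n - k) := by omega
            simp [this, hxy]
          | false =>
            rw [h.adj_of_not_full (n - k) (by omega) (by omega) hf _ (by omega)]
            have : owner n par k x ≠ par (n - k) := by omega
            simp [this]
        · rw [if_neg hyi] at hxy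
          simp only [if_neg hxi, if_neg hyi]
          exact h3 x y hx hy hxy

end Elim

/-! ### Types of single vertices, of empty graphs and of mergers -/

namespace LabelledGraph

/-- The adjacencies between two trees that are merged. -/
def rootAdj (a b : Fin 3) : Prop := a = 2 ∧ b ≠ 0

/-- The graph with one vertex. -/
def single (b : Bool) : LabelledGraph := ⟨fun _ _ => False, fun _ => b = true, fun x => x = 1, fun _ => 2⟩

/-- The graph without vertices. -/
def nothing : LabelledGraph := ⟨fun _ _ => False, fun _ => False, fun _ => False, fun _ => 0⟩

/-- Every move is the only vertex or undefined, so the answers are forced. The type thus does not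
depend on which number the vertex is. -/
theorem rankType_eq_of_single {S S' : LabelledGraph} {p p' : ℕ} (hS : ∀ x, S.dom x ↔ x = p)
    (hS' : ∀ x, S'.dom x ↔ x = p') (hA : ¬ S.adj p p) (hA' : ¬ S'.adj p' p')
    (hs : S.sel p ↔ S'.sel p') (hl : S.lab p = S'.lab p') (q : ℕ) (a a' : ℕ → Option ℕ)
    (ha : ∀ i, (a i = none ∧ a' i = none) ∨ (a i = some p ∧ a' i = some p')) :
    S.rankType q a = S'.rankType q a' := by
  induction q generalizing a a' with
  | zero =>
    refine Prod.ext (funext₂ fun i j => propext ?_) (Prod.ext (funext₂ fun i j => propext ?_)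
      (Prod.ext (funext fun i => propext ?_) (funext₂ fun i l => propext ?_)))
    · rcases ha i with h | h <;> rcases ha j with h' | h' <;> simp [rankType, h, h', hA, hA']
    · rcases ha i with h | h <;> rcases ha j with h' | h' <;> simp [rankType, h, h']
    · rcases ha i with h | h <;> simp [rankType, h, hs]
    · rcases ha i with h | h <;> simp [rankType, h, hl]
  | succ q ih =>
    have hn : S.rankType q (Function.update a q none) = S'.rankType q (Function.update a' q none) := by
      refine ih _ _ fun i => ?_
      by_cases hi : i = q
      · subst hi; simp
      · simpa [Function.update_of_ne hi] using ha i
    have hp : S.rankType q (Function.update a q (some p)) =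
        S'.rankType q (Function.update a' q (some p')) := by
      refine ih _ _ fun i => ?_
      by_cases hi : i = q
      · subst hi; simp
      · simpa [Function.update_of_ne hi] using ha i
    refine Set.Subset.antisymm ?_ ?_
    · rintro t ⟨x, hx, rfl⟩
      cases x with
      | none => exact ⟨none, by simp, hn⟩
      | some x =>
        obtain rfl := (hS x).1 (hx x rfl)
        exact ⟨some p', by simpa using (hS' p').2 rfl, hp⟩
    · rintro t ⟨x, hx, rfl⟩
      cases x with
      | none => exact ⟨none, by simp, hn.symm⟩
      | some x =>
        obtain rfl := (hS' x).1 (hx x rfl)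
        exact ⟨some p, by simpa using (hS p).2 rfl, hp.symm⟩

/-- The dominating set will be read off the initial states, so these have to be different. Seven
moves to the only vertex make its selection visible in entry 0. -/
theorem type_single_ne : (single true).type ≠ (single false).type := by
  intro h
  have hd : (single true).dom 1 := rfl
  obtain ⟨_, -, h6⟩ := exists_move_some (by omega) h hd
  obtain ⟨_, -, h5⟩ := exists_move_some (by omega) h6 hd
  obtain ⟨_, -, h4⟩ := exists_move_some (by omega) h5 hd
  obtain ⟨_, -, h3⟩ := exists_move_some (by omega) h4 hd
  obtain ⟨_, -, h2⟩ := exists_move_some (by omega) h3 hd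
  obtain ⟨_, -, h1⟩ := exists_move_some (by omega) h2 hd
  obtain ⟨x, -, h0⟩ := exists_move_some (by omega) h1 hd
  have := sel_iff h0 (i := 0) (by omega) (Function.update_self ..) (Function.update_self ..)
  simp [single] at this

/-- Mergers constrain the data on the domain only, so every graph without vertices is a merger of
two copies of `nothing`, and compositionality applies. The next lemma uses the same device. -/
theorem type_eq_nothing {S : LabelledGraph} (h : ∀ x, ¬ S.dom x) : S.type = nothing.type := by
  have key : ∀ T : LabelledGraph, (∀ x, ¬ T.dom x) →
      IsMerge rootAdj id id nothing nothing T := fun T hT => by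
    constructor <;> simp [nothing, hT]
  exact (key S h).type_eq (key nothing (by simp [nothing])) rfl rfl

theorem type_congr {S T : LabelledGraph} (hd : ∀ x, S.dom x ↔ T.dom x)
    (hA : ∀ x y, T.dom x → T.dom y → (S.adj x y ↔ T.adj x y))
    (hs : ∀ x, T.dom x → (S.sel x ↔ T.sel x)) (hl : ∀ x, T.dom x → S.lab x = T.lab x) :
    S.type = T.type := by
  have h1 : IsMerge rootAdj id id T nothing S := by
    constructor <;> simp_all [nothing]
  have h2 : IsMerge rootAdj id id T nothing T := by
    constructor <;> simp [nothing]
  exact h1.type_eq h2 rfl rfl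

open Classical in
/-- The type of a merger as a function of the types of the parts. -/
noncomputable def combType (b : Bool) (t₁ t₂ : RankType 7) : RankType 7 :=
  if h : ∃ S S₁ S₂, S₁.type = t₁ ∧ S₂.type = t₂ ∧ IsMerge rootAdj id (Elim.relabel b) S₁ S₂ S
  then h.choose.type else t₁

/-- `combType` chooses some merger of parts with the given types; by compositionality its type does
not depend on the choice. -/
theorem IsMerge.type_eq_combType {b : Bool} {S S₁ S₂ : LabelledGraph}
    (h : IsMerge rootAdj id (Elim.relabel b) S₁ S₂ S) : S.type = combType b S₁.type S₂.type := by
  have hex : ∃ S S₁' S₂', S₁'.type = S₁.type ∧ S₂'.type = S₂.type ∧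
      IsMerge rootAdj id (Elim.relabel b) S₁' S₂' S := ⟨S, S₁, S₂, rfl, rfl, h⟩
  rw [combType, dif_pos hex]
  obtain ⟨S₁', S₂', h1, h2, h3⟩ := hex.choose_spec
  exact h.type_eq h3 h1.symm h2.symm

end LabelledGraph

open LabelledGraph

/-- The tree with root `p` after `k` mergers. -/
def treeGraph (n : ℕ) (R : ℕ → ℕ → Prop) (par : ℕ → ℕ) (full : ℕ → Bool) (L : Finset ℕ) (k p : ℕ) :
    LabelledGraph :=
  ⟨R, (· ∈ L), fun x => 1 ≤ x ∧ x ≤ n ∧ Elim.owner n par k x = p, Elim.label n par full k⟩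

/-- Between these two trees the adjacency of the roots in `Elim.invariant` comes for free, so the
labels alone decide. -/
theorem treeGraph_isMerge {n : ℕ} {R : ℕ → ℕ → Prop} {par : ℕ → ℕ} {full : ℕ → Bool}
    (h : IsElimination n R par full) (L : Finset ℕ) {k : ℕ} (hk : k < n) :
    IsMerge rootAdj id (Elim.relabel (full (n - k))) (treeGraph n R par full L k (par (n - k)))
      (treeGraph n R par full L k (n - k)) (treeGraph n R par full L (k + 1) (par (n - k))) := by
  obtain ⟨h1, h2, h3⟩ := Elim.invariant h k hk.le
  have hp := h.par_lt (n - k) (by omega) (by omega)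
  have cross : ∀ x y, 1 ≤ x → x ≤ n → Elim.owner n par k x = par (n - k) → y ≤ n →
      Elim.owner n par k y = n - k →
      (R x y ↔ rootAdj (Elim.label n par full k x) (Elim.label n par full k y)) := by
    intro x y hx1 hx hxo hy hyo
    rw [h3 x y hx hy (by omega), rootAdj]
    refine ⟨fun hh => ⟨hh.1, hh.2.1⟩, fun hh => ⟨hh.1, hh.2, ?_⟩⟩
    -- Label 2 makes `x` the root of its tree, so `par (n - k) = x` is positive and thus a true
    -- neighbour of `n - k`, not the virtual root.
    have hxx := h2 x hh.1
    rw [hxo, hyo]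
    cases hf : full (n - k) with
    | true => exact (h.adj_of_full _ (by omega) (by omega) hf _ hp).2 (.inl rfl)
    | false => exact (h.adj_of_not_full _ (by omega) (by omega) hf _ hp).2 ⟨rfl, by omega⟩
  constructor
  · intro x
    simp only [treeGraph, Elim.owner]
    split <;> omega
  · rintro x ⟨-, -, hx⟩ ⟨-, -, hx'⟩
    omega
  · exact fun _ _ _ _ => Iff.rfl
  · exact fun _ _ _ _ => Iff.rfl
  · rintro x y ⟨hx1, hx2, hx3⟩ ⟨hy1, hy2, hy3⟩
    exact cross x y hx1 hx2 hx3 hy2 hy3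
  · rintro x y ⟨hx1, hx2, hx3⟩ ⟨hy1, hy2, hy3⟩
    exact Iff.trans ⟨h.symm _ _, h.symm _ _⟩ (cross x y hx1 hx2 hx3 hy2 hy3)
  · exact fun _ _ => Iff.rfl
  · exact fun _ _ => Iff.rfl
  · rintro x ⟨-, -, hx⟩
    simp only [treeGraph, Elim.label]
    rw [if_neg (by omega)]
    rfl
  · rintro x ⟨-, -, hx⟩
    simp only [treeGraph, Elim.label]
    rw [if_pos hx]

/-- The automaton that recognizes the liar's vertex-edge dominating sets. -/
theorem exists_automaton : ∃ (N : ℕ) (M : Automaton N), M.init true ≠ M.init false ∧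
    ∀ (n : ℕ) (R : ℕ → ℕ → Prop) (par : ℕ → ℕ) (full : ℕ → Bool), IsElimination n R par full →
      ∀ L : Finset ℕ, L ⊆ Finset.Icc 1 n → ∃ st : ℕ → ℕ → Fin N,
        st n 0 = M.empty ∧ (∀ p, 1 ≤ p → p ≤ n → st n p = M.init (decide (p ∈ L))) ∧
        (∀ i, 1 ≤ i → i ≤ n → ∀ p, p < i → st (i - 1) p =
          if p = par i then M.comb (full i) (st i p) (st i i) else st i p) ∧
        (M.acc (st 0 0) ↔ Good R (· ∈ L)) := by
  obtain ⟨N, ⟨e⟩⟩ := Finite.exists_equiv_fin (RankType 7)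
  -- A type is accepted if some proper graph of this type is good; by `good_of_type_eq` all proper
  -- graphs of the type are good then.
  refine ⟨N, ⟨fun b => e (single b).type, e nothing.type,
    fun b t₁ t₂ => e (combType b (e.symm t₁) (e.symm t₂)),
    fun t => ∃ S : LabelledGraph, S.IsProper ∧ e S.type = t ∧ Good S.adj S.sel⟩,
    fun h => type_single_ne (e.injective h), ?_⟩
  intro n R par full h L hL
  -- After `n - i` mergers the nodes `0, …, i` are left, and the state of `p` is the type of its
  -- tree.
  refine ⟨fun i p => e (treeGraph n R par full L (n - i) p).type, ?_, ?_, ?_, ?_⟩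
  · refine congrArg e (type_eq_nothing ?_)
    rintro x ⟨hx, -, hx'⟩
    simp only [Nat.sub_self, Elim.owner] at hx'
    omega
  · intro p hp hpn
    refine congrArg e (rankType_eq_of_single (p := p) (p' := 1) ?_ ?_ (h.irrefl p) ?_ ?_ ?_ 7 _ _ ?_)
    · intro x
      simp only [treeGraph, Nat.sub_self, Elim.owner]
      omega
    · exact fun x => Iff.rfl
    · simp [single]
    · simp [single, treeGraph]
    · simp [single, treeGraph, Elim.label]
    · exact fun i => .inl ⟨rfl, rfl⟩
  · intro i hi hin p hpi
    have e1 : n - (i - 1) = (n - i) + 1 := by omega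
    have e2 : n - (n - i) = i := by omega
    simp only [e1]
    split
    · rename_i hp
      have := treeGraph_isMerge h L (k := n - i) (by omega)
      rw [e2] at this
      rw [hp, this.type_eq_combType]
      simp
    · rename_i hp
      refine congrArg e (type_congr ?_ ?_ ?_ ?_)
      · intro x
        simp only [treeGraph, Elim.owner, e2]
        split <;> omega
      · exact fun _ _ _ _ => Iff.rfl
      · exact fun _ _ => Iff.rfl
      · rintro x ⟨-, -, hx⟩
        simp only [treeGraph, Elim.label, e2]
        rw [if_neg (by omega)]
  · have hprop : (treeGraph n R par full L n 0).IsProper := by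
      have h1 := (Elim.invariant h n le_rfl).1
      have key : ∀ x, 1 ≤ x → x ≤ n → (treeGraph n R par full L n 0).dom x := by
        intro x hx hx'
        have := h1 x hx'
        exact ⟨hx, hx', by omega⟩
      refine ⟨fun x y hxy => ⟨key x (h.pos _ _ hxy) (h.le _ _ hxy),
        key y (h.pos _ _ (h.symm _ _ hxy)) (h.le _ _ (h.symm _ _ hxy))⟩, fun x hx => ?_⟩
      have := Finset.mem_Icc.1 (hL hx)
      exact key x this.1 this.2
    constructor
    · rintro ⟨S, hS, hSt, hg⟩
      exact good_of_type_eq hS hprop (by simpa using hSt) hg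
    · intro hg
      exact ⟨_, hprop, by simp, hg⟩

end LiarVE

/-! ### Search orders of block graphs -/

namespace LiarVE

/-- `num` numbers the vertices from `1` on, in an order in which a graph search may visit them:
a vertex without neighbours before it is visited only if no edge leaves the set of the vertices
before it. -/
structure IsSearchOrder {n : ℕ} (G : SimpleGraph (Fin n)) (num : ℕ → ℕ) : Prop where
  pos : ∀ v : Fin n, 1 ≤ num v
  le : ∀ v : Fin n, num v ≤ n
  inj : ∀ u v : Fin n, num u = num v → u = v
  search : ∀ v : Fin n, (∃ u : Fin n, G.Adj u v ∧ num u < num v) ∨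
    ∀ u w : Fin n, G.Adj u w → num u < num v → num w < num v

/-- Adjacency of the vertices with the numbers `a` and `b`. -/
def rankAdj {n : ℕ} (G : SimpleGraph (Fin n)) (num : ℕ → ℕ) (a b : ℕ) : Prop :=
  ∃ u v : Fin n, num u = a ∧ num v = b ∧ G.Adj u v

variable {n : ℕ} {G : SimpleGraph (Fin n)} {num : ℕ → ℕ}

theorem rankAdj.symm {a b : ℕ} (h : rankAdj G num a b) : rankAdj G num b a := by
  obtain ⟨u, v, hu, hv, h⟩ := h
  exact ⟨v, u, hv, hu, h.symm⟩

namespace IsSearchOrder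

theorem rankAdj_iff (h : IsSearchOrder G num) {u v : Fin n} :
    rankAdj G num (num u) (num v) ↔ G.Adj u v := by
  constructor
  · rintro ⟨u', v', hu, hv, hA⟩
    rwa [h.inj _ _ hu, h.inj _ _ hv] at hA
  · exact fun hA => ⟨u, v, rfl, rfl, hA⟩

/-- Passing to earlier neighbours as long as there are any leads to a vertex `s` where the search
started afresh. -/
theorem exists_walk_to_start (h : IsSearchOrder G num) (v : Fin n) :
    ∃ (s : Fin n) (p : G.Walk v s), (∀ z ∈ p.support, num z ≤ num v) ∧
      ∀ u w : Fin n, G.Adj u w → num u < num s → num w < num s := by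
  induction hk : num v using Nat.strong_induction_on generalizing v with
  | _ k ih =>
    subst hk
    rcases h.search v with ⟨u, hA, hu⟩ | hcl
    · obtain ⟨s, p, hp, hs⟩ := ih _ hu u rfl
      refine ⟨s, .cons hA.symm p, ?_, hs⟩
      intro z hz
      rw [SimpleGraph.Walk.support_cons, List.mem_cons] at hz
      rcases hz with rfl | hz
      · exact le_rfl
      · exact (hp z hz).trans hu.le
    · exact ⟨v, .nil, by simp, hcl⟩

theorem lt_of_walk {s : Fin n} (hs : ∀ u w : Fin n, G.Adj u w → num u < num s → num w < num s)
    {a b : Fin n} (p : G.Walk a b) (ha : num a < num s) : num b < num s := by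
  induction p with
  | nil => exact ha
  | cons hA _ ih => exact ih (hs _ _ hA ha)

/-- The neighbours before a vertex form a clique. -/
theorem adj_of_earlier (h : IsSearchOrder G num) (hG : IsBlockGraph G) {v x y : Fin n}
    (hx : G.Adj x v) (hy : G.Adj y v) (hxv : num x < num v) (hyv : num y < num v) (hxy : x ≠ y) :
    G.Adj x y := by
  obtain ⟨s, p, hp, hs⟩ := h.exists_walk_to_start x
  obtain ⟨s', p', hp', hs'⟩ := h.exists_walk_to_start y
  -- The starts coincide: if `s` came before `s'`, then so would `x`, which is connected to `s`, and
  -- its neighbour `v`; but `s'` is numbered at most as `y`, which comes before `v`.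
  have key : ∀ {s s' x y : Fin n} (p : G.Walk x s) (p' : G.Walk y s'),
      (∀ z ∈ p'.support, num z ≤ num y) →
      (∀ u w : Fin n, G.Adj u w → num u < num s' → num w < num s') → G.Adj x v →
      num y < num v → ¬ num s < num s' := by
    intro s s' x y p p' hp' hs' hx hyv hlt
    have h1 := lt_of_walk hs' p.reverse hlt
    have h2 := hs' _ _ hx h1
    have h3 := hp' s' p'.end_mem_support
    omega
  have h1 := key p p' hp' hs' hx hyv
  have h2 := key p' p hp hs hy hxv
  obtain rfl : s = s' := h.inj _ _ (by omega)
  -- The walk through the common start meets only numbers up to those of `x` and `y`, so it avoids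
  -- `v`.
  refine hG.adj_of_walk (v := v) (p.append p'.reverse) ?_ hx.symm hy.symm hxy
  intro hv
  rw [SimpleGraph.Walk.mem_support_append_iff, SimpleGraph.Walk.support_reverse,
    List.mem_reverse] at hv
  rcases hv with hv | hv
  · exact absurd (hp v hv) (by omega)
  · exact absurd (hp' v hv) (by omega)

/-- Two vertices with a common neighbour `u` and with adjacent neighbours are adjacent. -/
theorem adj_of_triangles (hG : IsBlockGraph G) {u i a c : Fin n} (hui : G.Adj u i) (hua : G.Adj u a)
    (huc : G.Adj u c) (hic : G.Adj i c) (hca : G.Adj c a) (hia : i ≠ a) : G.Adj i a := by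
  refine hG.adj_of_walk (v := u) (.cons hic (.cons hca .nil)) ?_ hui hua hia
  simp [hui.ne, hua.ne, huc.ne]

/-- The earlier neighbours of `i` form a clique, so those other than the parent `u` are earlier
neighbours of `u`. Conversely, let `c` be a second earlier neighbour of `i`. Any other earlier
neighbour `a` of `u` is adjacent to `c`, as both come before `u`, and then `i`, `c`, `a` is a walk
between neighbours of `u` that avoids `u`. -/
theorem isElimination (h : IsSearchOrder G num) (hG : IsBlockGraph G) {par : ℕ → ℕ} {full : ℕ → Bool}
    (hle : ∀ i, 1 ≤ i → i ≤ n → ∀ a, a < i → rankAdj G num a i → a ≤ par i)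
    (hpar : ∀ i, 1 ≤ i → i ≤ n → par i = 0 ∨ par i < i ∧ rankAdj G num (par i) i)
    (hfull : ∀ i, 1 ≤ i → i ≤ n → (full i = true ↔ ∃ a b, a ≠ b ∧ a < i ∧ b < i ∧
      rankAdj G num a i ∧ rankAdj G num b i)) : IsElimination n (rankAdj G num) par full := by
  have hpos : ∀ a b, rankAdj G num a b → 1 ≤ a := by
    rintro a b ⟨u, v, rfl, rfl, -⟩
    exact h.pos u
  have clique : ∀ i x y, x < i → y < i → x ≠ y → rankAdj G num x i → rankAdj G num y i →
      rankAdj G num x y := by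
    rintro i x y hx hy hxy ⟨x, v, rfl, rfl, hA⟩ ⟨y, v', rfl, hv, hA'⟩
    rw [h.inj _ _ hv] at hA'
    exact h.rankAdj_iff.2 (h.adj_of_earlier hG hA hA' hx hy fun e => hxy (by rw [e]))
  refine ⟨fun _ _ => rankAdj.symm, ?_, hpos, ?_, ?_, ?_, ?_⟩
  · rintro a ⟨u, v, hu, hv, hA⟩
    exact hA.ne (h.inj _ _ (hu.trans hv.symm))
  · rintro a b ⟨u, v, rfl, rfl, -⟩
    exact h.le u
  · intro i hi hin
    rcases hpar i hi hin with hp | hp <;> omega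
  · intro i hi hin hf a ha
    obtain ⟨c₁, c₂, hc, h1, h2, hR1, hR2⟩ := (hfull i hi hin).1 hf
    have l1 := hle i hi hin c₁ h1 hR1
    have l2 := hle i hi hin c₂ h2 hR2
    have hp : par i < i ∧ rankAdj G num (par i) i := by
      rcases hpar i hi hin with hp | hp
      · have := hpos _ _ hR1
        omega
      · exact hp
    obtain ⟨c, hcp, hRc⟩ : ∃ c, c < par i ∧ rankAdj G num c i := by
      by_cases e : c₁ = par i
      · exact ⟨c₂, by omega, hR2⟩
      · exact ⟨c₁, by omega, hR1⟩
    constructor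
    · intro hR
      have := hle i hi hin a ha hR
      rcases this.eq_or_lt with e | e
      · exact .inl e
      · exact .inr ⟨e, clique i a (par i) ha hp.1 e.ne hR hp.2⟩
    · rintro (rfl | ⟨hap, hR⟩)
      · exact hp.2
      · have hRcp := clique i c (par i) (by omega) hp.1 hcp.ne hRc hp.2
        by_cases e : a = c
        · rwa [e]
        have hac := clique (par i) a c hap hcp e hR hRcp
        have hpi := hp.2
        generalize par i = u at *
        obtain ⟨a, u, rfl, rfl, hau⟩ := hR
        obtain ⟨c, i, rfl, rfl, hci⟩ := hRc
        rw [h.rankAdj_iff] at hRcp hac hpi ⊢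
        exact (adj_of_triangles hG hpi hau.symm hRcp.symm hci.symm hac.symm
          (fun e => by rw [e] at ha; omega)).symm
  · intro i hi hin hf a ha
    constructor
    · intro hR
      refine ⟨?_, hpos _ _ hR⟩
      have h1 := hle i hi hin a ha hR
      have h2 := hpos _ _ hR
      rcases hpar i hi hin with hp | hp
      · omega
      · by_contra hne
        rw [(hfull i hi hin).2 ⟨a, par i, hne, ha, hp.1, hR, hp.2⟩] at hf
        cases hf
    · rintro ⟨rfl, h0⟩
      rcases hpar i hi hin with hp | hp
      · omega
      · exact hp.2

end IsSearchOrder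

end LiarVE

/-! ### Dynamic programming over a tree automaton

The table entry `g p q` is `n + 1` minus the least number of elements below `p` with which `p` gets the
state `q`, and `0` if there is no way to get this state. -/

namespace LiarVE

/-- `st i` are the states of the nodes `0, …, i` in the run of the automaton for the set `L`, after
the nodes `n, …, i + 1` have been merged into their parents. -/
structure IsRun {N : ℕ} (M : Automaton N) (n : ℕ) (par : ℕ → ℕ) (full : ℕ → Bool) (L : Finset ℕ)
    (st : ℕ → ℕ → Fin N) : Prop where
  empty : st n 0 = M.empty
  init : ∀ p, 1 ≤ p → p ≤ n → st n p = M.init (decide (p ∈ L))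
  step : ∀ i, 1 ≤ i → i ≤ n → ∀ p, p < i → st (i - 1) p =
    if p = par i then M.comb (full i) (st i p) (st i i) else st i p

/-- One step of the reconstruction: the states of `i` and its parent before their merger. -/
def splitState {N : ℕ} (par : ℕ → ℕ) (b₁ b₂ : ℕ → Fin N → Fin N) (i : ℕ) (c : ℕ → Fin N) : ℕ → Fin N :=
  Function.update (Function.update c (par i) (b₁ i (c (par i)))) i (b₂ i (c (par i)))

/-- The reconstruction for the nodes `i + 1, …, i + k`. -/
def splitStates {N : ℕ} (par : ℕ → ℕ) (b₁ b₂ : ℕ → Fin N → Fin N) :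
    ℕ → ℕ → (ℕ → Fin N) → ℕ → Fin N
  | 0, _, c => c
  | k + 1, i, c => splitStates par b₁ b₂ k (i + 1) (splitState par b₁ b₂ (i + 1) c)

/-- The initial table. -/
def initGain {N : ℕ} (M : Automaton N) (n p : ℕ) (q : Fin N) : ℕ :=
  if p = 0 then if q = M.empty then n + 1 else 0
  else if q = M.init true then n else if q = M.init false then n + 1 else 0

/-- The table `g` and the back pointers `β₁`, `β₂` are correct for the nodes `0, …, i`. -/
structure IsTable {N : ℕ} (M : Automaton N) (n : ℕ) (par : ℕ → ℕ) (full : ℕ → Bool) (i : ℕ)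
    (g : ℕ → Fin N → ℕ) (β₁ β₂ : ℕ → Fin N → ℕ) : Prop where
  le : ∀ p q, p ≤ i → g p q ≤ n + 1
  lower : ∀ L, L ⊆ Finset.Icc 1 n → ∀ st, IsRun M n par full L st →
    ∑ p ∈ Finset.range (i + 1), (n + 1 - g p (st i p)) ≤ L.card
  attained : ∀ b₁ b₂ : ℕ → Fin N → Fin N,
    (∀ j, i < j → j ≤ n → ∀ q, (b₁ j q).val = β₁ j q ∧ (b₂ j q).val = β₂ j q) →
    ∀ c : ℕ → Fin N, (∀ p, p ≤ i → 0 < g p (c p)) → ∃ L, L ⊆ Finset.Icc 1 n ∧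
      (∀ p, 1 ≤ p → p ≤ n → splitStates par b₁ b₂ (n - i) i c p = M.init (decide (p ∈ L))) ∧
      L.card = ∑ p ∈ Finset.range (i + 1), (n + 1 - g p (c p)) ∧
      ∀ st, IsRun M n par full L st → ∀ p, p ≤ i → st i p = c p

variable {N : ℕ} {M : Automaton N} {n : ℕ} {par : ℕ → ℕ} {full : ℕ → Bool}

/-- The deficit `n + 1 - g` is 1 at selected nodes and 0 at the others and at the virtual root. -/
theorem sum_initGain (hM : M.init true ≠ M.init false) {L : Finset ℕ} (hL : L ⊆ Finset.Icc 1 n)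
    {c : ℕ → Fin N} (h0 : c 0 = M.empty) (hc : ∀ p, 1 ≤ p → p ≤ n → c p = M.init (decide (p ∈ L))) :
    ∑ p ∈ Finset.range (n + 1), (n + 1 - initGain M n p (c p)) = L.card := by
  have : ∀ p ∈ Finset.range (n + 1), n + 1 - initGain M n p (c p) = if p ∈ L then 1 else 0 := by
    intro p hp
    rw [Finset.mem_range] at hp
    rcases Nat.eq_zero_or_pos p with rfl | hp0
    · have : 0 ∉ L := fun h => by simpa using hL h
      simp [initGain, h0, this]
    · rw [hc p hp0 (by omega)]
      by_cases hpL : p ∈ L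
      · simp [initGain, hpL, hp0.ne']
      · simp [initGain, hpL, hp0.ne', hM.symm]
  rw [Finset.sum_congr rfl this, Finset.sum_ite_mem, Finset.sum_const, smul_eq_mul, mul_one]
  congr 1
  refine Finset.inter_eq_right.2 fun p hp => ?_
  have := Finset.mem_Icc.1 (hL hp)
  exact Finset.mem_range.2 (by omega)

theorem isTable_initGain (hM : M.init true ≠ M.init false) {g : ℕ → Fin N → ℕ}
    (hg : ∀ p q, p ≤ n → g p q = initGain M n p q) (β₁ β₂ : ℕ → Fin N → ℕ) :
    IsTable M n par full n g β₁ β₂ := by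
  have hsum : ∀ c : ℕ → Fin N, ∑ p ∈ Finset.range (n + 1), (n + 1 - g p (c p)) =
      ∑ p ∈ Finset.range (n + 1), (n + 1 - initGain M n p (c p)) := fun c =>
    Finset.sum_congr rfl fun p hp => by rw [hg _ _ (by rw [Finset.mem_range] at hp; omega)]
  refine ⟨?_, ?_, ?_⟩
  · intro p q hp
    rw [hg p q hp]
    unfold initGain
    split_ifs <;> omega
  · intro L hL st hst
    rw [hsum, sum_initGain hM hL hst.empty hst.init]
  · intro b₁ b₂ _ c hc
    have h0 : c 0 = M.empty := by
      have := hc 0 (by omega)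
      rw [hg _ _ (by omega)] at this
      by_contra hne
      simp [initGain, hne] at this
    have hin : ∀ p, 1 ≤ p → p ≤ n → c p = M.init true ∨ c p = M.init false := by
      intro p hp hpn
      have := hc p hpn
      rw [hg _ _ hpn] at this
      by_contra! hne
      simp [initGain, hne, show p ≠ 0 by omega] at this
    -- As the initial states differ, states of positive gain determine the selected set.
    have hL : ∀ p, 1 ≤ p → p ≤ n →
        c p = M.init (decide (p ∈ (Finset.Icc 1 n).filter fun p => c p = M.init true)) := by
      intro p hp hpn
      rcases hin p hp hpn with h | h
      · simp [h, hp, hpn]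
      · simp [h, hM.symm]
    refine ⟨(Finset.Icc 1 n).filter fun p => c p = M.init true, Finset.filter_subset _ _, ?_, ?_, ?_⟩
    · simpa [splitStates] using hL
    · rw [hsum, sum_initGain hM (Finset.filter_subset _ _) h0 hL]
    · intro st hst p hp
      rcases Nat.eq_zero_or_pos p with rfl | hp0
      · rw [hst.empty, h0]
      · rw [hst.init p hp0 hp, ← hL p hp0 hp]

/-- The terms of `i` and `par i` become one term, the rest of the sum is unchanged. Deficits add up,
since `g₁ + g₂ - (n + 1)` has deficit `(n + 1 - g₁) + (n + 1 - g₂)` when it is positive; as gains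
are at most `n + 1`, truncation yields 0 if one of the states is unattainable. For attainment, the
back pointers extend a choice of states on `0, …, i - 1` to `0, …, i`. -/
theorem IsTable.step {i : ℕ} (hi : 1 ≤ i) (hin : i ≤ n) (hpar : par i < i) {g g' : ℕ → Fin N → ℕ}
    {β₁ β₂ β₁' β₂' : ℕ → Fin N → ℕ} (h : IsTable M n par full i g β₁ β₂)
    (hβ : ∀ j, i < j → ∀ q, β₁' j q = β₁ j q ∧ β₂' j q = β₂ j q)
    (hg : ∀ p q, p < i → p ≠ par i → g' p q = g p q)
    (hmax : ∀ q₁ q₂, g (par i) q₁ + g i q₂ - (n + 1) ≤ g' (par i) (M.comb (full i) q₁ q₂))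
    (hatt : ∀ q, 0 < g' (par i) q → ∃ q₁ q₂, M.comb (full i) q₁ q₂ = q ∧ β₁' i q = q₁.val ∧
      β₂' i q = q₂.val ∧ g' (par i) q = g (par i) q₁ + g i q₂ - (n + 1)) :
    IsTable M n par full (i - 1) g' β₁' β₂' := by
  have hii : i - 1 + 1 = i := by omega
  have hmem : par i ∈ Finset.range i := Finset.mem_range.2 hpar
  refine ⟨?_, ?_, ?_⟩
  · intro p q hp
    by_cases e : p = par i
    · subst e
      rcases Nat.eq_zero_or_pos (g' (par i) q) with h0 | h0
      · omega
      · obtain ⟨q₁, q₂, -, -, -, h1⟩ := hatt q h0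
        have h2 := h.le (par i) q₁ (by omega)
        have h3 := h.le i q₂ le_rfl
        omega
    · rw [hg p q (by omega) e]
      exact h.le p q (by omega)
  · intro L hL st hst
    refine le_trans ?_ (h.lower L hL st hst)
    rw [hii, Finset.sum_range_succ, ← Finset.add_sum_erase _ _ hmem, ← Finset.add_sum_erase _ _ hmem]
    have e1 : ∑ x ∈ (Finset.range i).erase (par i), (n + 1 - g' x (st (i - 1) x)) =
        ∑ x ∈ (Finset.range i).erase (par i), (n + 1 - g x (st i x)) := by
      refine Finset.sum_congr rfl fun x hx => ?_
      rw [Finset.mem_erase, Finset.mem_range] at hx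
      rw [hst.step i hi hin x hx.2, if_neg hx.1, hg x _ hx.2 hx.1]
    rw [e1, hst.step i hi hin _ hpar, if_pos rfl]
    have h1 := hmax (st i (par i)) (st i i)
    have h2 := h.le (par i) (st i (par i)) (by omega)
    have h3 := h.le i (st i i) le_rfl
    omega
  · intro b₁ b₂ hb c hc
    obtain ⟨q₁, q₂, hcomb, hq₁, hq₂, hgain⟩ := hatt (c (par i)) (hc _ (by omega))
    have hbi := hb i (by omega) hin (c (par i))
    have e1 : b₁ i (c (par i)) = q₁ := Fin.ext (hbi.1.trans hq₁)
    have e2 : b₂ i (c (par i)) = q₂ := Fin.ext (hbi.2.trans hq₂)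
    have hpi : par i ≠ i := by omega
    have c1 : splitState par b₁ b₂ i c (par i) = q₁ := by
      simp [splitState, Function.update_of_ne hpi, e1]
    have c2 : splitState par b₁ b₂ i c i = q₂ := by simp [splitState, e2]
    have c3 : ∀ x, x < i → x ≠ par i → splitState par b₁ b₂ i c x = c x := fun x hx hx' => by
      simp [splitState, Function.update_of_ne hx.ne, Function.update_of_ne hx']
    have hpos := hc (par i) (by omega)
    have l1 := h.le (par i) q₁ (by omega)
    have l2 := h.le i q₂ le_rfl
    obtain ⟨L, hL, hL1, hL2, hL3⟩ := h.attained b₁ b₂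
      (fun j hj hjn q => ⟨((hb j (by omega) hjn q).1.trans (hβ j hj q).1),
        ((hb j (by omega) hjn q).2.trans (hβ j hj q).2)⟩) (splitState par b₁ b₂ i c) (by
        intro x hx
        rcases hx.eq_or_lt with rfl | hx
        · rw [c2]; omega
        · by_cases e : x = par i
          · rw [e, c1]; omega
          · rw [c3 x hx e, ← hg x _ hx e]
            exact hc x (by omega))
    refine ⟨L, hL, ?_, ?_, ?_⟩
    · intro p hp hpn
      rw [← hL1 p hp hpn, show n - (i - 1) = (n - i) + 1 by omega, splitStates, hii]
    · rw [hL2, hii, Finset.sum_range_succ, ← Finset.add_sum_erase _ _ hmem,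
        ← Finset.add_sum_erase _ _ hmem, c1, c2]
      have e1 : ∑ x ∈ (Finset.range i).erase (par i), (n + 1 - g x (splitState par b₁ b₂ i c x)) =
          ∑ x ∈ (Finset.range i).erase (par i), (n + 1 - g' x (c x)) := by
        refine Finset.sum_congr rfl fun x hx => ?_
        rw [Finset.mem_erase, Finset.mem_range] at hx
        rw [c3 x hx.2 hx.1, hg x _ hx.2 hx.1]
      rw [e1]
      omega
    · intro st hst p hp
      rw [hst.step i hi hin p (by omega)]
      split
      · rename_i e
        rw [e, hL3 st hst _ (by omega), hL3 st hst i le_rfl, c1, c2, hcomb]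
      · rename_i e
        rw [hL3 st hst _ (by omega), c3 p (by omega) e]

/-- The reconstruction from the best accepting state of the root yields an optimal set. -/
theorem IsTable.optimal {g : ℕ → Fin N → ℕ} {β₁ β₂ : ℕ → Fin N → ℕ}
    (h : IsTable M n par full 0 g β₁ β₂) {good : Finset ℕ → Prop}
    (hrun : ∀ L, L ⊆ Finset.Icc 1 n → ∃ st, IsRun M n par full L st ∧ (M.acc (st 0 0) ↔ good L))
    (hgood : good (Finset.Icc 1 n)) {q : Fin N}
    (hq : (M.acc q ∧ ∀ q', M.acc q' → g 0 q' ≤ g 0 q) ∨ ∀ q', M.acc q' → g 0 q' = 0)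
    {b₁ b₂ : ℕ → Fin N → Fin N}
    (hb : ∀ j, 1 ≤ j → j ≤ n → ∀ q, (b₁ j q).val = β₁ j q ∧ (b₂ j q).val = β₂ j q)
    {c : ℕ → Fin N} (hc : c 0 = q) : ∃ L, L ⊆ Finset.Icc 1 n ∧ good L ∧
      (∀ L', L' ⊆ Finset.Icc 1 n → good L' → L.card ≤ L'.card) ∧
      ∀ p, 1 ≤ p → p ≤ n → splitStates par b₁ b₂ n 0 c p = M.init (decide (p ∈ L)) := by
  have lower : ∀ L', L' ⊆ Finset.Icc 1 n → good L' → ∃ q', M.acc q' ∧ n + 1 - g 0 q' ≤ L'.card := by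
    intro L' hL' hg
    obtain ⟨st, hst, hacc⟩ := hrun L' hL'
    refine ⟨st 0 0, hacc.2 hg, ?_⟩
    simpa only [zero_add, Finset.sum_range_one] using h.lower L' hL' st hst
  -- The set of all nodes is good and has `n` elements, so some accepting state has positive gain,
  -- which rules out the second alternative of `hq`.
  obtain ⟨q₀, hq₀, hle₀⟩ := lower _ subset_rfl hgood
  rw [Nat.card_Icc] at hle₀
  obtain ⟨hacc, hmax⟩ : M.acc q ∧ ∀ q', M.acc q' → g 0 q' ≤ g 0 q := by
    refine hq.resolve_right fun h0 => ?_
    have := h0 q₀ hq₀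
    omega
  obtain ⟨L, hL, h1, h2, h3⟩ := h.attained b₁ b₂ (fun j hj => hb j hj) c (by
    intro p hp
    obtain rfl : p = 0 := by omega
    have := hmax q₀ hq₀
    rw [hc]
    omega)
  obtain ⟨st, hst, hgst⟩ := hrun L hL
  simp only [zero_add, Finset.sum_range_one, hc] at h2
  refine ⟨L, hL, hgst.1 ?_, fun L' hL' hg => ?_, h1⟩
  · rwa [h3 st hst 0 le_rfl, hc]
  · obtain ⟨q', hq', hle'⟩ := lower L' hL' hg
    have := hmax q' hq'
    omega

end LiarVE

/-! ### Graph search on the word RAM -/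

namespace WordRAM

/-- The lists of the neighbours in the graph `A` on `0, …, n - 1`, stored one after the other in the
array `tgt` of length `l`; the list of `v` starts at `off v`. -/
structure IsAdjacencyArray (n l : ℕ) (A : ℕ → ℕ → Prop) (off tgt : ℕ → ℕ) : Prop where
  symm : ∀ u v, A u v → A v u
  lt : ∀ u v, A u v → u < n
  off_le_succ : ∀ v, v < n → off v ≤ off (v + 1)
  off_zero : off 0 = 0
  off_last : off n = l
  adj : ∀ v, v < n → ∀ w, A v w ↔ ∃ j, off v ≤ j ∧ j < off (v + 1) ∧ tgt j = w
  inj : ∀ v, v < n → ∀ i j, off v ≤ i → i < off (v + 1) → off v ≤ j → j < off (v + 1) →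
    tgt i = tgt j → i = j

theorem IsAdjacencyArray.off_mono {n l : ℕ} {A : ℕ → ℕ → Prop} {off tgt : ℕ → ℕ}
    (h : IsAdjacencyArray n l A off tgt) {v w : ℕ} (hvw : v ≤ w) (hw : w ≤ n) : off v ≤ off w := by
  induction w, hvw using Nat.le_induction with
  | base => exact le_rfl
  | succ w _ ih => exact (ih (by omega)).trans (h.off_le_succ w (by omega))

theorem IsAdjacencyArray.off_le {n l : ℕ} {A : ℕ → ℕ → Prop} {off tgt : ℕ → ℕ}
    (h : IsAdjacencyArray n l A off tgt) {v : ℕ} (hv : v ≤ n) : off v ≤ l :=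
  h.off_last ▸ h.off_mono hv le_rfl

theorem IsAdjacencyArray.adj_tgt {n l : ℕ} {A : ℕ → ℕ → Prop} {off tgt : ℕ → ℕ}
    (h : IsAdjacencyArray n l A off tgt) {v j : ℕ} (hv : v < n) (hj : off v ≤ j)
    (hlt : j < off (v + 1)) : A v (tgt j) := (h.adj v hv _).2 ⟨j, hj, hlt, rfl⟩

theorem IsAdjacencyArray.tgt_lt {n l : ℕ} {A : ℕ → ℕ → Prop} {off tgt : ℕ → ℕ}
    (h : IsAdjacencyArray n l A off tgt) {v j : ℕ} (hv : v < n) (hj : off v ≤ j)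
    (hlt : j < off (v + 1)) : tgt j < n := h.lt _ _ (h.symm _ _ (h.adj_tgt hv hj hlt))

/-- The invariant of the search. The vertices with numbers `1, …, tail` have been found, those with
numbers smaller than `head` have been scanned, and that with number `head` up to the position `j`
of its list, which ends at `e`. The vertices smaller than `s` have been found. -/
structure SearchInv (n l : ℕ) (A : ℕ → ℕ → Prop) (off tgt num ord : ℕ → ℕ) (tail head j e s : ℕ) :
    Prop where
  s_le : s ≤ n
  tail_le : tail ≤ n
  head_le : head ≤ tail
  found : ∀ v, v < s → num v ≠ 0
  num_le : ∀ v, v < n → num v ≤ tail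
  ord_num : ∀ v, v < n → num v ≠ 0 → ord (num v) = v
  ord_lt : ∀ r, 1 ≤ r → r ≤ tail → ord r < n
  num_ord : ∀ r, 1 ≤ r → r ≤ tail → num (ord r) = r
  j_le : j ≤ e
  e_le : e ≤ l
  scanning : j < e → 1 ≤ head ∧ off (ord head) ≤ j ∧ e = off (ord head + 1)
  scanned : ∀ r, 1 ≤ r → r ≤ head → ∀ i, off (ord r) ≤ i → i < off (ord r + 1) →
    num (tgt i) ≠ 0 ∨ r = head ∧ j ≤ i ∧ i < e
  search : ∀ v, v < n → num v ≠ 0 → (∃ u, A u v ∧ num u ≠ 0 ∧ num u < num v) ∨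
    ∀ u w, A u w → num u ≠ 0 → num u < num v → num w ≠ 0 ∧ num w < num v

/-- The work that remains to be done in the search. -/
def searchMeasure (n : ℕ) (off num : ℕ → ℕ) (head j e s : ℕ) : ℕ :=
  ∑ v ∈ Finset.range n, (if num v ≠ 0 ∧ num v ≤ head then 0 else off (v + 1) - off v + 1) +
    (e - j) + (n - s)

namespace SearchInv

variable {n l : ℕ} {A : ℕ → ℕ → Prop} {off tgt num ord : ℕ → ℕ} {tail head j e s : ℕ}

/-- The map `ord` injects the numbers in use into the vertices other than `w`, so one more number is
available. -/
theorem tail_lt (h : SearchInv n l A off tgt num ord tail head j e s) {w : ℕ} (hw : w < n)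
    (hw0 : num w = 0) : tail < n := by
  have : (Finset.Icc 1 tail).card ≤ ((Finset.range n).erase w).card := by
    refine Finset.card_le_card_of_injOn ord ?_ ?_
    · intro r hr
      have hr := Finset.mem_Icc.1 hr
      refine Finset.mem_erase.2 ⟨?_, Finset.mem_range.2 (h.ord_lt r hr.1 hr.2)⟩
      rintro rfl
      rw [h.num_ord r hr.1 hr.2] at hw0
      omega
    · intro r hr r' hr' e
      have hr := Finset.mem_Icc.1 hr
      have hr' := Finset.mem_Icc.1 hr'
      rw [← h.num_ord r hr.1 hr.2, e, h.num_ord r' hr'.1 hr'.2]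
  rw [Nat.card_Icc, Finset.card_erase_of_mem (Finset.mem_range.2 hw), Finset.card_range] at this
  omega

/-- By `hnew` the vertex either has a found neighbour, whose number is smaller, or is a new start
while no edge leaves the found vertices. These are the two alternatives of a search order. -/
theorem visit (h : SearchInv n l A off tgt num ord tail head j e s) {w : ℕ} (hw : w < n)
    (hw0 : num w = 0) (hA : IsAdjacencyArray n l A off tgt)
    (hnew : (∃ u, A u w ∧ num u ≠ 0) ∨ ∀ u x, A u x → num u ≠ 0 → num x ≠ 0) :
    SearchInv n l A off tgt (Function.update num w (tail + 1)) (Function.update ord (tail + 1) w)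
      (tail + 1) head j e s := by
  have hne : ∀ {v}, num v ≠ 0 → Function.update num w (tail + 1) v = num v := by
    intro v hv
    exact Function.update_of_ne (by rintro rfl; exact hv hw0) _ _
  have hne' : ∀ {v}, num v ≠ 0 → Function.update num w (tail + 1) v ≠ 0 := by
    intro v hv
    rwa [hne hv]
  have hord : ∀ {r}, r ≤ tail → Function.update ord (tail + 1) w r = ord r := by
    intro r hr
    exact Function.update_of_ne (by omega) _ _
  constructor
  · exact h.s_le
  · exact h.tail_lt hw hw0
  · exact h.head_le.trans (by omega)
  · exact fun v hv => hne' (h.found v hv)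
  · intro v hv
    have := h.num_le v hv
    rw [Function.update_apply]
    split <;> omega
  · intro v hv hv0
    by_cases e : v = w
    · subst e; simp
    · rw [Function.update_of_ne e] at hv0 ⊢
      rw [hord (h.num_le v hv), h.ord_num v hv hv0]
  · intro r hr hr'
    rw [Function.update_apply]
    split
    · exact hw
    · exact h.ord_lt r hr (by omega)
  · intro r hr hr'
    by_cases e : r = tail + 1
    · subst e; simp
    · have := h.num_ord r hr (by omega)
      rw [hord (by omega), hne (by omega), this]
  · exact h.j_le
  · exact h.e_le
  · rw [hord h.head_le]; exact h.scanning
  · intro r hr hr' i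
    rw [hord (hr'.trans h.head_le)]
    intro hi hi'
    rcases h.scanned r hr hr' i hi hi' with h1 | h1
    · exact .inl (hne' h1)
    · exact .inr h1
  · intro v hv hv0
    by_cases ev : v = w
    · subst ev
      rw [Function.update_self]
      rcases hnew with ⟨u, hu, hu0⟩ | hnew
      · refine .inl ⟨u, hu, hne' hu0, ?_⟩
        rw [hne hu0]
        have := h.num_le u (hA.lt _ _ hu)
        omega
      · refine .inr fun u x hux hu0 hlt => ?_
        by_cases eu : u = v
        · subst eu; rw [Function.update_self] at hlt; omega
        · rw [Function.update_of_ne eu] at hu0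
          have hx := hnew u x hux hu0
          refine ⟨hne' hx, ?_⟩
          rw [hne hx]
          have := h.num_le x (hA.lt _ _ (hA.symm _ _ hux))
          omega
    · rw [Function.update_of_ne ev] at hv0 ⊢
      have hvt := h.num_le v hv
      rcases h.search v hv hv0 with ⟨u, hu, hu0, hlt⟩ | hcl
      · exact .inl ⟨u, hu, hne' hu0, by rwa [hne hu0]⟩
      · refine .inr fun u x hux hu0 hlt => ?_
        by_cases eu : u = w
        · subst eu; rw [Function.update_self] at hlt; omega
        · rw [Function.update_of_ne eu] at hu0 hlt
          obtain ⟨h1, h2⟩ := hcl u x hux hu0 hlt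
          exact ⟨hne' h1, by rwa [hne h1]⟩

/-- The new number exceeds `head`, so the vertex still counts as unscanned. -/
theorem measure_visit (h : SearchInv n l A off tgt num ord tail head j e s) {w : ℕ} (hw0 : num w = 0)
    (j' s' : ℕ) : searchMeasure n off (Function.update num w (tail + 1)) head j' e s' =
      searchMeasure n off num head j' e s' := by
  have := h.head_le
  unfold searchMeasure
  congr 2
  refine Finset.sum_congr rfl fun v _ => ?_
  by_cases ev : v = w
  · subst ev
    rw [Function.update_self, hw0, if_neg (by omega), if_neg (by omega)]
  · rw [Function.update_of_ne ev]

theorem advance (h : SearchInv n l A off tgt num ord tail head j e s) (hj : j < e)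
    (hn : num (tgt j) ≠ 0) : SearchInv n l A off tgt num ord tail head (j + 1) e s := by
  obtain ⟨h1, h2, h3⟩ := h.scanning hj
  refine { h with j_le := hj, scanning := fun _ => ⟨h1, by omega, h3⟩, scanned := ?_ }
  intro r hr hr' i hi hi'
  rcases h.scanned r hr hr' i hi hi' with h4 | ⟨h4, h5, h6⟩
  · exact .inl h4
  · by_cases ei : i = j
    · exact .inl (ei ▸ hn)
    · exact .inr ⟨h4, by omega, h6⟩

theorem dequeue (h : SearchInv n l A off tgt num ord tail head j e s)
    (hA : IsAdjacencyArray n l A off tgt) (hj : ¬ j < e) (hh : head < tail) :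
    SearchInv n l A off tgt num ord tail (head + 1) (off (ord (head + 1)))
      (off (ord (head + 1) + 1)) s := by
  have hlt := h.ord_lt (head + 1) (by omega) hh
  refine { h with
    head_le := hh
    j_le := hA.off_le_succ _ hlt
    e_le := hA.off_le hlt
    scanning := fun _ => ⟨by omega, le_rfl, rfl⟩
    scanned := ?_ }
  intro r hr hr' i hi hi'
  by_cases er : r = head + 1
  · subst er
    exact .inr ⟨rfl, hi, hi'⟩
  · rcases h.scanned r hr (by omega) i hi hi' with h4 | ⟨-, h5, h6⟩
    · exact .inl h4
    · omega

/-- The weight of the dequeued vertex is the length of its list plus one. The length reappears as `e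
- j`, and the one is the gain. -/
theorem measure_dequeue (h : SearchInv n l A off tgt num ord tail head j e s) (hh : head < tail) :
    searchMeasure n off num (head + 1) (off (ord (head + 1))) (off (ord (head + 1) + 1)) s <
      searchMeasure n off num head j e s := by
  have hlt := h.ord_lt (head + 1) (by omega) hh
  have hnum := h.num_ord (head + 1) (by omega) hh
  have hmem : ord (head + 1) ∈ Finset.range n := Finset.mem_range.2 hlt
  have hsum : ∑ v ∈ (Finset.range n).erase (ord (head + 1)),
        (if num v ≠ 0 ∧ num v ≤ head + 1 then 0 else off (v + 1) - off v + 1) =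
      ∑ v ∈ (Finset.range n).erase (ord (head + 1)),
        (if num v ≠ 0 ∧ num v ≤ head then 0 else off (v + 1) - off v + 1) := by
    refine Finset.sum_congr rfl fun v hv => ?_
    rw [Finset.mem_erase, Finset.mem_range] at hv
    have : num v ≠ head + 1 := by
      intro hv'
      have := h.ord_num v hv.2 (by omega)
      rw [hv'] at this
      exact hv.1 this.symm
    congr 1
    rw [eq_iff_iff]
    omega
  unfold searchMeasure
  rw [← Finset.add_sum_erase _ _ hmem, ← Finset.add_sum_erase (Finset.range n)
    (fun v => if num v ≠ 0 ∧ num v ≤ head then 0 else off (v + 1) - off v + 1) hmem, hsum, hnum,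
    if_pos (by omega), if_neg (by omega)]
  omega

theorem closed (h : SearchInv n l A off tgt num ord tail head j e s)
    (hA : IsAdjacencyArray n l A off tgt) (hj : ¬ j < e) (hh : ¬ head < tail) (u x : ℕ)
    (hux : A u x) (hu : num u ≠ 0) : num x ≠ 0 := by
  have hun := hA.lt _ _ hux
  obtain ⟨i, hi, hi', rfl⟩ := (hA.adj u hun x).1 hux
  have h1 := h.num_le u hun
  have h2 := h.ord_num u hun hu
  rcases h.scanned (num u) (by omega) (by omega) i (by rwa [h2]) (by rwa [h2]) with h3 | h3
  · exact h3
  · omega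

theorem next_start (h : SearchInv n l A off tgt num ord tail head j e s) (hs : s < n)
    (hn : num s ≠ 0) : SearchInv n l A off tgt num ord tail head j e (s + 1) := by
  refine { h with s_le := hs, found := ?_ }
  intro v hv
  by_cases ev : v = s
  · exact ev ▸ hn
  · exact h.found v (by omega)

theorem initial :
    SearchInv n l A off tgt (fun _ => 0) (fun _ => 0) 0 0 0 0 0 := by
  constructor <;> simp <;> omega

/-- The search may stop with lists unread. It matters only that all vertices have been found, and
`num` injects them into `1, …, tail`. -/
theorem tail_eq (h : SearchInv n l A off tgt num ord tail head j e n) : tail = n := by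
  refine le_antisymm h.tail_le ?_
  have : (Finset.range n).card ≤ (Finset.Icc 1 tail).card := by
    refine Finset.card_le_card_of_injOn num ?_ ?_
    · intro v hv
      have hv := Finset.mem_range.1 hv
      have h1 := h.found v hv
      have h2 := h.num_le v hv
      exact Finset.mem_Icc.2 ⟨by omega, h2⟩
    · intro v hv w hw e
      have hv := Finset.mem_range.1 hv
      have hw := Finset.mem_range.1 hw
      rw [← h.ord_num v hv (h.found v hv), e, h.ord_num w hw (h.found w hw)]
  simpa using this

end SearchInv

/-! The search keeps in the variables `1` to `5` the values `tail`, `head`, `j`, `e` and `s` of its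
invariant, and in the arrays `3` and `4` the numbers of the vertices and the vertices in the order of
their numbers. -/

/-- Give the next number to the vertex in variable `x`. -/
def visitProg (x : ℕ) : Prog :=
  .seq (.assign 1 (.add (.var 1) (.const 1))) (.seq (.write 3 (.var x) (.var 1))
    (.write 4 (.var 1) (.var x)))

/-- A pass reads one list entry, or dequeues a vertex, or, if nothing is pending, tries the next
start. This flattens the nested loops of a breadth-first search into one; array 4 is also the queue.
-/
def searchBody : Prog :=
  .ite (.lt (.var 3) (.var 4))
    (.seq (.assign 6 (.read 1 (.var 3))) (.seq (.assign 3 (.add (.var 3) (.const 1)))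
      (.ite (.eq (.read 3 (.var 6)) (.const 0)) (visitProg 6) .skip)))
    (.ite (.lt (.var 2) (.var 1))
      (.seq (.assign 2 (.add (.var 2) (.const 1))) (.seq (.assign 3 (.read 0 (.read 4 (.var 2))))
        (.assign 4 (.read 0 (.add (.read 4 (.var 2)) (.const 1))))))
      (.seq (.ite (.eq (.read 3 (.var 5)) (.const 0)) (visitProg 5) .skip)
        (.assign 5 (.add (.var 5) (.const 1)))))

def searchProg : Prog := .loop (.lt (.var 5) (.var 0)) searchBody

theorem searchProg_run {n l : ℕ} {A : ℕ → ℕ → Prop} {off tgt : ℕ → ℕ}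
    (hA : IsAdjacencyArray n l A off tgt) {W : ℕ} (hW : 2 * n + l + 2 < W) {σ : Store}
    (h0 : σ.arr 0 = off) (h1 : σ.arr 1 = tgt) (hz : ∀ a, 2 ≤ a → σ.arr a = fun _ => 0)
    (hn : σ.var 0 = n) (hv : ∀ x, 1 ≤ x → σ.var x = 0) :
    ∃ t τ, Run W searchProg σ t τ ∧
      t ≤ ((Cond.lt (.var 5) (.var 0)).cost + 1 + searchBody.cost) * (l + 2 * n + 1) ∧
      τ.arr 0 = off ∧ τ.arr 1 = tgt ∧ τ.var 0 = n ∧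
      (∀ a, 2 ≤ a → a ≠ 3 → a ≠ 4 → τ.arr a = fun _ => 0) ∧
      ∃ tail head j e, SearchInv n l A off tgt (τ.arr 3) (τ.arr 4) tail head j e n := by
  let I : Store → Prop := fun τ => τ.arr 0 = off ∧ τ.arr 1 = tgt ∧ τ.var 0 = n ∧
    (∀ a, 2 ≤ a → a ≠ 3 → a ≠ 4 → τ.arr a = fun _ => 0) ∧
    SearchInv n l A off tgt (τ.arr 3) (τ.arr 4) (τ.var 1) (τ.var 2) (τ.var 3) (τ.var 4) (τ.var 5)
  let μ : Store → ℕ := fun τ =>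
    searchMeasure n off (τ.arr 3) (τ.var 2) (τ.var 3) (τ.var 4) (τ.var 5)
  -- A list entry counts once; a vertex counts twice, for leaving the queue and as a possible start.
  have hμ : μ σ = l + 2 * n := by
    have hsum : ∀ k, k ≤ n → ∑ v ∈ Finset.range k, (off (v + 1) - off v + 1) = off k + k := by
      intro k hk
      induction k with
      | zero => simp [hA.off_zero]
      | succ k ih =>
        have := hA.off_le_succ k hk
        rw [Finset.sum_range_succ, ih (by omega)]
        omega
    simp only [μ, searchMeasure, hz 3 (by omega)]
    simp [hsum n le_rfl, hA.off_last, hv]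
    omega
  have hI : I σ := by
    refine ⟨h0, h1, hn, fun a ha _ _ => hz a ha, ?_⟩
    rw [hz 3 (by omega), hz 4 (by omega), hv 1 (by omega), hv 2 (by omega), hv 3 (by omega),
      hv 4 (by omega), hv 5 (by omega)]
    exact SearchInv.initial
  obtain ⟨t, τ, hr, ht, ⟨k0, k1, kn, kz, ks⟩, hb⟩ := exists_run_loop (W := W)
    (b := .lt (.var 5) (.var 0)) (P := searchBody) I μ
    (by
      rintro τ ⟨k0, k1, kn, kz, ks⟩
      have := ks.s_le
      simp only [Cond.Fits, Expr.Fits]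
      omega)
    (by
      rintro τ ⟨k0, k1, kn, kz, ks⟩ hb
      simp only [Cond.Holds, Expr.eval, kn] at hb
      have b1 := ks.s_le
      have b2 := ks.tail_le
      have b3 := ks.head_le
      have b4 := ks.j_le
      have b5 := ks.e_le
      simp only [searchBody, visitProg, wp, Expr.eval, Expr.Fits, Cond.Holds, Cond.Fits]
      refine ⟨by omega, fun hj => ?_, fun hj => ⟨by omega, fun hh => ?_, fun hh => ?_⟩⟩
      · obtain ⟨c1, c2, c3⟩ := ks.scanning hj
        have hord := ks.ord_lt _ c1 b3
        have ht := hA.tgt_lt hord c2 (c3 ▸ hj)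
        have hnt := ks.num_le _ ht
        simp [k1]
        refine ⟨by omega, by omega, by omega, fun hw => ?_, fun hw => ?_⟩
        · have hlt := ks.tail_lt ht hw
          refine ⟨by omega, by omega, by omega, by omega, ⟨by simpa using k0, by simpa using k1,
            by simpa using kn, fun a h2 h3 h4 => by simpa [h3, h4] using kz a h2 h3 h4, ?_⟩, ?_⟩
          · have hu : τ.arr 3 (τ.arr 4 (τ.var 2)) ≠ 0 := by
              rw [ks.num_ord _ c1 b3]
              omega
            have := (ks.visit ht hw hA (.inl ⟨_, hA.adj_tgt hord c2 (c3 ▸ hj), hu⟩)).advance hj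
              (by simp)
            simpa using this
          · simp only [μ]
            simp [ks.measure_visit hw]
            simp only [searchMeasure]
            omega
        · refine ⟨⟨by simpa using k0, by simpa using k1, by simpa using kn, kz, ?_⟩, ?_⟩
          · simpa using ks.advance hj hw
          · simp [μ, searchMeasure]
            omega
      · have hord := ks.ord_lt (τ.var 2 + 1) (by omega) hh
        have o1 := hA.off_le hord.le
        have o2 : off (τ.arr 4 (τ.var 2 + 1) + 1) ≤ l := hA.off_le hord
        simp [k0]
        refine ⟨by omega, by omega, by omega, ⟨by simpa using k0, by simpa using k1, by simpa using kn,
          kz, ?_⟩, ?_⟩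
        · simpa using ks.dequeue hA hj hh
        · simpa [μ] using ks.measure_dequeue hh
      · have hnt := ks.num_le _ hb
        simp
        refine ⟨by omega, fun hw => ?_, fun hw => ?_⟩
        · have hlt := ks.tail_lt hb hw
          refine ⟨by omega, by omega, by omega, by omega, by omega, ⟨by simpa using k0,
            by simpa using k1, by simpa using kn,
            fun a h2 h3 h4 => by simpa [h3, h4] using kz a h2 h3 h4, ?_⟩, ?_⟩
          · have := (ks.visit hb hw hA (.inr (ks.closed hA hj hh))).next_start hb (by simp)
            simpa using this
          · simp only [μ]
            simp [ks.measure_visit hw]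
            simp only [searchMeasure]
            omega
        · refine ⟨by omega, ⟨by simpa using k0, by simpa using k1, by simpa using kn, kz, ?_⟩, ?_⟩
          · simpa using ks.next_start hb hw
          · simp [μ, searchMeasure]
            omega) hI
  refine ⟨t, τ, hr, hμ ▸ ht, k0, k1, kn, kz, τ.var 1, τ.var 2, τ.var 3, τ.var 4, ?_⟩
  simp only [Cond.Holds, Expr.eval, kn] at hb
  have := ks.s_le
  rwa [show τ.var 5 = n by omega] at ks

end WordRAM

/-! ### The last earlier neighbours -/

namespace WordRAM

/-- The positions before `j` in the list of `u` that hold vertices numbered before `u`. -/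
def earlierPos (off tgt num : ℕ → ℕ) (u j : ℕ) : Finset ℕ :=
  (Finset.range j).filter fun i => off u ≤ i ∧ i < off (u + 1) ∧ num (tgt i) < num u

/-- After the first `j` list entries, which are those before `v` and some of `v`, have been read,
`par` holds the largest number of an earlier neighbour and `cnt` the number of these neighbours. -/
structure ParentInv (n l : ℕ) (off tgt num par cnt : ℕ → ℕ) (v j : ℕ) : Prop where
  v_le : v ≤ n
  off_le : off v ≤ j
  j_le : j ≤ l
  le_off : v < n → j ≤ off (v + 1)
  cnt_eq : ∀ u, u < n → cnt (num u) = (earlierPos off tgt num u j).card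
  le_par : ∀ u, u < n → ∀ i ∈ earlierPos off tgt num u j, num (tgt i) ≤ par (num u)
  par_eq : ∀ u, u < n → par (num u) = 0 ∨
    ∃ i ∈ earlierPos off tgt num u j, par (num u) = num (tgt i)

variable {n l : ℕ} {A : ℕ → ℕ → Prop} {off tgt num par cnt : ℕ → ℕ} {v j : ℕ}

theorem earlierPos_succ (u j : ℕ) : earlierPos off tgt num u (j + 1) =
    if off u ≤ j ∧ j < off (u + 1) ∧ num (tgt j) < num u then insert j (earlierPos off tgt num u j)
    else earlierPos off tgt num u j := by
  rw [earlierPos, Finset.range_add_one, Finset.filter_insert]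
  rfl

theorem IsAdjacencyArray.eq_of_mem (hA : IsAdjacencyArray n l A off tgt) {u v j : ℕ} (hu : u < n)
    (hv : v < n) (h1 : off u ≤ j) (h2 : j < off (u + 1)) (h3 : off v ≤ j) (h4 : j < off (v + 1)) :
    u = v := by
  rcases lt_trichotomy u v with h | h | h
  · have := hA.off_mono (show u + 1 ≤ v from h) hv.le
    omega
  · exact h
  · have := hA.off_mono (show v + 1 ≤ u from h) hu.le
    omega

namespace ParentInv

theorem next_vertex (h : ParentInv n l off tgt num par cnt v j) (hA : IsAdjacencyArray n l A off tgt)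
    (hv : v < n) (hj : ¬ j < off (v + 1)) : ParentInv n l off tgt num par cnt (v + 1) j := by
  refine { h with v_le := hv, off_le := by omega, le_off := fun hv' => ?_ }
  have h1 := h.le_off hv
  have h2 := hA.off_le_succ _ hv'
  omega

theorem skip (h : ParentInv n l off tgt num par cnt v j) (hA : IsAdjacencyArray n l A off tgt)
    (hv : v < n) (hj : j < off (v + 1)) (hlt : ¬ num (tgt j) < num v) :
    ParentInv n l off tgt num par cnt v (j + 1) := by
  have key : ∀ u, u < n → earlierPos off tgt num u (j + 1) = earlierPos off tgt num u j := by
    intro u hu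
    rw [earlierPos_succ, if_neg]
    rintro ⟨h1, h2, h3⟩
    obtain rfl := hA.eq_of_mem hu hv h1 h2 h.off_le hj
    exact hlt h3
  have hl : off (v + 1) ≤ l := hA.off_le hv
  refine ⟨h.v_le, by have := h.off_le; omega, by omega, fun _ => hj, ?_, ?_, ?_⟩
  · intro u hu; rw [key u hu]; exact h.cnt_eq u hu
  · intro u hu; rw [key u hu]; exact h.le_par u hu
  · intro u hu; rw [key u hu]; exact h.par_eq u hu

/-- Position `j` lies in the list of `v` only, and numbers are distinct, so the entries of other
vertices stay correct. -/
theorem count (h : ParentInv n l off tgt num par cnt v j) (hA : IsAdjacencyArray n l A off tgt)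
    (hnum : ∀ u v, u < n → v < n → num u = num v → u = v) (hv : v < n) (hj : j < off (v + 1))
    (hlt : num (tgt j) < num v) :
    ParentInv n l off tgt num
      (if par (num v) < num (tgt j) then Function.update par (num v) (num (tgt j)) else par)
      (Function.update cnt (num v) (cnt (num v) + 1)) v (j + 1) := by
  have key : ∀ u, u < n → u ≠ v → earlierPos off tgt num u (j + 1) = earlierPos off tgt num u j := by
    intro u hu huv
    rw [earlierPos_succ, if_neg]
    rintro ⟨h1, h2, h3⟩
    exact huv (hA.eq_of_mem hu hv h1 h2 h.off_le hj)
  have keyv : earlierPos off tgt num v (j + 1) = insert j (earlierPos off tgt num v j) := by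
    rw [earlierPos_succ, if_pos ⟨h.off_le, hj, hlt⟩]
  have hnot : j ∉ earlierPos off tgt num v j := by simp [earlierPos]
  have hne : ∀ u, u < n → u ≠ v → num u ≠ num v := fun u hu huv e => huv (hnum u v hu hv e)
  have hpar : ∀ u, u < n → u ≠ v →
      (if par (num v) < num (tgt j) then Function.update par (num v) (num (tgt j)) else par)
        (num u) = par (num u) := by
    intro u hu huv
    split
    · rw [Function.update_of_ne (hne u hu huv)]
    · rfl
  have hparv : (if par (num v) < num (tgt j) then Function.update par (num v) (num (tgt j)) else par)
      (num v) = max (par (num v)) (num (tgt j)) := by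
    split
    · rw [Function.update_self]; omega
    · omega
  have hl : off (v + 1) ≤ l := hA.off_le hv
  refine ⟨h.v_le, by have := h.off_le; omega, by omega, fun _ => hj, ?_, ?_, ?_⟩
  · intro u hu
    by_cases huv : u = v
    · subst huv
      rw [Function.update_self, keyv, Finset.card_insert_of_notMem hnot, h.cnt_eq u hu]
    · rw [Function.update_of_ne (hne u hu huv), key u hu huv]
      exact h.cnt_eq u hu
  · intro u hu i hi
    by_cases huv : u = v
    · subst huv
      rw [hparv]
      rw [keyv, Finset.mem_insert] at hi
      rcases hi with rfl | hi
      · exact le_max_right _ _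
      · exact (h.le_par u hu i hi).trans (le_max_left _ _)
    · rw [hpar u hu huv]
      rw [key u hu huv] at hi
      exact h.le_par u hu i hi
  · intro u hu
    by_cases huv : u = v
    · subst huv
      rw [hparv, keyv]
      rcases le_total (par (num u)) (num (tgt j)) with hle | hle
      · exact .inr ⟨j, Finset.mem_insert_self _ _, max_eq_right hle⟩
      · rw [max_eq_left hle]
        rcases h.par_eq u hu with h0 | ⟨i, hi, h1⟩
        · exact .inl h0
        · exact .inr ⟨i, Finset.mem_insert_of_mem hi, h1⟩
    · rw [hpar u hu huv, key u hu huv]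
      exact h.par_eq u hu

end ParentInv

/-! The variables `7` and `8` hold `v` and `j`, and the arrays `5` and `6` hold `par` and `cnt`. -/

/-- The lists are contiguous, so one pointer runs through all of them, and `v` advances when the
pointer reaches the end of its list. -/
def parentBody : Prog :=
  .ite (.lt (.var 8) (.read 0 (.add (.var 7) (.const 1))))
    (.seq (.assign 9 (.read 3 (.read 1 (.var 8)))) (.seq (.assign 10 (.read 3 (.var 7)))
      (.seq (.ite (.lt (.var 9) (.var 10))
        (.seq (.write 6 (.var 10) (.add (.read 6 (.var 10)) (.const 1)))
          (.ite (.lt (.read 5 (.var 10)) (.var 9)) (.write 5 (.var 10) (.var 9)) .skip)) .skip)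
        (.assign 8 (.add (.var 8) (.const 1))))))
    (.assign 7 (.add (.var 7) (.const 1)))

def parentInit : Prog := .seq (.assign 7 (.const 0)) (.assign 8 (.const 0))

def parentLoop : Prog := .loop (.lt (.var 7) (.var 0)) parentBody

theorem parentLoop_run (hA : IsAdjacencyArray n l A off tgt)
    (hnum : ∀ u v, u < n → v < n → num u = num v → u = v) (hle : ∀ u, u < n → num u ≤ n) {W : ℕ}
    (hW : 2 * n + l + 2 < W) {σ : Store} (h0 : σ.arr 0 = off) (h1 : σ.arr 1 = tgt)
    (h3 : σ.arr 3 = num) (h5 : σ.arr 5 = fun _ => 0) (h6 : σ.arr 6 = fun _ => 0)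
    (hn : σ.var 0 = n) (h7 : σ.var 7 = 0) (h8 : σ.var 8 = 0) :
    ∃ t τ, Run W parentLoop σ t τ ∧
      t ≤ ((Cond.lt (.var 7) (.var 0)).cost + 1 + parentBody.cost) * (l + n + 1) ∧
      τ.var 0 = n ∧ (∀ a, a ≠ 5 → a ≠ 6 → τ.arr a = σ.arr a) ∧
      ParentInv n l off tgt num (τ.arr 5) (τ.arr 6) n l := by
  let I : Store → Prop := fun τ => τ.var 0 = n ∧ (∀ a, a ≠ 5 → a ≠ 6 → τ.arr a = σ.arr a) ∧
    ParentInv n l off tgt num (τ.arr 5) (τ.arr 6) (τ.var 7) (τ.var 8)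
  let μ : Store → ℕ := fun τ => (l - τ.var 8) + (n - τ.var 7)
  have hI : I σ := by
    refine ⟨hn, fun _ _ _ => rfl, ?_⟩
    rw [h5, h6, h7, h8]
    refine ⟨by omega, hA.off_zero.le, by omega, by omega, ?_, ?_, ?_⟩ <;> simp [earlierPos]
  obtain ⟨t, τ, hr, ht, ⟨kn, kf, kp⟩, hb⟩ := exists_run_loop (W := W)
    (b := .lt (.var 7) (.var 0)) (P := parentBody) I μ
    (by
      rintro τ ⟨kn, kf, kp⟩
      have := kp.v_le
      simp only [Cond.Fits, Expr.Fits]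
      omega)
    (by
      rintro τ ⟨kn, kf, kp⟩ hb
      simp only [Cond.Holds, Expr.eval, kn] at hb
      have k0 : τ.arr 0 = off := (kf 0 (by omega) (by omega)).trans h0
      have k1 : τ.arr 1 = tgt := (kf 1 (by omega) (by omega)).trans h1
      have k3 : τ.arr 3 = num := (kf 3 (by omega) (by omega)).trans h3
      have b2 := kp.off_le
      have b3 := kp.j_le
      have b4 := kp.le_off hb
      have b5 : off (τ.var 7 + 1) ≤ l := hA.off_le hb
      have b6 := hle _ hb
      simp only [parentBody, wp, Expr.eval, Expr.Fits, Cond.Holds, Cond.Fits]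
      refine ⟨by rw [k0]; omega, fun hj => ?_, fun hj => ⟨by omega, ?_, ?_⟩⟩
      · rw [k0] at hj
        have ht := hA.tgt_lt hb b2 hj
        have b7 := hle _ ht
        have b8 : τ.arr 6 (num (τ.var 7)) ≤ l := by
          rw [kp.cnt_eq _ hb]
          refine (Finset.card_filter_le _ _).trans ?_
          simpa using b3
        have b9 : τ.arr 5 (num (τ.var 7)) ≤ n := by
          rcases kp.par_eq _ hb with e | ⟨i, hi, e⟩
          · omega
          · rw [e]
            simp only [earlierPos, Finset.mem_filter] at hi
            exact hle _ (hA.tgt_lt hb hi.2.1 hi.2.2.1)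
        simp [k1, k3]
        refine ⟨by omega, by omega, by omega, fun hlt => ⟨by omega, by omega, by omega, fun hp => ?_,
          fun hp => ?_⟩, fun hlt => ⟨by omega, ?_, ?_⟩⟩
        · refine ⟨by omega, by omega, by omega, ⟨by simpa using kn,
            fun a h5 h6 => by simpa [h5, h6] using kf a h5 h6, ?_⟩, ?_⟩
          · simpa [hp] using kp.count hA hnum hb hj hlt
          · simp [μ]; omega
        · refine ⟨by omega, ⟨by simpa using kn,
            fun a h5 h6 => by simpa [h5, h6] using kf a h5 h6, ?_⟩, ?_⟩
          · simpa [not_lt.2 hp] using kp.count hA hnum hb hj hlt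
          · simp [μ]; omega
        · refine ⟨by simpa using kn, kf, ?_⟩
          simpa using kp.skip hA hb hj (by omega)
        · simp [μ]; omega
      · rw [k0] at hj
        refine ⟨by simpa using kn, kf, ?_⟩
        simpa using kp.next_vertex hA hb hj
      · simp [μ]; omega) hI
  refine ⟨t, τ, hr, ?_, kn, kf, ?_⟩
  · simpa [μ, h7, h8] using ht
  simp only [Cond.Holds, Expr.eval, kn] at hb
  have e := kp.v_le
  have e1 : τ.var 7 = n := by omega
  rw [e1] at kp
  have e2 := kp.off_le
  have e3 := kp.j_le
  rw [hA.off_last] at e2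
  rwa [show τ.var 8 = l by omega] at kp

end WordRAM

/-! ### The dynamic program on the word RAM

The table entry for node `p` and state `q` is in cell `N * p + q` of array `8`, and the back pointers
are in the same cells of the arrays `9` and `10`. Array `11` holds the new entries of a node while
they are computed. The variables `11` and `12` hold a node and its parent. -/

namespace WordRAM

open LiarVE

variable {N : ℕ}

theorem cell_inj {p p' : ℕ} {q q' : Fin N} : N * p + q.val = N * p' + q'.val ↔ p = p' ∧ q = q' := by
  constructor
  · intro h
    have hN : 0 < N := q.pos
    have h1 := congrArg (· / N) h
    have h2 := congrArg (· % N) h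
    simp only [Nat.mul_add_div hN, Nat.mul_add_mod, Nat.div_eq_of_lt q.2, Nat.div_eq_of_lt q'.2,
      Nat.mod_eq_of_lt q.2, Nat.mod_eq_of_lt q'.2, add_zero] at h1 h2
    exact ⟨h1, Fin.ext h2⟩
  · rintro ⟨rfl, rfl⟩; rfl

theorem cell_lt {n p : ℕ} (hp : p ≤ n) (q : Fin N) : N * p + q.val < N * (n + 1) := by
  have := Nat.mul_le_mul_left N hp
  have := q.2
  rw [mul_add_one]
  omega

/-- The cell of the node with number `e` and the state with number `f`. -/
def cellExpr (N : ℕ) (e f : Expr) : Expr := .add (e.mulConst N) f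

@[simp] theorem eval_cellExpr (e f : Expr) (σ : Store) :
    (cellExpr N e f).eval σ = N * e.eval σ + f.eval σ := by
  simp [cellExpr, Expr.eval]

theorem fits_cellExpr {e f : Expr} {σ : Store} {W : ℕ} (he : e.Fits W σ) (hf : f.Fits W σ)
    (h : N * e.eval σ + f.eval σ < W) : (cellExpr N e f).Fits W σ :=
  ⟨Expr.fits_mulConst he (by omega), hf, by simpa using h⟩

/-- The table that is stored in an array. -/
def tableOf (N : ℕ) (f : ℕ → ℕ) (p : ℕ) (q : Fin N) : ℕ := f (N * p + q.val)

theorem tableOf_update (f : ℕ → ℕ) (p p' : ℕ) (q q' : Fin N) (k : ℕ) :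
    tableOf N (Function.update f (N * p + q.val) k) p' q' =
      if p' = p ∧ q' = q then k else tableOf N f p' q' := by
  simp only [tableOf, Function.update_apply, cell_inj]

variable (M : Automaton N)

def tableInitStart : Prog :=
  .seq (.write 8 (.const M.empty) (.add (.var 0) (.const 1))) (.assign 11 (.const 1))

def tableInitBody : Prog :=
  .seq (.write 8 (cellExpr N (.var 11) (.const (M.init true))) (.var 0))
    (.seq (.write 8 (cellExpr N (.var 11) (.const (M.init false))) (.add (.var 0) (.const 1)))
      (.assign 11 (.add (.var 11) (.const 1))))

def nodeCond : Cond := .lt (.var 11) (.add (.var 0) (.const 1))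

def tableInitLoop : Prog := .loop nodeCond (tableInitBody M)

theorem tableInitLoop_run (hM : M.init true ≠ M.init false) {n W : ℕ}
    (hW : N * (n + 1) + 2 * n + 5 < W) {σ : Store} (h8 : ∀ p q, tableOf N (σ.arr 8) p q =
      if p = 0 then initGain M n p q else 0) (hn : σ.var 0 = n) (h11 : σ.var 11 = 1) :
    ∃ t τ, Run W (tableInitLoop M) σ t τ ∧
      t ≤ (nodeCond.cost + 1 + (tableInitBody M).cost) * (n + 1) ∧
      τ.var 0 = n ∧ (∀ a, a ≠ 8 → τ.arr a = σ.arr a) ∧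
      ∀ p q, p ≤ n → tableOf N (τ.arr 8) p q = initGain M n p q := by
  let I : Store → Prop := fun τ => τ.var 0 = n ∧ (∀ a, a ≠ 8 → τ.arr a = σ.arr a) ∧ 1 ≤ τ.var 11 ∧
    τ.var 11 ≤ n + 1 ∧
    ∀ p q, tableOf N (τ.arr 8) p q = if p < τ.var 11 then initGain M n p q else 0
  let μ : Store → ℕ := fun τ => n + 1 - τ.var 11
  have hI : I σ := by
    refine ⟨hn, fun _ _ => rfl, by omega, by omega, fun p q => ?_⟩
    rw [h8, h11]
    simp only [Nat.lt_one_iff]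
  obtain ⟨t, τ, hr, ht, ⟨kn, kf, k1, k2, k8⟩, hb⟩ := exists_run_loop (W := W)
    (b := nodeCond) (P := tableInitBody M) I μ
    (by
      rintro τ ⟨kn, kf, k1, k2, k8⟩
      simp only [nodeCond, Cond.Fits, Expr.Fits, Expr.eval]
      omega)
    (by
      rintro τ ⟨kn, kf, k1, k2, k8⟩ hb
      simp only [nodeCond, Cond.Holds, Expr.eval, kn] at hb
      have c1 := cell_lt (show τ.var 11 ≤ n by omega) (M.init true)
      have c2 := cell_lt (show τ.var 11 ≤ n by omega) (M.init false)
      have q1 : (M.init true).val < W := by omega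
      have q2 : (M.init false).val < W := by omega
      simp only [tableInitBody, wp]
      refine ⟨fits_cellExpr (by simp only [Expr.Fits]; omega) q1 (by simp only [Expr.eval]; omega),
        by simp only [Expr.Fits]; omega, fits_cellExpr (by simp [Expr.Fits]; omega) q2
        (by simp [Expr.eval]; omega), by simp [Expr.Fits, Expr.eval]; omega,
        by simp [Expr.Fits, Expr.eval]; omega, ⟨by simpa using kn, ?_, ?_, ?_, ?_⟩, ?_⟩
      · intro a ha
        simpa [ha] using kf a ha
      · simp [Expr.eval]
      · simp [Expr.eval]; omega
      · intro p q
        simp only [eval_cellExpr, Expr.eval, Store.setVar_arr, Store.setArr_arr, Store.setArr_var,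
          Store.setVar_var, if_true, tableOf_update, k8, kn, initGain]
        by_cases hp : p = τ.var 11
        · subst hp
          by_cases hq : q = M.init false
          · subst hq
            simp [hM.symm, show τ.var 11 ≠ 0 by omega]
          · by_cases hq' : q = M.init true
            · subst hq'
              simp [hM, show τ.var 11 ≠ 0 by omega]
            · simp [hq, hq', show τ.var 11 ≠ 0 by omega]
        · simp only [hp, false_and, if_false]
          split_ifs <;> first | rfl | omega
      · simp [μ, Expr.eval]; omega) hI
  refine ⟨t, τ, hr, ht.trans (Nat.mul_le_mul_left _ (by simp only [μ]; omega)), kn, kf, fun p q hp => ?_⟩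
  simp only [nodeCond, Cond.Holds, Expr.eval, kn] at hb
  rw [k8, if_pos (by omega)]

/-! #### Merging a node into its parent -/

def clearProg (N : ℕ) : Prog :=
  seqs ((List.finRange N).map fun q : Fin N => .write 11 (.const q) (.const 0))

/-- The new row is built in array 11, because later pairs still read the old row of the parent. Only
strict improvements are stored, so back pointers mean nothing where the gain stays 0. -/
def combineStep (b : Bool) (x : Fin N × Fin N) : Prog :=
  .seq (.assign 13 (.sub (.add (.read 8 (cellExpr N (.var 12) (.const x.1)))
      (.read 8 (cellExpr N (.var 11) (.const x.2)))) (.add (.var 0) (.const 1))))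
    (.ite (.lt (.read 11 (.const (M.comb b x.1 x.2))) (.var 13))
      (.seq (.write 11 (.const (M.comb b x.1 x.2)) (.var 13))
        (.seq (.write 9 (cellExpr N (.var 11) (.const (M.comb b x.1 x.2))) (.const x.1))
          (.write 10 (cellExpr N (.var 11) (.const (M.comb b x.1 x.2))) (.const x.2)))) .skip)

def combineProg (b : Bool) : Prog :=
  seqs (((List.finRange N).product (List.finRange N)).map (combineStep M b))

def copyProg (N : ℕ) : Prog :=
  seqs ((List.finRange N).map fun q : Fin N =>
    .write 8 (cellExpr N (.var 12) (.const q)) (.read 11 (.const q)))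

def mergeProg (b : Bool) : Prog := .seq (clearProg N) (.seq (combineProg M b) (copyProg N))

/-- The invariant while the new table entries for node `p` are computed from the pairs `l` of states
of `p` and `i`. -/
structure CombineInv (n : ℕ) (b : Bool) (i p : ℕ) (σ : Store) (l : List (Fin N × Fin N)) (τ : Store) :
    Prop where
  var_zero : τ.var 0 = n
  node : τ.var 11 = i
  parent : τ.var 12 = p
  frame : ∀ a, a ≠ 9 → a ≠ 10 → a ≠ 11 → τ.arr a = σ.arr a
  frame₁ : ∀ j q, j ≠ i → tableOf N (τ.arr 9) j q = tableOf N (σ.arr 9) j q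
  frame₂ : ∀ j q, j ≠ i → tableOf N (τ.arr 10) j q = tableOf N (σ.arr 10) j q
  lt₁ : ∀ j q, tableOf N (τ.arr 9) j q < N
  lt₂ : ∀ j q, tableOf N (τ.arr 10) j q < N
  le : ∀ q : Fin N, τ.arr 11 q ≤ n + 1
  max : ∀ x ∈ l, tableOf N (σ.arr 8) p x.1 + tableOf N (σ.arr 8) i x.2 - (n + 1) ≤
    τ.arr 11 (M.comb b x.1 x.2)
  attained : ∀ q : Fin N, 0 < τ.arr 11 q → ∃ q₁ q₂ : Fin N, M.comb b q₁ q₂ = q ∧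
    tableOf N (τ.arr 9) i q = q₁.val ∧ tableOf N (τ.arr 10) i q = q₂.val ∧
    τ.arr 11 q = tableOf N (σ.arr 8) p q₁ + tableOf N (σ.arr 8) i q₂ - (n + 1)

variable {M}

theorem combineStep_wp {n W : ℕ} (hW : N * (n + 1) + 2 * n + 5 < W) {b : Bool} {i p : ℕ}
    (hi : i ≤ n) (hp : p ≤ n) {σ : Store}
    (hle : ∀ j q, j ≤ n → tableOf N (σ.arr 8) j q ≤ n + 1) (l : List (Fin N × Fin N))
    (x : Fin N × Fin N) (τ : Store) (h : CombineInv M n b i p σ l τ) :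
    wp W (combineStep M b x) (CombineInv M n b i p σ (l ++ [x])) τ := by
  obtain ⟨q₁, q₂⟩ := x
  have c1 := cell_lt hp q₁
  have c2 := cell_lt hi q₂
  have c3 := cell_lt hi (M.comb b q₁ q₂)
  have l1 := hle p q₁ hp
  have l2 := hle i q₂ hi
  have l3 := h.le (M.comb b q₁ q₂)
  have k8 : τ.arr 8 = σ.arr 8 := h.frame 8 (by omega) (by omega) (by omega)
  have hn := h.var_zero
  have hi' := h.node
  have hp' := h.parent
  have w3 : (M.comb b q₁ q₂).val < W := by omega
  simp only [tableOf] at l1 l2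
  simp only [combineStep, wp, Expr.Fits, Cond.Fits, Cond.Holds]
  refine ⟨⟨⟨⟨fits_cellExpr (by simp only [Expr.Fits]; omega) (by simp only [Expr.Fits]; omega)
      (by simp only [Expr.eval, hp']; omega), by simp only [eval_cellExpr, Expr.eval, k8, hp']; omega⟩,
      ⟨fits_cellExpr (by simp only [Expr.Fits]; omega) (by simp only [Expr.Fits]; omega)
      (by simp only [Expr.eval, hi']; omega), by simp only [eval_cellExpr, Expr.eval, k8, hi']; omega⟩,
      by simp only [eval_cellExpr, Expr.eval, k8, hi', hp']; omega⟩,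
      by simp only [Expr.eval]; omega⟩, ?_⟩
  simp only [eval_cellExpr, Expr.eval, k8, hi', hp', hn, Store.setVar_arr, Store.setVar_var, if_true,
    Store.setArr_var]
  refine ⟨⟨⟨w3, by omega⟩, by omega⟩, fun hlt => ?_, fun hlt => ?_⟩
  · refine ⟨w3, by omega, fits_cellExpr (by simp [Expr.Fits]; omega) w3
      (by simp [Expr.eval, hi']; omega), by omega, fits_cellExpr (by simp [Expr.Fits]; omega) w3
      (by simp [Expr.eval, hi']; omega), by omega,
      ?_⟩
    constructor
    · simpa using hn
    · simpa using hi'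
    · simpa using hp'
    · intro a h9 h10 h11
      simpa [h9, h10, h11] using h.frame a h9 h10 h11
    · intro j q hj
      simpa [hi', tableOf_update, hj] using h.frame₁ j q hj
    · intro j q hj
      simpa [hi', tableOf_update, hj] using h.frame₂ j q hj
    · intro j q
      have := h.lt₁ j q
      simp [tableOf_update]
      split <;> omega
    · intro j q
      have := h.lt₂ j q
      simp [tableOf_update]
      split <;> omega
    · intro q
      have := h.le q
      simp [Function.update_apply]
      split <;> omega
    · intro x hx
      rw [List.mem_append, List.mem_singleton] at hx
      rcases hx with hx | rfl
      · have := h.max x hx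
        by_cases e : M.comb b x.1 x.2 = M.comb b q₁ q₂
        · simp [e] at this ⊢
          omega
        · have e' : (M.comb b x.1 x.2).val ≠ (M.comb b q₁ q₂).val := fun e' => e (Fin.ext e')
          simpa [Function.update_of_ne e'] using this
      · simp [tableOf]
    · intro q
      by_cases e : q = M.comb b q₁ q₂
      · intro _
        refine ⟨q₁, q₂, e.symm, ?_, ?_, ?_⟩ <;> simp [tableOf_update, e]
        simp [tableOf]
      · have e' : q.val ≠ (M.comb b q₁ q₂).val := fun e' => e (Fin.ext e')
        have := h.attained q
        simpa [hi', tableOf_update, e, Function.update_of_ne e'] using this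
  · constructor
    · simpa using hn
    · simpa using hi'
    · simpa using hp'
    · exact h.frame
    · exact h.frame₁
    · exact h.frame₂
    · exact h.lt₁
    · exact h.lt₂
    · exact h.le
    · intro x hx
      rw [List.mem_append, List.mem_singleton] at hx
      rcases hx with hx | rfl
      · exact h.max x hx
      · simpa [tableOf] using hlt
    · exact h.attained

/-- What merging node `i` into node `p` does. -/
structure MergePost (M : Automaton N) (n : ℕ) (b : Bool) (i p : ℕ) (σ τ : Store) : Prop where
  var_zero : τ.var 0 = n
  node : τ.var 11 = i
  frame : ∀ a, a ≠ 8 → a ≠ 9 → a ≠ 10 → a ≠ 11 → τ.arr a = σ.arr a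
  frame₁ : ∀ j q, j ≠ i → tableOf N (τ.arr 9) j q = tableOf N (σ.arr 9) j q
  frame₂ : ∀ j q, j ≠ i → tableOf N (τ.arr 10) j q = tableOf N (σ.arr 10) j q
  lt₁ : ∀ j q, tableOf N (τ.arr 9) j q < N
  lt₂ : ∀ j q, tableOf N (τ.arr 10) j q < N
  gain : ∀ j q, j ≠ p → tableOf N (τ.arr 8) j q = tableOf N (σ.arr 8) j q
  max : ∀ q₁ q₂, tableOf N (σ.arr 8) p q₁ + tableOf N (σ.arr 8) i q₂ - (n + 1) ≤
    tableOf N (τ.arr 8) p (M.comb b q₁ q₂)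
  attained : ∀ q, 0 < tableOf N (τ.arr 8) p q → ∃ q₁ q₂ : Fin N, M.comb b q₁ q₂ = q ∧
    tableOf N (τ.arr 9) i q = q₁.val ∧ tableOf N (τ.arr 10) i q = q₂.val ∧
    tableOf N (τ.arr 8) p q = tableOf N (σ.arr 8) p q₁ + tableOf N (σ.arr 8) i q₂ - (n + 1)

theorem mergeProg_wp {n W : ℕ} (hW : N * (n + 1) + 2 * n + 5 < W) (b : Bool) {i p : ℕ}
    (hi : i ≤ n) (hp : p ≤ n) {σ : Store} (hn : σ.var 0 = n) (h11 : σ.var 11 = i)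
    (h12 : σ.var 12 = p) (hle : ∀ j q, j ≤ n → tableOf N (σ.arr 8) j q ≤ n + 1)
    (hlt₁ : ∀ j q, tableOf N (σ.arr 9) j q < N) (hlt₂ : ∀ j q, tableOf N (σ.arr 10) j q < N) :
    wp W (mergeProg M b) (MergePost M n b i p σ) σ := by
  have hq : ∀ q : Fin N, q.val < W := fun q => by have := cell_lt (Nat.zero_le n) q; omega
  simp only [mergeProg, wp, clearProg, combineProg, copyProg]
  have hclear := wp_seqs (W := W) (fun (l : List (Fin N)) τ => τ.var = σ.var ∧
    (∀ a, a ≠ 11 → τ.arr a = σ.arr a) ∧ ∀ q ∈ l, τ.arr 11 q.val = 0)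
    (fun q => .write 11 (.const q) (.const 0)) (List.finRange N) [] (by
      rintro l q - τ ⟨h1, h2, h3⟩
      refine ⟨hq q, by simp only [Expr.Fits]; omega, h1, fun a ha => by simpa [ha] using h2 a ha, ?_⟩
      intro q' hq'
      rw [List.mem_append, List.mem_singleton] at hq'
      simp only [Expr.eval, Store.setArr_arr, if_true, Function.update_apply]
      split
      · rfl
      · rename_i hne
        rcases hq' with hq' | rfl
        · exact h3 q' hq'
        · exact absurd rfl hne) (σ := σ) ⟨rfl, fun _ _ => rfl, by simp⟩
  refine wp_mono hclear ?_
  rintro τ ⟨h1, h2, h3⟩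
  have hcomb := wp_seqs (W := W) (CombineInv M n b i p σ) (combineStep M b)
    ((List.finRange N).product (List.finRange N)) [] (fun l x _ => combineStep_wp hW hi hp hle l x) (σ := τ) (by
      have e : ∀ q : Fin N, τ.arr 11 q.val = 0 := fun q => h3 q (by simp)
      constructor
      · rw [h1, hn]
      · rw [h1, h11]
      · rw [h1, h12]
      · exact fun a _ _ h => h2 a h
      · intro j q _; rw [h2 9 (by omega)]
      · intro j q _; rw [h2 10 (by omega)]
      · rw [h2 9 (by omega)]; exact hlt₁
      · rw [h2 10 (by omega)]; exact hlt₂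
      · simp [e]
      · simp
      · simp [e])
  refine wp_mono hcomb ?_
  intro ρ hρ
  have hcopy := wp_seqs (W := W) (fun (l : List (Fin N)) τ => τ.var = ρ.var ∧
    (∀ a, a ≠ 8 → τ.arr a = ρ.arr a) ∧
    (∀ j q, j ≠ p → tableOf N (τ.arr 8) j q = tableOf N (ρ.arr 8) j q) ∧
    ∀ q ∈ l, tableOf N (τ.arr 8) p q = ρ.arr 11 q.val)
    (fun q => .write 8 (cellExpr N (.var 12) (.const q)) (.read 11 (.const q))) (List.finRange N) [] (by
      rintro l q - τ ⟨h1, h2, h3, h4⟩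
      have hpar : τ.var 12 = p := by rw [h1, hρ.parent]
      have k11 : τ.arr 11 = ρ.arr 11 := h2 11 (by omega)
      have c := cell_lt hp q
      have hl := hρ.le q
      refine ⟨fits_cellExpr (by simp only [Expr.Fits]; omega) (hq q)
        (by simp only [Expr.eval, hpar]; omega), ⟨hq q, by simp only [Expr.eval, k11]; omega⟩, h1,
        fun a ha => by simpa [ha] using h2 a ha, ?_, ?_⟩
      · intro j q' hj
        simpa [Expr.eval, hpar, tableOf_update, hj] using h3 j q' hj
      · intro q' hq'
        rw [List.mem_append, List.mem_singleton] at hq'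
        simp only [Expr.eval, eval_cellExpr, Store.setArr_arr, if_true, hpar, tableOf_update, k11]
        split
        · rename_i hh
          rw [hh.2]
        · rename_i hne
          rcases hq' with hq' | rfl
          · exact h4 q' hq'
          · exact absurd ⟨trivial, rfl⟩ hne) (σ := ρ) ⟨rfl, fun _ _ => rfl, fun _ _ _ => rfl, by simp⟩
  refine wp_mono hcopy ?_
  rintro τ' ⟨g1, g2, g3, g4⟩
  have g4' : ∀ q : Fin N, tableOf N (τ'.arr 8) p q = ρ.arr 11 q.val := fun q => g4 q (by simp)
  constructor
  · rw [g1, hρ.var_zero]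
  · rw [g1, hρ.node]
  · intro a h8 h9 h10 h11
    rw [g2 a h8, hρ.frame a h9 h10 h11]
  · rw [g2 9 (by omega)]; exact hρ.frame₁
  · rw [g2 10 (by omega)]; exact hρ.frame₂
  · rw [g2 9 (by omega)]; exact hρ.lt₁
  · rw [g2 10 (by omega)]; exact hρ.lt₂
  · intro j q hj
    rw [g3 j q hj, hρ.frame 8 (by omega) (by omega) (by omega)]
  · intro q₁ q₂
    rw [g4']
    exact hρ.max (q₁, q₂) (by simp [List.product])
  · intro q hq0
    rw [g4', g2 9 (by omega), g2 10 (by omega)] at *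
    exact hρ.attained q hq0

end WordRAM

/-! ### Filling the table, and reading off an optimal set -/

namespace WordRAM

open LiarVE

variable {N : ℕ} (M : Automaton N)

def tableBody : Prog :=
  .seq (.assign 12 (.read 5 (.var 11)))
    (.seq (.ite (.lt (.const 1) (.read 6 (.var 11))) (mergeProg M true) (mergeProg M false))
      (.assign 11 (.sub (.var 11) (.const 1))))

def tableCond : Cond := .lt (.const 0) (.var 11)

def tableLoop : Prog := .loop tableCond (tableBody M)

/-- The back pointers are bounded by `N` at unattainable states too, so that the arrays can be read
as total functions into `Fin N`. -/
theorem tableLoop_run {n W : ℕ} (hW : N * (n + 1) + 2 * n + 5 < W) {par cnt : ℕ → ℕ}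
    (hpar : ∀ i, 1 ≤ i → i ≤ n → par i < i) (hcnt : ∀ i, 1 ≤ i → i ≤ n → cnt i < W) {σ : Store}
    (hM : M.init true ≠ M.init false) (h5 : σ.arr 5 = par) (h6 : σ.arr 6 = cnt)
    (h8 : ∀ p q, p ≤ n → tableOf N (σ.arr 8) p q = initGain M n p q)
    (h9 : σ.arr 9 = fun _ => 0) (h10 : σ.arr 10 = fun _ => 0) (hn : σ.var 0 = n)
    (h11 : σ.var 11 = n) :
    ∃ t τ, Run W (tableLoop M) σ t τ ∧
      t ≤ (tableCond.cost + 1 + (tableBody M).cost) * (n + 1) ∧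
      τ.var 0 = n ∧ (∀ a, a ≠ 8 → a ≠ 9 → a ≠ 10 → a ≠ 11 → τ.arr a = σ.arr a) ∧
      (∀ j q, tableOf N (τ.arr 9) j q < N) ∧ (∀ j q, tableOf N (τ.arr 10) j q < N) ∧
      IsTable M n par (fun i => decide (1 < cnt i)) 0 (tableOf N (τ.arr 8)) (tableOf N (τ.arr 9))
        (tableOf N (τ.arr 10)) := by
  let I : Store → Prop := fun τ => τ.var 0 = n ∧ τ.var 11 ≤ n ∧
    (∀ a, a ≠ 8 → a ≠ 9 → a ≠ 10 → a ≠ 11 → τ.arr a = σ.arr a) ∧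
    (∀ j q, tableOf N (τ.arr 9) j q < N) ∧ (∀ j q, tableOf N (τ.arr 10) j q < N) ∧
    (∀ j q, j ≤ n → tableOf N (τ.arr 8) j q ≤ n + 1) ∧
    IsTable M n par (fun i => decide (1 < cnt i)) (τ.var 11) (tableOf N (τ.arr 8))
      (tableOf N (τ.arr 9)) (tableOf N (τ.arr 10))
  have hN : 0 < N := M.empty.pos
  have hI : I σ := by
    refine ⟨hn, h11.le, fun _ _ _ _ _ => rfl, ?_, ?_, ?_, ?_⟩
    · simp [h9, tableOf, hN]
    · simp [h10, tableOf, hN]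
    · intro j q hj
      rw [h8 j q hj]
      unfold initGain
      split_ifs <;> omega
    · rw [h11]
      exact isTable_initGain hM h8 _ _
  obtain ⟨t, τ, hr, ht, ⟨kn, k11, kf, k9, k10, k8, kt⟩, hb⟩ := exists_run_loop (W := W)
    (b := tableCond) (P := tableBody M) I (fun τ => τ.var 11)
    (by
      rintro τ ⟨kn, k11, -⟩
      simp only [tableCond, Cond.Fits, Expr.Fits]
      omega)
    (by
      rintro τ ⟨kn, k11, kf, k9, k10, k8, kt⟩ hb
      simp only [tableCond, Cond.Holds, Expr.eval] at hb
      have k5 : τ.arr 5 = par := (kf 5 (by omega) (by omega) (by omega) (by omega)).trans h5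
      have k6 : τ.arr 6 = cnt := (kf 6 (by omega) (by omega) (by omega) (by omega)).trans h6
      have hp := hpar _ hb k11
      have hc := hcnt _ hb k11
      -- One statement for both branches, each of which runs the merger for its own value of the
      -- bit.
      have post : ∀ b : Bool, b = decide (1 < cnt (τ.var 11)) → wp W (mergeProg M b)
          (wp W (.assign 11 (.sub (.var 11) (.const 1))) (fun τ' => I τ' ∧ τ'.var 11 < τ.var 11))
          (τ.setVar 12 (par (τ.var 11))) := by
        intro b hbc
        refine wp_mono (mergeProg_wp hW b k11 (show par (τ.var 11) ≤ n by omega) (by simpa using kn)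
          (by simp) (by simp) k8 k9 k10) ?_
        intro ρ hρ
        have e11 := hρ.node
        have hts := kt.step hb k11 hp (g' := tableOf N (ρ.arr 8)) (β₁' := tableOf N (ρ.arr 9))
          (β₂' := tableOf N (ρ.arr 10))
          (fun j hj q => ⟨hρ.frame₁ j q (by omega), hρ.frame₂ j q (by omega)⟩)
          (fun p q _ hpne => hρ.gain p q hpne) (by rw [← hbc]; exact hρ.max)
          (by rw [← hbc]; exact hρ.attained)
        refine ⟨by simp only [Expr.Fits]; omega, ⟨by simpa using hρ.var_zero, ?_, ?_, hρ.lt₁, hρ.lt₂,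
          ?_, ?_⟩, ?_⟩
        · simp [Expr.eval]; omega
        · intro a a8 a9 a10 a11
          rw [Store.setVar_arr, hρ.frame a a8 a9 a10 a11]
          exact kf a a8 a9 a10 a11
        · intro j q hj
          by_cases e : j = par (τ.var 11)
          · exact hts.le j q (by omega)
          · rw [Store.setVar_arr, hρ.gain j q e]
            exact k8 j q hj
        · simpa [Expr.eval, e11] using hts
        · simp [Expr.eval]; omega
      simp only [tableBody, wp, Expr.Fits, Expr.eval, Cond.Fits, Cond.Holds, k5, k6,
        Store.setVar_arr, Store.setVar_var] at post ⊢
      refine ⟨⟨by omega, by omega⟩, ⟨by omega, ?_⟩, fun hk => ?_, fun hk => ?_⟩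
      · simpa using ⟨by omega, hc⟩
      · exact post true (by simpa using hk)
      · exact post false (by simpa using hk)) hI
  refine ⟨t, τ, hr, ?_, kn, kf, k9, k10, ?_⟩
  · simpa [h11] using ht
  · simp only [tableCond, Cond.Holds, Expr.eval] at hb
    rwa [show τ.var 11 = 0 by omega] at kt

/-! #### The optimal state of the root -/

def pickStep (q : Fin N) : Prog :=
  .ite (.lt (.var 14) (.read 8 (.const q)))
    (.seq (.assign 14 (.read 8 (.const q))) (.write 7 (.const 0) (.const q))) .skip

-- The accepting states are constants of the program: they are selected when the program is written
-- down, and the machine never tests acceptance.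
open Classical in
noncomputable def pickProg : Prog :=
  .seq (.assign 14 (.const 0)) (.seq (seqs (((List.finRange N).filter fun q => M.acc q).map pickStep))
    (.assign 11 (.const 1)))

/-- The zeros in array 7 count as the state with number 0, and only the entry of the root matters.
The second alternative covers the case that no accepting state has positive gain and nothing is
recorded. -/
theorem pickProg_wp {n W : ℕ} (hW : N + n + 5 < W) {σ : Store} (h7 : σ.arr 7 = fun _ => 0)
    (hle : ∀ q, tableOf N (σ.arr 8) 0 q ≤ n + 1) :
    wp W (pickProg M) (fun τ => τ.var 0 = σ.var 0 ∧ τ.var 11 = 1 ∧ (∀ a, a ≠ 7 → τ.arr a = σ.arr a) ∧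
      ∃ c : ℕ → Fin N, (∀ p, τ.arr 7 p = c p) ∧
        ((M.acc (c 0) ∧ ∀ q, M.acc q → tableOf N (σ.arr 8) 0 q ≤ tableOf N (σ.arr 8) 0 (c 0)) ∨
          ∀ q, M.acc q → tableOf N (σ.arr 8) 0 q = 0)) σ := by
  classical
  have hN : 0 < N := M.empty.pos
  have key := wp_seqs (W := W) (fun (l : List (Fin N)) τ => τ.var 0 = σ.var 0 ∧
    τ.var 14 ≤ n + 1 ∧ (∀ a, a ≠ 7 → τ.arr a = σ.arr a) ∧ (∀ q ∈ l, tableOf N (σ.arr 8) 0 q ≤ τ.var 14) ∧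
    ∃ c : ℕ → Fin N, (∀ p, τ.arr 7 p = c p) ∧
      (τ.var 14 = 0 ∨ M.acc (c 0) ∧ τ.var 14 = tableOf N (σ.arr 8) 0 (c 0)))
    pickStep ((List.finRange N).filter fun q => M.acc q) [] (by
      rintro l q hq τ ⟨h0, h14, hf, hmax, c, hc, hatt⟩
      have hacc : M.acc q := by simpa using hq
      have k8 : τ.arr 8 = σ.arr 8 := hf 8 (by omega)
      have hl := hle q
      have hqN := q.2
      simp only [tableOf, mul_zero, zero_add] at hl hmax hatt ⊢
      simp only [pickStep, wp, Expr.Fits, Expr.eval, Cond.Fits, Cond.Holds, k8]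
      refine ⟨⟨by omega, by omega, by omega⟩, fun hlt => ⟨⟨by omega, by omega⟩, by omega, by omega,
        by simpa using h0, by simpa using hl, ?_, ?_, Function.update c 0 q, ?_,
        .inr ⟨by simpa using hacc, by simp⟩⟩,
        fun hlt => ⟨h0, h14, hf, ?_, c, hc, hatt⟩⟩
      · intro a ha
        simpa [ha] using hf a ha
      · intro q' hq'
        rw [List.mem_append, List.mem_singleton] at hq'
        rcases hq' with hq' | rfl
        · have := hmax q' hq'
          simp
          omega
        · simp
      · intro p
        simp only [Store.setArr_arr, Store.setVar_arr, if_true, Function.update_apply, hc]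
        split <;> rfl
      · intro q' hq'
        rw [List.mem_append, List.mem_singleton] at hq'
        rcases hq' with hq' | rfl
        · exact hmax q' hq'
        · omega)
    (σ := σ.setVar 14 0) (by
      refine ⟨by simp, by simp, fun _ _ => rfl, by simp, fun _ => ⟨0, hN⟩, ?_, .inl (by simp)⟩
      simp [h7])
  simp only [pickProg, wp, Expr.Fits, Expr.eval]
  refine ⟨by omega, wp_mono key ?_⟩
  intro τ hτ
  obtain ⟨h0, -, hf, hmax, c, hc, hatt⟩ := hτ
  refine ⟨by omega, by simpa using h0, by simp, hf, c, hc, ?_⟩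
  have hmax' : ∀ q, M.acc q → tableOf N (σ.arr 8) 0 q ≤ τ.var 14 := fun q hq =>
    hmax q (by simpa using hq)
  rcases hatt with h | ⟨h1, h2⟩
  · exact .inr fun q hq => by have := hmax' q hq; omega
  · exact .inl ⟨h1, fun q hq => h2 ▸ (hmax' q hq)⟩

/-! #### Reconstruction and output -/

/-- Mergers are undone in reverse order, from node 1 on. Variable 13 keeps the old state of the
parent, whose cell is overwritten before the second back pointer is read. -/
def splitBody (N : ℕ) : Prog :=
  .seq (.assign 12 (.read 5 (.var 11))) (.seq (.assign 13 (.read 7 (.var 12)))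
    (.seq (.write 7 (.var 12) (.read 9 (cellExpr N (.var 11) (.var 13))))
      (.seq (.write 7 (.var 11) (.read 10 (cellExpr N (.var 11) (.var 13))))
        (.assign 11 (.add (.var 11) (.const 1))))))

def splitLoop (N : ℕ) : Prog := .loop nodeCond (splitBody N)

theorem splitLoop_run {n W : ℕ} (hW : N * (n + 1) + 2 * n + N + 5 < W) {par : ℕ → ℕ}
    (hpar : ∀ i, 1 ≤ i → i ≤ n → par i < i) {b₁ b₂ : ℕ → Fin N → Fin N} {c₀ : ℕ → Fin N} {σ : Store}
    (h5 : σ.arr 5 = par) (h7 : ∀ p, σ.arr 7 p = c₀ p)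
    (h9 : ∀ j q, tableOf N (σ.arr 9) j q = b₁ j q) (h10 : ∀ j q, tableOf N (σ.arr 10) j q = b₂ j q)
    (hn : σ.var 0 = n) (h11 : σ.var 11 = 1) :
    ∃ t τ, Run W (splitLoop N) σ t τ ∧
      t ≤ (nodeCond.cost + 1 + (splitBody N).cost) * (n + 1) ∧
      τ.var 0 = n ∧ (∀ a, a ≠ 7 → τ.arr a = σ.arr a) ∧
      ∀ p, τ.arr 7 p = splitStates par b₁ b₂ n 0 c₀ p := by
  let I : Store → Prop := fun τ => τ.var 0 = n ∧ (∀ a, a ≠ 7 → τ.arr a = σ.arr a) ∧ 1 ≤ τ.var 11 ∧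
    τ.var 11 ≤ n + 1 ∧ ∃ c : ℕ → Fin N, (∀ p, τ.arr 7 p = c p) ∧
      splitStates par b₁ b₂ (n + 1 - τ.var 11) (τ.var 11 - 1) c = splitStates par b₁ b₂ n 0 c₀
  let μ : Store → ℕ := fun τ => n + 1 - τ.var 11
  have hI : I σ := ⟨hn, fun _ _ => rfl, by omega, by omega, c₀, h7, by rw [h11]; rfl⟩
  obtain ⟨t, τ, hr, ht, ⟨kn, kf, k1, k2, c, hc, hs⟩, hb⟩ := exists_run_loop (W := W)
    (b := nodeCond) (P := splitBody N) I μ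
    (by
      rintro τ ⟨kn, kf, k1, k2, -⟩
      simp only [nodeCond, Cond.Fits, Expr.Fits, Expr.eval]
      omega)
    (by
      rintro τ ⟨kn, kf, k1, k2, c, hc, hs⟩ hb
      simp only [nodeCond, Cond.Holds, Expr.eval, kn] at hb
      have k5 : τ.arr 5 = par := (kf 5 (by omega)).trans h5
      have k9 : τ.arr 9 = σ.arr 9 := kf 9 (by omega)
      have k10 : τ.arr 10 = σ.arr 10 := kf 10 (by omega)
      have hp := hpar _ k1 (by omega)
      have hcl := cell_lt (show τ.var 11 ≤ n by omega) (c (par (τ.var 11)))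
      have hb1 := (b₁ (τ.var 11) (c (par (τ.var 11)))).2
      have hb2 := (b₂ (τ.var 11) (c (par (τ.var 11)))).2
      have hcp := (c (par (τ.var 11))).2
      have r1 := h9 (τ.var 11) (c (par (τ.var 11)))
      have r2 := h10 (τ.var 11) (c (par (τ.var 11)))
      simp only [tableOf] at r1 r2
      simp only [splitBody, wp]
      refine ⟨⟨by simp only [Expr.Fits]; omega, by simp only [Expr.eval, k5]; omega⟩,
        ⟨by simp [Expr.Fits, Expr.eval, k5]; omega, by simp [Expr.eval, k5, hc]; omega⟩,
        by simp [Expr.Fits, Expr.eval, k5]; omega,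
        ⟨fits_cellExpr (by simp [Expr.Fits]; omega) (by simp [Expr.Fits, Expr.eval, k5, hc]; omega)
          (by simp [Expr.eval, k5, hc]; omega), by simp [Expr.eval, k5, hc, k9, r1]; omega⟩,
        by simp [Expr.Fits]; omega,
        ⟨fits_cellExpr (by simp [Expr.Fits]; omega) (by simp [Expr.Fits, Expr.eval, k5, hc]; omega)
          (by simp [Expr.eval, k5, hc]; omega), by simp [Expr.eval, k5, hc, k10, r2]; omega⟩,
        by simp [Expr.Fits, Expr.eval]; omega, ⟨by simpa using kn, ?_, ?_, ?_,
        splitState par b₁ b₂ (τ.var 11) c, ?_, ?_⟩, ?_⟩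
      · intro a ha
        simpa [ha] using kf a ha
      · simp [Expr.eval]
      · simp [Expr.eval]; omega
      · intro p
        simp only [splitState, Expr.eval, eval_cellExpr, k5, k9, k10, Store.setVar_arr, Store.setVar_var,
          Store.setArr_arr, Store.setArr_var, if_true, hc, Function.update_apply]
        simp [r1, r2]
        split_ifs <;> simp
      · rw [← hs]
        have e1 : n + 1 - τ.var 11 = (n + 1 - (τ.var 11 + 1)) + 1 := by omega
        have e2 : τ.var 11 - 1 + 1 = τ.var 11 := by omega
        rw [e1, splitStates, e2]
        simp [Expr.eval]
      · simp [μ, Expr.eval]; omega) hI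
  refine ⟨t, τ, hr, ht.trans (Nat.mul_le_mul_left _ (by simp only [μ]; omega)), kn, kf, fun p => ?_⟩
  simp only [nodeCond, Cond.Holds, Expr.eval, kn] at hb
  rw [← hs, hc, show n + 1 - τ.var 11 = 0 by omega, splitStates]

/-- With all mergers undone each node is in an initial state, which tells whether the vertex with
this number is selected. -/
def outputBody : Prog :=
  .seq (.ite (.eq (.read 7 (.var 11)) (.const (M.init true))) (.write 2 (.read 4 (.var 11)) (.const 1))
    .skip) (.assign 11 (.add (.var 11) (.const 1)))

def outputLoop : Prog := .loop nodeCond (outputBody M)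

theorem outputLoop_run {n W : ℕ} (hW : 2 * n + N + 5 < W) {num ord : ℕ → ℕ} {c : ℕ → Fin N}
    (hord : ∀ r, 1 ≤ r → r ≤ n → ord r < n) (hnum : ∀ r, 1 ≤ r → r ≤ n → num (ord r) = r)
    (hpos : ∀ v, v < n → 1 ≤ num v) (hle : ∀ v, v < n → num v ≤ n)
    (hordnum : ∀ v, v < n → ord (num v) = v) {σ : Store}
    (h2 : σ.arr 2 = fun _ => 0) (h4 : σ.arr 4 = ord) (h7 : ∀ p, σ.arr 7 p = c p)
    (hn : σ.var 0 = n) (h11 : σ.var 11 = 1) :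
    ∃ t τ, Run W (outputLoop M) σ t τ ∧
      t ≤ (nodeCond.cost + 1 + (outputBody M).cost) * (n + 1) ∧
      ∀ v, v < n → (τ.arr 2 v = 1 ↔ c (num v) = M.init true) := by
  let I : Store → Prop := fun τ => τ.var 0 = n ∧ (∀ a, a ≠ 2 → τ.arr a = σ.arr a) ∧ 1 ≤ τ.var 11 ∧
    τ.var 11 ≤ n + 1 ∧ ∀ v, v < n → (τ.arr 2 v = 1 ↔ num v < τ.var 11 ∧ c (num v) = M.init true)
  let μ : Store → ℕ := fun τ => n + 1 - τ.var 11
  have hI : I σ := by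
    refine ⟨hn, fun _ _ => rfl, by omega, by omega, fun v hv => ?_⟩
    have := hpos v hv
    rw [h2, h11]
    constructor
    · intro h; cases h
    · intro h; omega
  obtain ⟨t, τ, hr, ht, ⟨kn, kf, k1, k2, k3⟩, hb⟩ := exists_run_loop (W := W)
    (b := nodeCond) (P := outputBody M) I μ
    (by
      rintro τ ⟨kn, kf, k1, k2, -⟩
      simp only [nodeCond, Cond.Fits, Expr.Fits, Expr.eval]
      omega)
    (by
      rintro τ ⟨kn, kf, k1, k2, k3⟩ hb
      simp only [nodeCond, Cond.Holds, Expr.eval, kn] at hb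
      have k4 : τ.arr 4 = ord := (kf 4 (by omega)).trans h4
      have k7 : ∀ p, τ.arr 7 p = c p := fun p => by rw [kf 7 (by omega), h7]
      have o1 := hord _ k1 (by omega)
      have o2 := hnum _ k1 (by omega)
      have hc := (c (τ.var 11)).2
      have hq := (M.init true).2
      simp only [outputBody, wp, Expr.Fits, Expr.eval, Cond.Fits, Cond.Holds, k4, k7]
      refine ⟨⟨⟨by omega, by omega⟩, by omega⟩, fun he => ?_, fun he => ?_⟩
      · refine ⟨⟨by omega, by omega⟩, by omega, by simp; omega, ⟨by simpa using kn, ?_, by simp,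
          by simp; omega, ?_⟩, by simp [μ]; omega⟩
        · intro a ha
          simpa [ha] using kf a ha
        · intro v hv
          simp only [Store.setVar_arr, Store.setArr_arr, Store.setVar_var, Store.setArr_var, if_true,
            Function.update_apply]
          split
          · rename_i hvo
            subst hvo
            rw [o2]
            simp [Fin.ext he]
          · rename_i hvo
            have : num v ≠ τ.var 11 := fun e => hvo (by rw [← e, hordnum v hv])
            rw [k3 v hv]
            have : num v < τ.var 11 ↔ num v < τ.var 11 + 1 := by omega
            rw [this]
      · refine ⟨by omega, ⟨by simpa using kn, kf, by simp, by simp; omega, ?_⟩, by simp [μ]; omega⟩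
        intro v hv
        simp only [Store.setVar_arr, Store.setVar_var, if_true]
        rw [k3 v hv]
        constructor
        · exact fun h => ⟨by omega, h.2⟩
        · rintro ⟨h1, h2⟩
          refine ⟨?_, h2⟩
          have : num v ≠ τ.var 11 := fun e => he (by rw [← e, h2])
          omega) hI
  refine ⟨t, τ, hr, ht.trans (Nat.mul_le_mul_left _ (by simp only [μ]; omega)), fun v hv => ?_⟩
  simp only [nodeCond, Cond.Holds, Expr.eval, kn] at hb
  have := hle v hv
  rw [k3 v hv]
  exact ⟨fun h => h.2, fun h => ⟨by omega, h⟩⟩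

end WordRAM

/-! ### The input, and the vertices in the order of their numbers -/

namespace WordRAM

open LiarVE

/-- Adjacency of numbers, as vertices of a graph on `Fin n`. -/
def natAdj {n : ℕ} (G : SimpleGraph (Fin n)) (u v : ℕ) : Prop :=
  ∃ (hu : u < n) (hv : v < n), G.Adj ⟨u, hu⟩ ⟨v, hv⟩

theorem natAdj_val {n : ℕ} {G : SimpleGraph (Fin n)} {u v : Fin n} : natAdj G u v ↔ G.Adj u v :=
  ⟨fun ⟨_, _, h⟩ => h, fun h => ⟨u.2, v.2, h⟩⟩

variable {n : ℕ} {G : SimpleGraph (Fin n)} {nbrs : Fin n → List (Fin n)}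

theorem inputStore_off_succ (v : Fin n) : (inputStore nbrs).arr 0 (v + 1) =
    (inputStore nbrs).arr 0 v + (nbrs v).length := by
  have h1 : v.val + 1 ≤ n := v.2
  have h2 : v.val ≤ n := v.2.le
  simp only [inputStore, if_true, if_pos h1, if_pos h2]
  rw [List.take_add_one]
  simp

theorem inputStore_tgt (v : Fin n) (k : ℕ) (hk : k < (nbrs v).length) :
    (inputStore nbrs).arr 1 ((inputStore nbrs).arr 0 v + k) = ((nbrs v)[k]).val := by
  have h2 : v.val ≤ n := v.2.le
  have hsplit : (List.finRange n).flatMap nbrs = ((List.finRange n).take v).flatMap nbrs ++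
      (nbrs v ++ ((List.finRange n).drop (v + 1)).flatMap nbrs) := by
    conv_lhs => rw [← List.take_append_drop v (List.finRange n)]
    rw [List.flatMap_append, List.drop_eq_getElem_cons (by simp)]
    simp
  simp only [inputStore, if_true, if_pos h2, one_ne_zero, if_false]
  rw [hsplit, List.map_append, List.getD_append_right _ _ _ _ (by simp)]
  simp only [List.length_map, Nat.add_sub_cancel_left, List.map_append]
  rw [List.getD_append _ _ _ _ (by simpa using hk), List.getD_eq_getElem _ _ (by simpa using hk)]
  simp

theorem length_nbrs [DecidableRel G.Adj] (h : IsAdjacencyLists G nbrs) (v : Fin n) :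
    (nbrs v).length = G.degree v := by
  classical
  rw [← SimpleGraph.card_neighborFinset_eq_degree, ← List.toFinset_card_of_nodup (h v).1]
  congr 1
  ext u
  simp [(h v).2]

theorem inputStore_isAdjacencyArray (h : IsAdjacencyLists G nbrs) :
    IsAdjacencyArray n (2 * G.edgeSet.ncard) (natAdj G) ((inputStore nbrs).arr 0)
      ((inputStore nbrs).arr 1) := by
  classical
  refine ⟨?_, fun u v h => h.1, ?_, ?_, ?_, ?_, ?_⟩
  · rintro u v ⟨hu, hv, hA⟩
    exact ⟨hv, hu, hA.symm⟩
  · intro v hv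
    have := inputStore_off_succ (nbrs := nbrs) ⟨v, hv⟩
    simp only at this
    omega
  · simp [inputStore]
  -- Offsets are partial sums of degrees, so the last one is twice the number of edges.
  · have hsum : ∀ k (hk : k ≤ n), (inputStore nbrs).arr 0 k =
        ∑ v ∈ Finset.univ.filter (fun v : Fin n => v.val < k), G.degree v := by
      intro k hk
      induction k with
      | zero => simp [inputStore]
      | succ k ih =>
        have := inputStore_off_succ (nbrs := nbrs) ⟨k, hk⟩
        simp only at this
        rw [this, ih (by omega), length_nbrs h]
        have hins : Finset.univ.filter (fun v : Fin n => v.val < k + 1) =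
            insert ⟨k, hk⟩ (Finset.univ.filter (fun v : Fin n => v.val < k)) := by
          ext v
          simp [Fin.ext_iff]
          omega
        rw [hins, Finset.sum_insert (by simp), add_comm]
    rw [hsum n le_rfl, Finset.filter_true_of_mem (fun v _ => v.2), G.sum_degrees_eq_twice_card_edges,
      Set.ncard_eq_toFinset_card', SimpleGraph.edgeFinset]
  · intro v hv w
    have hoff := inputStore_off_succ (nbrs := nbrs) ⟨v, hv⟩
    have htgt := inputStore_tgt (nbrs := nbrs) ⟨v, hv⟩
    simp only at hoff htgt
    constructor
    · rintro ⟨_, hw, hA⟩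
      obtain ⟨k, hk, hkw⟩ := List.getElem_of_mem (((h ⟨v, hv⟩).2 ⟨w, hw⟩).2 hA)
      exact ⟨_, Nat.le_add_right _ k, by omega, by rw [htgt k hk, hkw]⟩
    · rintro ⟨j, hj, hj', rfl⟩
      obtain ⟨k, rfl⟩ := Nat.exists_eq_add_of_le hj
      have hk : k < (nbrs ⟨v, hv⟩).length := by omega
      rw [htgt k hk]
      exact ⟨hv, Fin.isLt _, ((h ⟨v, hv⟩).2 _).1 (List.getElem_mem hk)⟩
  · intro v hv i j hi hi' hj hj' hij
    have hoff := inputStore_off_succ (nbrs := nbrs) ⟨v, hv⟩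
    have htgt := inputStore_tgt (nbrs := nbrs) ⟨v, hv⟩
    simp only at hoff htgt
    obtain ⟨k, rfl⟩ := Nat.exists_eq_add_of_le hi
    obtain ⟨k', rfl⟩ := Nat.exists_eq_add_of_le hj
    rw [htgt k (by omega), htgt k' (by omega)] at hij
    rw [((h ⟨v, hv⟩).1.getElem_inj_iff).1 (Fin.ext hij)]

variable {l : ℕ} {off tgt num ord par cnt : ℕ → ℕ} {tail head j e : ℕ}

theorem SearchInv.isSearchOrder (h : SearchInv n l (natAdj G) off tgt num ord tail head j e n) :
    IsSearchOrder G num := by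
  have h0 : ∀ v : Fin n, num v ≠ 0 := fun v => h.found v v.2
  refine ⟨fun v => Nat.pos_of_ne_zero (h0 v), fun v => (h.num_le v v.2).trans h.tail_le, ?_, ?_⟩
  · intro u v huv
    have h1 := h.ord_num u u.2 (h0 u)
    have h2 := h.ord_num v v.2 (h0 v)
    rw [huv] at h1
    exact Fin.ext (h1.symm.trans h2)
  · intro v
    rcases h.search v v.2 (h0 v) with ⟨u, ⟨hu, hv, hA⟩, -, hlt⟩ | hcl
    · exact .inl ⟨⟨u, hu⟩, hA, hlt⟩
    · exact .inr fun u w hA hlt => (hcl u w (natAdj_val.2 hA) (h0 u) hlt).2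

/-- Lists have no repetitions, so counted positions correspond to earlier neighbours, and `1 < cnt
i` says that there are two different ones. -/
theorem ParentInv.isElimination (h : ParentInv n l off tgt num par cnt n l)
    (hA : IsAdjacencyArray n l (natAdj G) off tgt) (hs : IsSearchOrder G num)
    (hsurj : ∀ r, 1 ≤ r → r ≤ n → ∃ v : Fin n, num v = r) (hG : IsBlockGraph G) :
    IsElimination n (rankAdj G num) par (fun i => decide (1 < cnt i)) := by
  have key : ∀ (v : Fin n) a, a < num v ∧ rankAdj G num a (num v) ↔
      ∃ i ∈ earlierPos off tgt num v l, num (tgt i) = a := by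
    intro v a
    constructor
    · rintro ⟨hlt, ⟨u, v', rfl, hv', hadj⟩⟩
      obtain rfl := hs.inj _ _ hv'
      obtain ⟨i, hi, hi', hiu⟩ := (hA.adj v' v'.2 u).1 (natAdj_val.2 hadj.symm)
      have : off (v' + 1) ≤ l := hA.off_le v'.2
      exact ⟨i, Finset.mem_filter.2 ⟨Finset.mem_range.2 (by omega), hi, hi', by rwa [hiu]⟩, by rw [hiu]⟩
    · rintro ⟨i, hi, rfl⟩
      obtain ⟨-, h1, h2, h3⟩ := Finset.mem_filter.1 hi
      obtain ⟨hv, ht, hadj⟩ := hA.adj_tgt v.2 h1 h2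
      exact ⟨h3, ⟨tgt i, ht⟩, v, rfl, rfl, hadj.symm⟩
  refine hs.isElimination hG ?_ ?_ ?_
  · intro i hi hin a ha hR
    obtain ⟨v, rfl⟩ := hsurj i hi hin
    obtain ⟨k, hk, rfl⟩ := (key v a).1 ⟨ha, hR⟩
    exact h.le_par v v.2 k hk
  · intro i hi hin
    obtain ⟨v, rfl⟩ := hsurj i hi hin
    rcases h.par_eq v v.2 with h0 | ⟨k, hk, h1⟩
    · exact .inl h0
    · exact .inr ((key v _).2 ⟨k, hk, h1.symm⟩)
  · intro i hi hin
    obtain ⟨v, rfl⟩ := hsurj i hi hin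
    rw [decide_eq_true_iff, h.cnt_eq v v.2, Finset.one_lt_card]
    constructor
    · rintro ⟨k, hk, k', hk', hne⟩
      have h1 := (key v _).2 ⟨k, hk, rfl⟩
      have h2 := (key v _).2 ⟨k', hk', rfl⟩
      refine ⟨_, _, fun hh => hne ?_, h1.1, h2.1, h1.2, h2.2⟩
      obtain ⟨-, m1, m2, -⟩ := Finset.mem_filter.1 hk
      obtain ⟨-, m3, m4, -⟩ := Finset.mem_filter.1 hk'
      have e := hs.inj ⟨_, hA.tgt_lt v.2 m1 m2⟩ ⟨_, hA.tgt_lt v.2 m3 m4⟩ hh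
      exact hA.inj v v.2 k k' m1 m2 m3 m4 (Fin.mk.inj_iff.1 e)
    · rintro ⟨a, b, hne, ha, hb, hRa, hRb⟩
      obtain ⟨k, hk, rfl⟩ := (key v a).1 ⟨ha, hRa⟩
      obtain ⟨k', hk', rfl⟩ := (key v b).1 ⟨hb, hRb⟩
      exact ⟨k, hk, k', hk', fun hh => hne (by rw [hh])⟩

end WordRAM

/-! ### Domination in terms of vertices and of their numbers -/

namespace LiarVE

variable {n : ℕ} {G : SimpleGraph (Fin n)} {num : ℕ → ℕ}

theorem nearEdge_rankAdj (hs : IsSearchOrder G num) {x y u : Fin n} :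
    NearEdge (rankAdj G num) (num x) (num y) (num u) ↔ u ∈ edgeClosedNbhd G s(x, y) := by
  have hi : ∀ a b : Fin n, num a = num b ↔ a = b := fun a b => ⟨hs.inj a b, fun h => by rw [h]⟩
  simp only [NearEdge, hs.rankAdj_iff, hi, edgeClosedNbhd, closedNbhd, Sym2.mem_iff, Set.mem_ofPred_eq,
    Set.mem_insert_iff, SimpleGraph.mem_neighborSet, exists_eq_or_imp, exists_eq_left]
  tauto

theorem isLiarVEDominating_iff_good (hs : IsSearchOrder G num) (S : Finset (Fin n)) :
    IsLiarVEDominating G S ↔ Good (rankAdj G num) (· ∈ S.image fun v : Fin n => num v) := by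
  have hi : ∀ a b : Fin n, num a = num b ↔ a = b := fun a b => ⟨hs.inj a b, fun h => by rw [h]⟩
  constructor
  · rintro ⟨h1, h2⟩
    refine ⟨?_, ?_⟩
    · rintro _ _ ⟨x, y, rfl, rfl, hA⟩
      obtain ⟨a, b, ha, hb, hne⟩ := (Set.one_lt_ncard_iff (Set.toFinite _)).1 (h1 s(x, y) hA)
      exact ⟨num a, num b, by rwa [Ne, hi], Finset.mem_image_of_mem _ ha.2,
        Finset.mem_image_of_mem _ hb.2, (nearEdge_rankAdj hs).2 ha.1, (nearEdge_rankAdj hs).2 hb.1⟩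
    · rintro _ _ _ _ ⟨x, y, rfl, rfl, hA⟩ ⟨z, w, rfl, rfl, hB⟩ n1 n2
      simp only [hi] at n1 n2
      obtain ⟨a, b, c, ha, hb, hc, hab, hac, hbc⟩ := (Set.two_lt_ncard_iff (Set.toFinite _)).1
        (h2 s(x, y) hA s(z, w) hB (by rw [Ne, Sym2.eq_iff]; tauto))
      exact ⟨num a, num b, num c, by rwa [Ne, hi], by rwa [Ne, hi], by rwa [Ne, hi],
        Finset.mem_image_of_mem _ ha.2, Finset.mem_image_of_mem _ hb.2, Finset.mem_image_of_mem _ hc.2,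
        ha.1.imp (nearEdge_rankAdj hs).2 (nearEdge_rankAdj hs).2,
        hb.1.imp (nearEdge_rankAdj hs).2 (nearEdge_rankAdj hs).2,
        hc.1.imp (nearEdge_rankAdj hs).2 (nearEdge_rankAdj hs).2⟩
  · rintro ⟨h1, h2⟩
    refine ⟨?_, ?_⟩
    · intro e
      induction e using Sym2.ind with | _ x y
      intro hA
      obtain ⟨u₁, u₂, hne, s1, s2, n1, n2⟩ := h1 _ _ (hs.rankAdj_iff.2 hA)
      obtain ⟨a, ha, rfl⟩ := Finset.mem_image.1 s1
      obtain ⟨b, hb, rfl⟩ := Finset.mem_image.1 s2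
      exact (Set.one_lt_ncard_iff (Set.toFinite _)).2 ⟨a, b, ⟨(nearEdge_rankAdj hs).1 n1, ha⟩,
        ⟨(nearEdge_rankAdj hs).1 n2, hb⟩, by rwa [Ne, hi] at hne⟩
    · intro e hA f hB hef
      induction e using Sym2.ind with | _ x y
      induction f using Sym2.ind with | _ z w
      rw [Ne, Sym2.eq_iff, not_or] at hef
      obtain ⟨u₁, u₂, u₃, d1, d2, d3, s1, s2, s3, n1, n2, n3⟩ := h2 (num x) (num y) (num z) (num w)
        (hs.rankAdj_iff.2 hA) (hs.rankAdj_iff.2 hB) (by simpa only [hi] using hef.1)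
        (by simpa only [hi] using hef.2)
      obtain ⟨a, ha, rfl⟩ := Finset.mem_image.1 s1
      obtain ⟨b, hb, rfl⟩ := Finset.mem_image.1 s2
      obtain ⟨c, hc, rfl⟩ := Finset.mem_image.1 s3
      rw [Ne, hi] at d1 d2 d3
      exact (Set.two_lt_ncard_iff (Set.toFinite _)).2 ⟨a, b, c,
        ⟨n1.imp (nearEdge_rankAdj hs).1 (nearEdge_rankAdj hs).1, ha⟩,
        ⟨n2.imp (nearEdge_rankAdj hs).1 (nearEdge_rankAdj hs).1, hb⟩,
        ⟨n3.imp (nearEdge_rankAdj hs).1 (nearEdge_rankAdj hs).1, hc⟩, d1, d2, d3⟩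

/-- Two distinct edges have at least three ends. This provides the feasible set that
`IsTable.optimal` needs. -/
theorem good_Icc {R : ℕ → ℕ → Prop} {par : ℕ → ℕ} {full : ℕ → Bool} (h : IsElimination n R par full) :
    Good R (· ∈ Finset.Icc 1 n) := by
  have hm : ∀ x y, R x y → x ∈ Finset.Icc 1 n := fun x y hxy =>
    Finset.mem_Icc.2 ⟨h.pos _ _ hxy, h.le _ _ hxy⟩
  have hne : ∀ x y, R x y → x ≠ y := fun x y hxy e => h.irrefl y (e ▸ hxy)
  refine ⟨fun x y hxy => ⟨x, y, hne x y hxy, hm x y hxy, hm y x (h.symm _ _ hxy), .inl rfl,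
    .inr (.inl rfl)⟩, ?_⟩
  intro x y z w hxy hzw n1 n2
  have e1 := hne x y hxy
  have e2 := hne z w hzw
  by_cases hz : z = x ∨ z = y
  · exact ⟨x, y, w, e1, by omega, by omega, hm x y hxy, hm y x (h.symm _ _ hxy),
      hm w z (h.symm _ _ hzw), .inl (.inl rfl), .inl (.inr (.inl rfl)), .inr (.inr (.inl rfl))⟩
  · exact ⟨x, y, z, e1, by omega, by omega, hm x y hxy, hm y x (h.symm _ _ hxy), hm z w hzw,
      .inl (.inl rfl), .inl (.inr (.inl rfl)), .inr (.inl rfl)⟩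

end LiarVE

/-! ### The algorithm -/

namespace WordRAM

open LiarVE

/-- The algorithm: number the vertices by a graph search, find the last earlier neighbour of each
vertex, fill the table from the last vertex to the first, and reconstruct an optimal set. -/
noncomputable def liarProg {N : ℕ} (M : Automaton N) : Prog :=
  .seq searchProg <| .seq parentInit <| .seq parentLoop <| .seq (tableInitStart M) <|
    .seq (tableInitLoop M) <| .seq (.assign 11 (.var 0)) <| .seq (tableLoop M) <| .seq (pickProg M) <|
    .seq (splitLoop N) <| .seq (.assign 11 (.const 1)) (outputLoop M)

/-- A bound for the steps of `liarProg` per vertex and edge. -/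
noncomputable def liarCost {N : ℕ} (M : Automaton N) : ℕ :=
  2 * ((Cond.lt (.var 5) (.var 0)).cost + 1 + searchBody.cost) + parentInit.cost +
    2 * ((Cond.lt (.var 7) (.var 0)).cost + 1 + parentBody.cost) + (tableInitStart M).cost +
    (nodeCond.cost + 1 + (tableInitBody M).cost) + 2 +
    (tableCond.cost + 1 + (tableBody M).cost) + (pickProg M).cost +
    (nodeCond.cost + 1 + (splitBody N).cost) + 2 + (nodeCond.cost + 1 + (outputBody M).cost)

theorem liarProg_run {N : ℕ} {M : Automaton N} (hM : M.init true ≠ M.init false)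
    (hrec : ∀ (n : ℕ) (R : ℕ → ℕ → Prop) (par : ℕ → ℕ) (full : ℕ → Bool),
      IsElimination n R par full → ∀ L : Finset ℕ, L ⊆ Finset.Icc 1 n →
        ∃ st, IsRun M n par full L st ∧ (M.acc (st 0 0) ↔ Good R (· ∈ L)))
    {n : ℕ} {G : SimpleGraph (Fin n)} (hG : IsBlockGraph G) {nbrs : Fin n → List (Fin n)}
    (hnbrs : IsAdjacencyLists G nbrs) {W : ℕ}
    (hW : N * (n + 1) + 2 * n + 2 * G.edgeSet.ncard + N + 5 < W) :
    ∃ t σ, Run W (liarProg M) (inputStore nbrs) t σ ∧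
      t ≤ liarCost M * (n + G.edgeSet.ncard + 1) ∧
      IsMinimumLiarVEDominating G (outputSet n σ) := by
  have hA := inputStore_isAdjacencyArray hnbrs
  have hN : 0 < N := M.empty.pos
  have hE := (M.empty).2
  generalize hm : G.edgeSet.ncard = m at *
  obtain ⟨t₁, σ₁, r₁, ht₁, a0, a1, an, az, tail, head, j, e, hinv⟩ := searchProg_run hA (W := W)
    (by omega) (σ := inputStore nbrs) rfl rfl
    (fun a ha => by funext i; simp [inputStore, show a ≠ 0 by omega, show a ≠ 1 by omega]) rfl
    (fun x hx => by simp [inputStore, show x ≠ 0 by omega])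
  have hs := hinv.isSearchOrder
  have htail := hinv.tail_eq
  -- From here on `tail` is the number of vertices.
  subst htail
  have hsurj : ∀ r, 1 ≤ r → r ≤ tail → ∃ v : Fin tail, σ₁.arr 3 v = r := fun r h1 h2 =>
    ⟨⟨_, hinv.ord_lt r h1 h2⟩, hinv.num_ord r h1 h2⟩
  obtain ⟨t₂, σ₂, r₂, ht₂, rfl⟩ := wp.run (W := W) (P := parentInit)
    (Q := fun τ => τ = (σ₁.setVar 7 0).setVar 8 0) (σ := σ₁)
    ⟨by simp only [Expr.Fits]; omega, by simp only [Expr.Fits]; omega, rfl⟩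
  obtain ⟨t₃, σ₃, r₃, ht₃, cn, cf, hpar⟩ := parentLoop_run hA (num := σ₁.arr 3)
    (fun u v hu hv h => by simpa using hs.inj ⟨u, hu⟩ ⟨v, hv⟩ h) (fun u hu => hs.le ⟨u, hu⟩) (W := W)
    (by omega) (σ := (σ₁.setVar 7 0).setVar 8 0) a0 a1 rfl (az 5 (by omega) (by omega) (by omega))
    (az 6 (by omega) (by omega) (by omega)) (by simpa using an) (by simp) (by simp)
  have helim := hpar.isElimination hA hs hsurj hG
  have cz : ∀ a, 2 ≤ a → a ≠ 3 → a ≠ 4 → a ≠ 5 → a ≠ 6 → σ₃.arr a = fun _ => 0 :=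
    fun a h2 h3 h4 h5 h6 => (cf a h5 h6).trans (az a h2 h3 h4)
  obtain ⟨t₄, σ₄, r₄, ht₄, rfl⟩ := wp.run (W := W) (P := tableInitStart M)
    (Q := fun τ => τ = (σ₃.setArr 8 M.empty (tail + 1)).setVar 11 1) (σ := σ₃)
    ⟨by simp only [Expr.Fits]; omega, by simp only [Expr.Fits, Expr.eval]; omega,
      by simp only [Expr.Fits]; omega, by simp [Expr.eval, cn]⟩
  obtain ⟨t₅, σ₅, r₅, ht₅, dn, df, dt⟩ := tableInitLoop_run M hM (W := W) (n := tail) (by omega)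
    (σ := (σ₃.setArr 8 M.empty (tail + 1)).setVar 11 1) (by
      intro p q
      have := tableOf_update (σ₃.arr 8) 0 p M.empty q (tail + 1)
      rw [mul_zero, zero_add] at this
      simp only [Store.setVar_arr, Store.setArr_arr, if_true, this]
      simp only [cz 8 (by omega) (by omega) (by omega) (by omega) (by omega), initGain, tableOf]
      split_ifs <;> tauto) (by simpa using cn) (by simp)
  have df' : ∀ a, a ≠ 8 → σ₅.arr a = σ₃.arr a := fun a ha => (df a ha).trans (by simp [ha])
  obtain ⟨t₆, σ₆, r₆, ht₆, rfl⟩ := wp.run (W := W) (P := .assign 11 (.var 0))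
    (Q := fun τ => τ = σ₅.setVar 11 tail) (σ := σ₅)
    ⟨by simp only [Expr.Fits]; omega, by simp [Expr.eval, dn]⟩
  have hcnt : ∀ i, 1 ≤ i → i ≤ tail → σ₃.arr 6 i < W := by
    intro i hi hin
    obtain ⟨v, rfl⟩ := hsurj i hi hin
    rw [hpar.cnt_eq v v.2]
    refine (Finset.card_filter_le _ _).trans_lt ?_
    rw [Finset.card_range]
    omega
  obtain ⟨t₇, σ₇, r₇, ht₇, en, ef, e9, e10, htab⟩ := tableLoop_run M (W := W) (n := tail) (by omega)
    helim.par_lt hcnt (σ := σ₅.setVar 11 tail) hM (df' 5 (by omega)) (df' 6 (by omega)) dt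
    ((df' 9 (by omega)).trans (cz 9 (by omega) (by omega) (by omega) (by omega) (by omega)))
    ((df' 10 (by omega)).trans (cz 10 (by omega) (by omega) (by omega) (by omega) (by omega)))
    (by simpa using dn) (by simp)
  have ef' : ∀ a, a < 8 → σ₇.arr a = σ₃.arr a := fun a ha =>
    (ef a (by omega) (by omega) (by omega) (by omega)).trans (df' a (by omega))
  obtain ⟨t₈, σ₈, r₈, ht₈, fn, f11, ff, c, hc, hbest⟩ := wp.run (pickProg_wp M (W := W) (n := tail)
    (σ := σ₇) (by
      have := Nat.le_mul_of_pos_right N (Nat.succ_pos tail)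
      omega)
    ((ef' 7 (by omega)).trans (cz 7 (by omega) (by omega) (by omega) (by omega) (by omega)))
    (fun q => htab.le 0 q le_rfl))
  obtain ⟨t₉, σ₉, r₉, ht₉, gn, gf, g7⟩ := splitLoop_run (W := W) (n := tail) (by omega) helim.par_lt
    (b₁ := fun j q => ⟨_, e9 j q⟩) (b₂ := fun j q => ⟨_, e10 j q⟩) (σ := σ₈)
    ((ff 5 (by omega)).trans (ef' 5 (by omega))) hc (fun j q => by rw [ff 9 (by omega)])
    (fun j q => by rw [ff 10 (by omega)]) (fn.trans en) f11
  obtain ⟨t₁₀, σ₁₀, r₁₀, ht₁₀, rfl⟩ := wp.run (W := W) (P := .assign 11 (.const 1))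
    (Q := fun τ => τ = σ₉.setVar 11 1) (σ := σ₉) ⟨by simp only [Expr.Fits]; omega, rfl⟩
  have gf' : ∀ a, a < 5 → σ₉.arr a = σ₁.arr a := fun a ha => (gf a (by omega)).trans <|
    (ff a (by omega)).trans <| (ef' a (by omega)).trans (cf a (by omega) (by omega))
  obtain ⟨t₁₁, σ₁₁, r₁₁, ht₁₁, hout⟩ := outputLoop_run M (W := W) (n := tail) (by omega)
    (num := σ₁.arr 3) hinv.ord_lt hinv.num_ord (fun v hv => hs.pos ⟨v, hv⟩)
    (fun v hv => hs.le ⟨v, hv⟩) (fun v hv => hinv.ord_num v hv (hinv.found v hv))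
    (σ := σ₉.setVar 11 1) ((gf' 2 (by omega)).trans (az 2 (by omega) (by omega) (by omega)))
    (gf' 4 (by omega)) g7 (by simpa using gn) (by simp)
  obtain ⟨L, hL, hgood, hmin, hsplit⟩ := htab.optimal (hrec _ _ _ _ helim) (good_Icc helim) hbest
    (b₁ := fun j q => ⟨_, e9 j q⟩) (b₂ := fun j q => ⟨_, e10 j q⟩) (fun j _ _ q => ⟨rfl, rfl⟩) rfl
  have hinj : Function.Injective fun v : Fin tail => σ₁.arr 3 v := fun u v h => hs.inj u v h
  -- The injection `num` carries the returned set onto the optimal set of numbers, so minimality can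
  -- be compared through images.
  have hset : (outputSet tail σ₁₁).image (fun v : Fin tail => σ₁.arr 3 v) = L := by
    have hiff : ∀ v : Fin tail, v ∈ outputSet tail σ₁₁ ↔ σ₁.arr 3 v ∈ L := by
      intro v
      rw [outputSet, Finset.mem_filter, hout v v.2, hsplit _ (hs.pos v) (hs.le v)]
      by_cases hv : σ₁.arr 3 v ∈ L
      · simp [hv]
      · simp [hv, hM.symm]
    ext r
    rw [Finset.mem_image]
    constructor
    · rintro ⟨v, hv, rfl⟩
      exact (hiff v).1 hv
    · intro hr
      obtain ⟨h1, h2⟩ := Finset.mem_Icc.1 (hL hr)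
      obtain ⟨v, rfl⟩ := hsurj r h1 h2
      exact ⟨v, (hiff v).2 hr, rfl⟩
  refine ⟨_, σ₁₁, .seq r₁ <| .seq r₂ <| .seq r₃ <| .seq r₄ <| .seq r₅ <| .seq r₆ <| .seq r₇ <|
    .seq r₈ <| .seq r₉ <| .seq r₁₀ r₁₁, ?_, ?_, ?_⟩
  -- The adjacency array has length `2 * m`, whence the factors 2 in `liarCost`.
  · have b₁ : (2 * m + 2 * tail + 1) ≤ 2 * (tail + m + 1) := by omega
    have b₃ : (2 * m + tail + 1) ≤ 2 * (tail + m + 1) := by omega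
    have bn : tail + 1 ≤ tail + m + 1 := by omega
    have lin : ∀ x, x ≤ x * (tail + m + 1) := fun x => Nat.le_mul_of_pos_right x (by omega)
    have c₁ := ht₁.trans (Nat.mul_le_mul_left _ b₁)
    have c₂ := ht₂.trans (lin _)
    have c₃ := ht₃.trans (Nat.mul_le_mul_left _ b₃)
    have c₄ := ht₄.trans (lin _)
    have c₅ := ht₅.trans (Nat.mul_le_mul_left _ bn)
    have c₆ := ht₆.trans (lin _)
    have c₇ := ht₇.trans (Nat.mul_le_mul_left _ bn)
    have c₈ := ht₈.trans (lin _)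
    have c₉ := ht₉.trans (Nat.mul_le_mul_left _ bn)
    have c₁₀ := ht₁₀.trans (lin _)
    have c₁₁ := ht₁₁.trans (Nat.mul_le_mul_left _ bn)
    have k₆ : (Prog.assign 11 (.var 0)).cost = 2 := rfl
    have k₁₀ : (Prog.assign 11 (.const 1)).cost = 2 := rfl
    rw [k₆] at c₆
    rw [k₁₀] at c₁₀
    rw [← mul_assoc, mul_comm _ 2] at c₁ c₃
    simp only [liarCost, add_mul _ _ (tail + m + 1)] at *
    omega
  · exact (isLiarVEDominating_iff_good hs _).2 (by rw [hset]; exact hgood)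
  · intro L' hL'
    rw [← Finset.card_image_of_injective _ hinj, ← Finset.card_image_of_injective L' hinj, hset]
    refine hmin _ ?_ ((isLiarVEDominating_iff_good hs _).1 hL')
    intro r hr
    obtain ⟨v, -, rfl⟩ := Finset.mem_image.1 hr
    exact Finset.mem_Icc.2 ⟨hs.pos v, hs.le v⟩

end WordRAM

/-! ### The theorem -/

theorem mainTheorem1 :
    ∃ (P : WordRAM.Prog) (c : ℕ),
      ∀ (n : ℕ) (G : SimpleGraph (Fin n)), LiarVE.IsBlockGraph G →
        ∀ nbrs : Fin n → List (Fin n), WordRAM.IsAdjacencyLists G nbrs →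
          ∃ (t : ℕ) (σ : WordRAM.Store),
            WordRAM.Run ((n + G.edgeSet.ncard + 2) ^ c) P (WordRAM.inputStore nbrs) t σ ∧
            t ≤ c * (n + G.edgeSet.ncard + 1) ∧
            LiarVE.IsMinimumLiarVEDominating G (WordRAM.outputSet n σ) := by
  obtain ⟨N, M, hM, hrec⟩ := LiarVE.exists_automaton
  -- The summand `liarCost M` pays for the steps. The summand `2 * N + 8` makes words long enough:
  -- numbers stay below `(2 * N + 7) * (n + m + 2)`, and the base `n + m + 2` is at least 2.
  refine ⟨WordRAM.liarProg M, WordRAM.liarCost M + 2 * N + 8, fun n G hG nbrs hnbrs => ?_⟩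
  have hW : N * (n + 1) + 2 * n + 2 * G.edgeSet.ncard + N + 5 <
      (n + G.edgeSet.ncard + 2) ^ (WordRAM.liarCost M + 2 * N + 8) := by
    generalize G.edgeSet.ncard = m
    calc N * (n + 1) + 2 * n + 2 * m + N + 5 < (2 * N + 7) * (n + m + 2) := by nlinarith
      _ ≤ 2 ^ (2 * N + 7) * (n + m + 2) := Nat.mul_le_mul_right _ Nat.lt_two_pow_self.le
      _ ≤ (n + m + 2) ^ (2 * N + 7) * (n + m + 2) :=
        Nat.mul_le_mul_right _ (Nat.pow_le_pow_left (by omega) _)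
      _ = (n + m + 2) ^ (2 * N + 8) := (pow_succ _ _).symm
      _ ≤ _ := Nat.pow_le_pow_right (by omega) (by omega)
  obtain ⟨t, σ, hr, ht, hmin⟩ := WordRAM.liarProg_run hM (fun n R par full he L hL => by
    obtain ⟨st, h1, h2, h3, h4⟩ := hrec n R par full he L hL
    exact ⟨st, ⟨h1, h2, h3⟩, h4⟩) hG hnbrs hW
  exact ⟨t, σ, hr, ht.trans (Nat.mul_le_mul_right _ (by omega)), hmin⟩
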